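/- Let $\mathring{\mathfrak g}$ be a finite dimensional simple complex Lie algebra with Cartan subalgebra $\mathfrak a$, roots $\mathring R$, simple roots $\alpha_1,\dots,\alpha_n$, highest root $\theta$, coroots $h_\alpha$ ($h_i=h_{\alpha_i}$), and a Chevalley basis with root vectors $e_\alpha$ ($\alpha\in\mathring R$, $[e_\alpha,e_{-\alpha}]=h_\alpha$). Let $V$ be a faithful finite dimensional $\mathring{\mathfrak g}$-module and $M\subset V$ an admissible lattice (spanned over $\mathbb Z$ by a $\mathbb C$-basis of $V$ and stable under all $e_\alpha^m/m!$). Let $\Bbbk$ be any field, and let either $\mathbb F=\Bbbk((\epsilon))$, $\mathfrak o=\Bbbk[[\epsilon]]$, or $\mathbb F=\Bbbk[\epsilon,\epsilon^{-1}]$, $\mathfrak o=\Bbbk[\epsilon]$. For a commutative ring $R$ and $f\in R$ let $x_\alpha(f)=\sum_m f^m\,e_\alpha^m/m!\in GL(M\otimes R)$, and let the loop group be the Chevalley group $G=\langle x_\alpha(f)\mid \alpha\in\mathring R,\ f\in\mathbb F\rangle\subseteq GL(M\otimes\mathbb F)$. Let $U^+(\Bbbk)=\langle x_\alpha(c)\mid\alpha\in\mathring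 R^+,c\in\Bbbk\rangle$ and $H(\Bbbk^\times)=\langle h_{\alpha_i^\vee}(d)\mid 1\le i\le n,d\in\Bbbk^\times\rangle$ in $GL(M\otimes\Bbbk)$, where $h_{\alpha^\vee}(d)$ is the image of $\mathrm{diag}(d,d^{-1})$ under the homomorphism from $SL_2$ with $\begin{pmatrix}1&c\\0&1\end{pmatrix}\mapsto x_\alpha(c)$ and $\begin{pmatrix}1&0\\c&1\end{pmatrix}\mapsto x_{-\alpha}(c)$, and let $$I^+=\{g\in G\mid g(0)\text{ exists (i.e. } g\in GL(M\otimes\mathfrak o)) \text{ and } g(0)\in U^+(\Bbbk)H(\Bbbk^\times)\},$$ where $g(0)$ is $g$ evaluated at $\epsilon=0$. Put $x_{\pm\alpha_i}(c)$ as above for $1\le i\le n$ and $x_{\alpha_0}(c)=x_{-\theta}(c\epsilon)$, $x_{-\alpha_0}(c)=x_{\theta}(c\epsilon^{-1})$. For $i\in\{0,\dots,n\}$ and $c\in\Bbbk$ let $y_i(c)\in G$ be the image of $\begin{pmatrix}c&1\\-1&0\end{pmatrix}$ under the homomorphism $SL_2(\Bbbk)\to G$ with $\begin{pmatrix}1&c\\0&1\end{pmatrix}\mapsto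 x_{\alpha_i}(c)$, $\begin{pmatrix}1&0\\c&1\end{pmatrix}\mapsto x_{-\alpha_i}(c)$. Let $W^{\mathrm{ad}}$ be the affine Weyl group, i.e. the subgroup of $GL((\mathfrak a\oplus\mathbb CK\oplus\mathbb Cd)^*)$ generated by $s_i\colon\lambda\mapsto\lambda-\lambda(h_i)\alpha_i$, $i\in\{0,\dots,n\}$, with $\alpha_0=-\theta+\delta$ and $h_0=-h_\theta+K$, where $\delta$ is the functional with $\delta(d)=1$ that vanishes on $\mathfrak a\oplus\mathbb CK$. Let $<$ be its Bruhat order ($x\le w$ if $x$ has a reduced word which is a subword of a reduced word of $w$). Let $C(G/I^+)$ be the space of finite $\mathbb C$-linear combinations of cosets $gI^+$, and let $T_{s_j}=I^+n_{s_j}I^+$ with $n_{s_j}=y_j(0)$. The double coset $T_{s_j}$ acts on $C(G/I^+)$ from the right by convolution, normalized by $I^+\cdot I^+=I^+$: $gI^+\cdot T_{s_j}$ is the formal sum of all cosets $xI^+$ with $g^{-1}x\in I^+n_{s_j}I^+$, each taken once. (If $\Bbbk$ is infinite, infinite formal linear combinations of cosets, i.e. arbitrary functions on $G/I^+$, are allowed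 as values, and infinite sums of such are taken coefficientwise.) Let $w\in W^{\mathrm{ad}}$, let $w=s_{i_1}\cdots s_{i_\ell}$ be a reduced word, let $c_1,\dots,c_\ell\in\Bbbk$ and $j\in\{0,\dots,n\}$. If $ws_j<w$, assume that $i_\ell=j$. Then $$ y_{i_1}(c_1)\cdots y_{i_\ell}(c_\ell)I^+\cdot T_{s_j} =\begin{cases} \displaystyle y_{i_1}(c_1)\cdots y_{i_{\ell-1}}(c_{\ell-1})I^+ + \sum_{\tilde c\in\Bbbk^\times} y_{i_1}(c_1)\cdots y_{i_{\ell-1}}(c_{\ell-1})\,y_{i_\ell}(c_\ell-\tilde c^{-1})I^+, & \text{if } ws_j<w,\\[2ex] \displaystyle \sum_{\tilde c\in\Bbbk} y_{i_1}(c_1)\cdots y_{i_\ell}(c_\ell)\,y_j(\tilde c)I^+, & \text{if } w<ws_j. \end{cases} $$ -/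

import Mathlib

open LieAlgebra LieAlgebra.IsKilling

universe u

noncomputable section

namespace AffineFlag

/-! ### Root data of the finite dimensional Lie algebra -/

section Finite

variable {𝔤 : Type*} [LieRing 𝔤] [LieAlgebra ℂ 𝔤] [FiniteDimensional ℂ 𝔤] [IsKilling ℂ 𝔤]
variable {H : LieSubalgebra ℂ 𝔤} [H.IsCartanSubalgebra]

/-- The root `-α`. -/
def negRoot (α : H.root) : H.root :=
  ⟨-α.1, by simpa using (H.isNonZero_coe_root α)⟩

/-- A Chevalley basis of `𝔤` relative to `H` (only its root vectors `e α` have to be recorded; the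
remaining members are the simple coroots): `e α` lies in the root space of `α`,
`[e α, e (-α)]` is the coroot `h_α`, and `[e α, e β] = ±(p + 1) e (α + β)` whenever `α + β` is a
root, where `p` is the largest integer such that `β - p α` is a root. -/
structure ChevalleyBasis (H : LieSubalgebra ℂ 𝔤) [H.IsCartanSubalgebra] where
  e : H.root → 𝔤
  mem_rootSpace : ∀ α : H.root, e α ∈ rootSpace H α.1
  lie_neg : ∀ α : H.root, ⁅e α, e (negRoot α)⁆ = (coroot α.1 : H)
  lie_add : ∀ α β γ : H.root,
    (rootSystem H).root γ = (rootSystem H).root α + (rootSystem H).root β →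
      ⁅e α, e β⁆ = (((rootSystem H).chainBotCoeff α β + 1 : ℕ) : ℂ) • e γ ∨
      ⁅e α, e β⁆ = -((((rootSystem H).chainBotCoeff α β + 1 : ℕ) : ℂ) • e γ)

/-- `α` is a positive root relative to the base `b`. -/
def IsPositive (b : (rootSystem H).Base) (α : H.root) : Prop :=
  (rootSystem H).root α ∈ AddSubmonoid.closure ((rootSystem H).root '' (b.support : Set H.root))

/-- `θ` is the highest root relative to the base `b`: for every root `α`, the difference `θ - α` is
a sum of simple roots. -/
def IsHighestRoot (b : (rootSystem H).Base) (θ : H.root) : Prop :=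
  ∀ α : H.root, (rootSystem H).root θ - (rootSystem H).root α ∈
    AddSubmonoid.closure ((rootSystem H).root '' (b.support : Set H.root))

/-! ### The affine Weyl group -/

/-- The vertices `0, 1, …, n` of the affine Dynkin diagram: `none` is the vertex `0`, and
`some i` are the vertices of the finite Dynkin diagram (the simple roots). -/
abbrev Node (b : (rootSystem H).Base) : Type _ := Option b.support

/-- The Cartan subalgebra `𝔞 ⊕ ℂ K ⊕ ℂ d` of the affine Lie algebra. -/
abbrev AffineCartan (H : LieSubalgebra ℂ 𝔤) : Type _ := H × ℂ × ℂ

/-- The simple roots `α_0 = -θ + δ, α_1, …, α_n`, as functionals on `𝔞 ⊕ ℂ K ⊕ ℂ d`. -/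
def affineRoot (b : (rootSystem H).Base) (θ : H.root) :
    Node b → Module.Dual ℂ (AffineCartan H)
  | none => -(((rootSystem H).root θ).comp (LinearMap.fst ℂ H (ℂ × ℂ))) +
      (LinearMap.snd ℂ ℂ ℂ).comp (LinearMap.snd ℂ H (ℂ × ℂ))
  | some i => ((rootSystem H).root i.1).comp (LinearMap.fst ℂ H (ℂ × ℂ))

/-- The simple coroots `h_0 = -h_θ + K, h_1, …, h_n`. -/
def affineCoroot (b : (rootSystem H).Base) (θ : H.root) : Node b → AffineCartan H
  | none => (-(rootSystem H).coroot θ, 1, 0)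
  | some i => ((rootSystem H).coroot i.1, 0, 0)

theorem affineRoot_affineCoroot (b : (rootSystem H).Base) (θ : H.root) (i : Node b) :
    Module.Dual.eval ℂ (AffineCartan H) (affineCoroot b θ i) (affineRoot b θ i) = 2 := by
  cases i with
  | none => simpa [affineRoot, affineCoroot] using
      root_apply_coroot (H.isNonZero_coe_root θ)
  | some i => simpa [affineRoot, affineCoroot] using
      root_apply_coroot (H.isNonZero_coe_root i.1)

/-- The simple reflection `λ ↦ λ - λ(h_i) α_i` of the dual of `𝔞 ⊕ ℂ K ⊕ ℂ d`. -/
def affineReflection (b : (rootSystem H).Base) (θ : H.root) (i : Node b) :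
    Module.Dual ℂ (AffineCartan H) ≃ₗ[ℂ] Module.Dual ℂ (AffineCartan H) :=
  Module.reflection (affineRoot_affineCoroot b θ i)

/-- The affine Weyl group, generated by the simple reflections `s_0, …, s_n`. -/
def affineWeyl (b : (rootSystem H).Base) (θ : H.root) :
    Subgroup (Module.Dual ℂ (AffineCartan H) ≃ₗ[ℂ] Module.Dual ℂ (AffineCartan H)) :=
  Subgroup.closure (Set.range (affineReflection b θ))

/-- The generator `s_i` of the affine Weyl group. -/
def simpleRefl (b : (rootSystem H).Base) (θ : H.root) (i : Node b) : affineWeyl b θ :=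
  ⟨affineReflection b θ i, Subgroup.subset_closure ⟨i, rfl⟩⟩

/-- The word `u = (i_1, …, i_ℓ)` is a reduced word for `w`: `s_{i_1} ⋯ s_{i_ℓ} = w`, and no shorter
word has this property. -/
def IsReducedWord (b : (rootSystem H).Base) (θ : H.root) (u : List (Node b))
    (w : affineWeyl b θ) : Prop :=
  (u.map (simpleRefl b θ)).prod = w ∧
    ∀ v : List (Node b), (v.map (simpleRefl b θ)).prod = w → u.length ≤ v.length

/-- The (positive level) Bruhat order on the affine Weyl group: `x` has a reduced word which is a
subword of a reduced word of `w`. -/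
def BruhatLE (b : (rootSystem H).Base) (θ : H.root) (x w : affineWeyl b θ) : Prop :=
  ∃ u v : List (Node b), IsReducedWord b θ u w ∧ IsReducedWord b θ v x ∧ v.Sublist u

/-- The strict (positive level) Bruhat order. -/
def BruhatLT (b : (rootSystem H).Base) (θ : H.root) (x w : affineWeyl b θ) : Prop :=
  BruhatLE b θ x w ∧ x ≠ w

/-! ### Chevalley groups -/

variable {V : Type*} [AddCommGroup V] [Module ℂ V] [LieRingModule 𝔤 V] [LieModule ℂ 𝔤 V]

open scoped Nat in
/-- An admissible lattice in the `𝔤`-module `V`, given by a `ℤ`-basis of it, which is to be a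
`ℂ`-basis of `V`: each divided power `e_α ^ m / m!` has an integral matrix in this basis. The
integral matrices (which are determined by the basis) are recorded as `divPow α m`. -/
structure AdmissibleLattice (C : ChevalleyBasis H) (V : Type*) [AddCommGroup V] [Module ℂ V]
    [LieRingModule 𝔤 V] [LieModule ℂ 𝔤 V] (κ : Type*) [Fintype κ] [DecidableEq κ] where
  basis : Module.Basis κ ℂ V
  divPow : H.root → ℕ → Matrix κ κ ℤ
  divPow_spec : ∀ (α : H.root) (m : ℕ), (divPow α m).map (Int.cast : ℤ → ℂ) =
    LinearMap.toMatrix basis basis ((m ! : ℂ)⁻¹ • (LieModule.toEnd ℂ 𝔤 V (C.e α)) ^ m)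

variable {C : ChevalleyBasis H} {κ : Type*} [Fintype κ] [DecidableEq κ]

namespace AdmissibleLattice

variable (Λ : AdmissibleLattice C V κ)

theorem castMatrix_injective (κ : Type*) :
    Function.Injective (fun A : Matrix κ κ ℤ => A.map (Int.cast : ℤ → ℂ)) :=
  Matrix.map_injective Int.cast_injective

theorem divPow_zero (α : H.root) : Λ.divPow α 0 = 1 := by
  apply castMatrix_injective κ
  simp [Λ.divPow_spec, LinearMap.toMatrix_one]

theorem divPow_mul (α : H.root) (m n : ℕ) :
    Λ.divPow α m * Λ.divPow α n = (m + n).choose m • Λ.divPow α (m + n) := by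
  apply castMatrix_injective κ
  have h1 : ((Λ.divPow α m * Λ.divPow α n).map (Int.cast : ℤ → ℂ)) =
      (Λ.divPow α m).map (Int.cast : ℤ → ℂ) * (Λ.divPow α n).map (Int.cast : ℤ → ℂ) :=
    Matrix.map_mul (f := Int.castRingHom ℂ)
  have h2 : (((m + n).choose m • Λ.divPow α (m + n)).map (Int.cast : ℤ → ℂ)) =
      ((m + n).choose m : ℂ) • (Λ.divPow α (m + n)).map (Int.cast : ℤ → ℂ) := by
    ext i j
    rw [Matrix.map_apply, Matrix.smul_apply, Matrix.smul_apply, Matrix.map_apply, nsmul_eq_mul,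
      Int.cast_mul, Int.cast_natCast, smul_eq_mul]
  simp only [h1, h2, Λ.divPow_spec, map_smul, smul_mul_assoc, mul_smul_comm, smul_smul,
    ← LinearMap.toMatrix_mul, ← pow_add]
  congr 1
  have hm : (m.factorial : ℂ) ≠ 0 := by exact_mod_cast m.factorial_ne_zero
  have hn : (n.factorial : ℂ) ≠ 0 := by exact_mod_cast n.factorial_ne_zero
  have hmn : ((m + n).factorial : ℂ) ≠ 0 := by exact_mod_cast (m + n).factorial_ne_zero
  have := Nat.add_choose_mul_factorial_mul_factorial n m
  rw [add_comm n m] at this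
  have h3 : ((m + n).choose m : ℂ) * m.factorial * n.factorial = (m + n).factorial := by
    rw [mul_right_comm]; exact_mod_cast this
  field_simp
  linear_combination -h3

theorem isNilpotent_toEnd (C : ChevalleyBasis H) [FiniteDimensional ℂ V] (α : H.root) :
    IsNilpotent (LieModule.toEnd ℂ 𝔤 V (C.e α)) := by
  set h : 𝔤 := ((coroot α.1 : H) : 𝔤)
  set E := LieModule.toEnd ℂ 𝔤 V (C.e α)
  set A := LieModule.toEnd ℂ 𝔤 V h
  have h2 : ⁅h, C.e α⁆ = (2 : ℂ) • C.e α := by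
    have := lie_eq_smul_of_mem_rootSpace (C.mem_rootSpace α) (coroot α.1 : H)
    rwa [root_apply_coroot (H.isNonZero_coe_root α)] at this
  have h3 : A * E - E * A = (2 : ℂ) • E := by
    ext v
    have := congrArg (fun z : 𝔤 => ⁅z, v⁆) h2
    simp only [lie_lie, smul_lie] at this
    simpa [A, E] using this
  have h4 : ∀ m : ℕ, A * E ^ m - E ^ m * A = (2 * m : ℂ) • E ^ m := by
    intro m
    induction m with
    | zero => simp
    | succ m ih =>
      have : A * E ^ (m + 1) - E ^ (m + 1) * A =
          (A * E ^ m - E ^ m * A) * E + E ^ m * (A * E - E * A) := by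
        simp only [pow_succ]; noncomm_ring
      rw [this, ih, h3, smul_mul_assoc, mul_smul_comm, ← pow_succ, ← add_smul]
      congr 1; push_cast; ring
  by_contra hE
  let D : Module.End ℂ (Module.End ℂ V) := LinearMap.mulLeft ℂ A - LinearMap.mulRight ℂ A
  have h5 : ∀ m : ℕ, D.HasEigenvalue (2 * m : ℂ) := by
    intro m
    refine Module.End.hasEigenvalue_of_hasEigenvector (x := E ^ m) ⟨?_, ?_⟩
    · rw [Module.End.mem_eigenspace_iff]
      simpa [D] using h4 m
    · intro h0; exact hE ⟨m, h0⟩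
  have hinj : Function.Injective (fun m : ℕ => (2 * m : ℂ)) := by
    intro a b hab; simpa using hab
  exact Set.infinite_of_injective_forall_mem hinj h5 D.finite_hasEigenvalue

theorem divPow_eq_zero (α : H.root) {m : ℕ} (hm : Fintype.card κ ≤ m) : Λ.divPow α m = 0 := by
  have : FiniteDimensional ℂ V := Λ.basis.finiteDimensional_of_finite
  apply castMatrix_injective κ
  have hn := isNilpotent_toEnd (V := V) C α
  have h0 : (LieModule.toEnd ℂ 𝔤 V (C.e α)) ^ (Fintype.card κ) = 0 := by
    have hc := LinearMap.aeval_self_charpoly (LieModule.toEnd ℂ 𝔤 V (C.e α))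
    rw [hn.charpoly_eq_X_pow_finrank, Module.finrank_eq_card_basis Λ.basis] at hc
    simpa using hc
  simp [Λ.divPow_spec, pow_eq_zero_of_le hm h0]

variable {F : Type*} [CommRing F]

/-- The integral matrix of `e_α ^ m / m!`, over the ring `F`. -/
def divPowIn (F : Type*) [CommRing F] (α : H.root) (m : ℕ) : Matrix κ κ F :=
  (Λ.divPow α m).map (Int.cast : ℤ → F)

/-- The matrix `exp (f e_α) = ∑ₘ f ^ m (e_α ^ m / m!)` over the ring `F`
(the terms with `m ≥ card κ` vanish). -/
def rootMatrix (α : H.root) (f : F) : Matrix κ κ F :=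
  ∑ m ∈ Finset.range (Fintype.card κ), f ^ m • Λ.divPowIn F α m

theorem divPowIn_mul (α : H.root) (m n : ℕ) :
    Λ.divPowIn F α m * Λ.divPowIn F α n = ((m + n).choose m : F) • Λ.divPowIn F α (m + n) := by
  have h1 : ((Λ.divPow α m * Λ.divPow α n).map (Int.cast : ℤ → F)) =
      Λ.divPowIn F α m * Λ.divPowIn F α n := Matrix.map_mul (f := Int.castRingHom F)
  rw [← h1, divPow_mul]
  ext i j
  rw [Matrix.map_apply, Matrix.smul_apply, Matrix.smul_apply, divPowIn, Matrix.map_apply,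
    nsmul_eq_mul, Int.cast_mul, Int.cast_natCast, smul_eq_mul]

theorem rootMatrix_eq_sum (α : H.root) (f : F) {N : ℕ} (hN : Fintype.card κ ≤ N) :
    Λ.rootMatrix α f = ∑ m ∈ Finset.range N, f ^ m • Λ.divPowIn F α m := by
  refine Finset.sum_subset (Finset.range_mono hN) fun m _ hm => ?_
  have : Fintype.card κ ≤ m := by simpa using hm
  ext i j; simp [divPowIn, Λ.divPow_eq_zero α this]

theorem rootMatrix_mul (α : H.root) (f g : F) :
    Λ.rootMatrix α f * Λ.rootMatrix α g = Λ.rootMatrix α (f + g) := by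
  set N := Fintype.card κ
  have key : ∀ s : ℕ, (f + g) ^ s • Λ.divPowIn F α s = ∑ p ∈ Finset.HasAntidiagonal.antidiagonal s,
      (f ^ p.1 • Λ.divPowIn F α p.1) * (g ^ p.2 • Λ.divPowIn F α p.2) := by
    intro s
    rw [(Commute.all f g).add_pow', Finset.sum_smul]
    refine Finset.sum_congr rfl fun p hp => ?_
    have hs : p.1 + p.2 = s := by simpa using hp
    rw [smul_mul_smul_comm, divPowIn_mul, hs, smul_smul, nsmul_eq_mul, mul_comm]
  have hz : ∀ p : ℕ × ℕ, N ≤ p.1 ∨ N ≤ p.2 →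
      (f ^ p.1 • Λ.divPowIn F α p.1) * (g ^ p.2 • Λ.divPowIn F α p.2) = 0 := by
    have h0 : ∀ m, N ≤ m → Λ.divPowIn F α m = 0 := fun m hm => by
      ext i j; simp [divPowIn, Λ.divPow_eq_zero α hm]
    rintro p (h | h) <;> simp [h0 _ h]
  rw [Λ.rootMatrix_eq_sum α (f + g) (N := 2 * N) (by omega)]
  simp only [key]
  rw [rootMatrix, rootMatrix, Finset.sum_mul_sum, ← Finset.sum_product', Finset.sum_sigma']
  symm
  refine Finset.sum_bij_ne_zero (fun x _ _ => x.2) ?_ ?_ ?_ ?_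
  · rintro ⟨s, p⟩ _ h
    simp only [Finset.mem_product, Finset.mem_range]
    by_contra hc
    exact h (hz p (by omega))
  · rintro ⟨s, p⟩ h _ ⟨s', p'⟩ h' _ hp
    simp only [Finset.mem_sigma, Finset.HasAntidiagonal.mem_antidiagonal] at h h'
    simp only at hp
    subst hp
    obtain rfl : s = s' := by omega
    rfl
  · rintro p hp hne
    simp only [Finset.mem_product, Finset.mem_range] at hp
    exact ⟨⟨p.1 + p.2, p⟩, by simp; omega, hne, rfl⟩
  · intros; rfl

theorem rootMatrix_zero (α : H.root) : Λ.rootMatrix α (0 : F) = 1 := by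
  rw [Λ.rootMatrix_eq_sum α 0 (Nat.le_succ _), Finset.sum_range_succ', Finset.sum_eq_zero]
  · simp [divPowIn, divPow_zero]
  · intros; simp

/-- The matrix `exp (f e_α)`, as an element of the general linear group. -/
def rootElem (α : H.root) (f : F) : GL κ F where
  val := Λ.rootMatrix α f
  inv := Λ.rootMatrix α (-f)
  val_inv := by rw [rootMatrix_mul, add_neg_cancel, rootMatrix_zero]
  inv_val := by rw [rootMatrix_mul, neg_add_cancel, rootMatrix_zero]

/-- The Chevalley group over `F` attached to the lattice: the group generated by all
`x_α(f) = exp (f e_α)`. -/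
def chevalleyGroup (F : Type*) [CommRing F] : Subgroup (GL κ F) :=
  Subgroup.closure {g | ∃ (α : H.root) (f : F), g = Λ.rootElem α f}

/-- `h_{α^∨}(d)`, the image of `diag(d, d⁻¹)` under the homomorphism `φ_α` from `SL₂` which maps
`!![1, f; 0, 1]` to `x_α(f)` and `!![1, 0; f, 1]` to `x_{-α}(f)`. We use
`diag(d, d⁻¹) = !![0, d; -d⁻¹, 0] * !![0, -1; 1, 0]` and
`!![0, d; -d⁻¹, 0] = !![1, d; 0, 1] * !![1, 0; -d⁻¹, 1] * !![1, d; 0, 1]`. -/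
def corootElem (α : H.root) (d : Fˣ) : GL κ F :=
  Λ.rootElem α (d : F) * Λ.rootElem (negRoot α) (-((d⁻¹ : Fˣ) : F)) * Λ.rootElem α (d : F) *
    (Λ.rootElem α (-1) * Λ.rootElem (negRoot α) 1 * Λ.rootElem α (-1))

/-- The group `U⁺(k) H(kˣ)`: generated by the `x_α(c)` with `α` positive and by the `h_{α_i^∨}(d)`
with `α_i` simple. -/
def borel (b : (rootSystem H).Base) (k : Type*) [Field k] : Subgroup (GL κ k) :=
  Subgroup.closure {g | ∃ (α : H.root) (c : k), IsPositive b α ∧ g = Λ.rootElem α c} ⊔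
    Subgroup.closure {g | ∃ i ∈ b.support, ∃ d : kˣ, g = Λ.corootElem i d}

end AdmissibleLattice

end Finite

/-! ### Loop groups -/

/-- A ring `F` of loops over `k`, its subring `o` (via `incl`) of the loops that can be evaluated
at `ε = 0`, this evaluation, the constants, and the unit `ε`. -/
structure LoopRing (k : Type u) [Field k] where
  F : Type u
  o : Type u
  [commRingF : CommRing F]
  [commRingO : CommRing o]
  incl : o →+* F
  evalZero : o →+* k
  const : k →+* F
  eps : Fˣ

attribute [instance] LoopRing.commRingF LoopRing.commRingO

/-- The case `F = k((ε))`, `o = k[[ε]]`. -/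
def LoopRing.series (k : Type*) [Field k] : LoopRing k where
  F := LaurentSeries k
  o := PowerSeries k
  incl := HahnSeries.ofPowerSeries ℤ k
  evalZero := PowerSeries.constantCoeff
  const := HahnSeries.C
  eps := Units.mk0 (HahnSeries.single 1 1) (by simp)

/-- The case `F = k[ε, ε⁻¹]`, `o = k[ε]`. -/
def LoopRing.polynomial (k : Type*) [Field k] : LoopRing k where
  F := LaurentPolynomial k
  o := Polynomial k
  incl := Polynomial.toLaurent
  evalZero := Polynomial.constantCoeff
  const := LaurentPolynomial.C
  eps := ⟨LaurentPolynomial.T 1, LaurentPolynomial.T (-1), by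
    rw [← LaurentPolynomial.T_add, add_neg_cancel, LaurentPolynomial.T_zero], by
    rw [← LaurentPolynomial.T_add, neg_add_cancel, LaurentPolynomial.T_zero]⟩

section Loop

variable {𝔤 : Type*} [LieRing 𝔤] [LieAlgebra ℂ 𝔤] [FiniteDimensional ℂ 𝔤] [IsKilling ℂ 𝔤]
variable {H : LieSubalgebra ℂ 𝔤} [H.IsCartanSubalgebra]
variable {V : Type*} [AddCommGroup V] [Module ℂ V] [LieRingModule 𝔤 V] [LieModule ℂ 𝔤 V]
variable {C : ChevalleyBasis H} {κ : Type*} [Fintype κ] [DecidableEq κ]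
variable (Λ : AdmissibleLattice C V κ) {k : Type*} [Field k] (L : LoopRing k)

/-- The loop group `G`: the Chevalley group over the ring of loops. -/
abbrev LoopGroup : Type _ := Λ.chevalleyGroup L.F

/-- `x_α(f)`, as an element of the loop group. -/
def xElem (α : H.root) (f : L.F) : LoopGroup Λ L :=
  ⟨Λ.rootElem α f, Subgroup.subset_closure ⟨α, f, rfl⟩⟩

/-- The positive Iwahori subgroup `I⁺`: all `g` in the loop group such that `g(0)` exists and lies
in `U⁺(k) H(kˣ)`. -/
def iwahori (b : (rootSystem H).Base) : Subgroup (LoopGroup Λ L) :=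
  (((Λ.borel b k).comap (Matrix.GeneralLinearGroup.map L.evalZero)).map
    (Matrix.GeneralLinearGroup.map L.incl)).subgroupOf (Λ.chevalleyGroup L.F)

variable (b : (rootSystem H).Base) (θ : H.root)

/-- `x_{α_i}(c)` for a vertex `i` of the affine Dynkin diagram;
`x_{α_0}(c) = x_{-θ+δ}(c) = x_{-θ}(c ε)`. -/
def xPos : Node b → k → LoopGroup Λ L
  | none, c => xElem Λ L (negRoot θ) (L.const c * (L.eps : L.F))
  | some i, c => xElem Λ L i.1 (L.const c)

/-- `x_{-α_i}(c)` for a vertex `i` of the affine Dynkin diagram;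
`x_{-α_0}(c) = x_{θ-δ}(c) = x_θ(c ε⁻¹)`. -/
def xNeg : Node b → k → LoopGroup Λ L
  | none, c => xElem Λ L θ (L.const c * ((L.eps⁻¹ : (L.F)ˣ) : L.F))
  | some i, c => xElem Λ L (negRoot i.1) (L.const c)

/-- `y_i(c)`, the image of `!![c, 1; -1, 0]` under the homomorphism `φ_i` from `SL₂(k)` which maps
`!![1, c; 0, 1]` to `x_{α_i}(c)` and `!![1, 0; c, 1]` to `x_{-α_i}(c)`. We use
`!![c, 1; -1, 0] = !![1, 1 - c; 0, 1] * !![1, 0; -1, 1] * !![1, 1; 0, 1]`. -/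
def yElem (i : Node b) (c : k) : LoopGroup Λ L :=
  xPos Λ L b θ i (1 - c) * xNeg Λ L b θ i (-1) * xPos Λ L b θ i 1

/-- The product `y_{i_1}(c_1) ⋯ y_{i_ℓ}(c_ℓ)` of a labelled word `((i_1, c_1), …, (i_ℓ, c_ℓ))`. -/
def yWord (p : List (Node b × k)) : LoopGroup Λ L :=
  (p.map fun q => yElem Λ L b θ q.1 q.2).prod

/-- `n_z = y_{j_1}(0) ⋯ y_{j_r}(0)` for a word `(j_1, …, j_r)` for `z`. -/
def nWord (u : List (Node b)) : LoopGroup Λ L :=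
  (u.map fun j => yElem Λ L b θ j 0).prod

end Loop

/-! ### The affine flag representation and the Hecke algebra action -/

section Hecke

variable {G : Type*} [Group G] (I : Subgroup G)

/-- The double coset `I x⁻¹ y I` of two cosets `x I`, `y I`. -/
def relPosition (x y : G ⧸ I) : DoubleCoset.Quotient (I : Set G) (I : Set G) :=
  Quotient.liftOn₂' x y (fun g h => DoubleCoset.mk I I (g⁻¹ * h)) (by
    intro g h g' h' hg hh
    rw [QuotientGroup.leftRel_apply] at hg hh
    refine (DoubleCoset.eq I I _ _).2 ⟨(g⁻¹ * g')⁻¹, I.inv_mem hg, h⁻¹ * h', hh, ?_⟩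
    group)

/-- The element `T = I g I` (the formal sum of the elements of this double coset), as a function on
the set of double cosets. -/
def doubleCosetSum (g : G) : DoubleCoset.Quotient (I : Set G) (I : Set G) → ℂ :=
  Set.indicator {DoubleCoset.mk I I g} 1

/-- The coset `g I` (the formal sum of its elements), as an element of the space `C(G/I)` of
finite linear combinations of cosets. -/
def cosetBasis (g : G) : (G ⧸ I) →₀ ℂ := Finsupp.single (g : G ⧸ I) 1

/-- The right action of a possibly infinite formal linear combination `T` of double cosets
`I h I` on `C(G/I)`: the convolution product for the Haar measure of total mass `1` on `I`,
`(a · T)(x) = ∫ a(y) T(y⁻¹ x) dy = ∑_{y I ∈ G/I} a(y I) T(I y⁻¹ x I)`.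
Its values are formal, possibly infinite, linear combinations of cosets, that is,
functions on `G/I`. -/
def heckeAct (a : (G ⧸ I) →₀ ℂ) (T : DoubleCoset.Quotient (I : Set G) (I : Set G) → ℂ) :
    G ⧸ I → ℂ :=
  fun x => a.sum fun y r => r * T (relPosition I y x)

end Hecke

end AffineFlag

end

noncomputable section

namespace AffineFlag

/-! ### Conjugation by the exponential of a nilpotent element -/

section Exp

variable {A : Type*} [Ring A] [Algebra ℚ A]

/-! Everything rests on one fact: with `n = y_j(0)`, the double coset `I n I` is the disjoint union
of the cosets `y_j(t) I`, `t ∈ k`. Translating by `g` gives `g I · T = ∑ₜ g y_j(t) I`, which is the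
formula for `w < w s_j`. When the last letter is `j`, put `c = c_ℓ` and use, in `SL₂`, `y(c) y(0) =
!![-1, c; 0, -1]` and `y(c) y(t) = y(c - t⁻¹) !![t, 1; 0, t⁻¹]` for `t ≠ 0`. Upper triangular
matrices land in `I`, so the term `t = 0` is the coset of the shortened word and the other terms are
the cosets of `y(c - t⁻¹)` (`exists_hasSum_yElem`).

The decomposition of `I n I` follows from `I = x_{α_j}(k) Q`, where `Q` is generated by the integral
torus and by all positive affine root groups, that of `α_j` being replaced by its part of higher
level, and where `n` normalizes `Q` (`exists_nodeElem_inv_mul_mem`,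
`nodeWeyl_conj_mem_nodeRadical`). This is proved for the group generated by the integral torus and
the positive affine root groups, whereas `I` is defined by a condition on `g(0)`. The two are
compared over `k((ε))` by `mem_iwahoriGen_of_mem_bigIwahori`: the Bruhat decomposition writes an
element of the loop group as `x n_u y`, with `x`, `y` in the generated group and `u` a word. If it
satisfies the condition on `g(0)`, so does `n_u`. The group defined by that condition contains no
root group of a negative affine root, so the exchange condition shortens `u` until nothing is left.
Laurent polynomials are embedded in Laurent series, and the condition on `g(0)` can be tested there
(`map_mem_bigIwahori_iff`).

The Chevalley relations are needed over arbitrary commutative rings. They are proved over `ℂ`, where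
the torus is `exp (z h_α)`, and transferred through a universal ring which embeds in `ℂ`
(`exists_lift_to_complex`). The signs are `±1` because a root vector is a primitive integral matrix
(`exists_not_dvd_divPow_one`). The commutator formula `rootElem_conj_mem` comes from a grading
argument over `ℤ[s, t]`. -/

/-- `ad X` is the sum of left multiplication by `X` and right multiplication by `-X`. These commute
and are nilpotent, so the exponential of the sum is the product of the exponentials. -/
theorem exp_mul_mul_exp_neg {X : A} (hX : IsNilpotent X) (Y : A) :
    IsNilpotent.exp X * Y * IsNilpotent.exp (-X) =
      IsNilpotent.exp (LinearMap.mulLeft ℚ X - LinearMap.mulRight ℚ X) Y := by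
  obtain ⟨n, hn⟩ := hX
  have hl : IsNilpotent (LinearMap.mulLeft ℚ X) := ⟨n, by rw [LinearMap.pow_mulLeft, hn]; simp⟩
  have hr' : (LinearMap.mulRight ℚ (-X)) ^ n = 0 := by
    rw [LinearMap.pow_mulRight, neg_pow, hn]; simp
  have hr : IsNilpotent (LinearMap.mulRight ℚ (-X)) := ⟨n, hr'⟩
  have h1 : LinearMap.mulLeft ℚ X - LinearMap.mulRight ℚ X =
      LinearMap.mulLeft ℚ X + LinearMap.mulRight ℚ (-X) := by
    ext; simp [sub_eq_add_neg]
  have hc : Commute (LinearMap.mulLeft ℚ X) (LinearMap.mulRight ℚ (-X)) :=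
    LinearMap.commute_mulLeft_right (R := ℚ) X (-X)
  have hn' : (LinearMap.mulLeft ℚ X) ^ n = 0 := by rw [LinearMap.pow_mulLeft, hn]; simp
  have hn2 : (-X) ^ n = 0 := by rw [neg_pow, hn, mul_zero]
  rw [h1, IsNilpotent.exp_add_of_commute hc hl hr, IsNilpotent.exp_eq_sum hn',
    IsNilpotent.exp_eq_sum hr', IsNilpotent.exp_eq_sum hn, IsNilpotent.exp_eq_sum hn2]
  simp only [Module.End.mul_apply, LinearMap.sum_apply, LinearMap.smul_apply,
    LinearMap.pow_mulLeft, LinearMap.pow_mulRight, LinearMap.mulLeft_apply,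
    LinearMap.mulRight_apply]
  rw [mul_assoc, Finset.sum_mul]
  simp only [Finset.mul_sum, smul_mul_assoc, mul_smul_comm, Finset.smul_sum]
  exact Finset.sum_congr rfl fun a _ => Finset.sum_congr rfl fun c _ => smul_comm _ _ _

theorem isNilpotent_mulLeft_sub_mulRight {X : A} (hX : IsNilpotent X) :
    IsNilpotent (LinearMap.mulLeft ℚ X - LinearMap.mulRight ℚ X) := by
  obtain ⟨n, hn⟩ := hX
  refine (LinearMap.commute_mulLeft_right (R := ℚ) X X).isNilpotent_sub ⟨n, ?_⟩ ⟨n, ?_⟩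
  · rw [LinearMap.pow_mulLeft, hn]; simp
  · rw [LinearMap.pow_mulRight, hn]; simp

/-- The conjugate is a finite sum of rational multiples of `(ad X) ^ i Y`, each of which stays in
`S`. -/
theorem exp_mul_mul_exp_neg_mem {X : A} (hX : IsNilpotent X) (S : Submodule ℚ A)
    (hS : ∀ Y ∈ S, X * Y - Y * X ∈ S) {Y : A} (hY : Y ∈ S) :
    IsNilpotent.exp X * Y * IsNilpotent.exp (-X) ∈ S := by
  rw [exp_mul_mul_exp_neg hX, IsNilpotent.exp, LinearMap.sum_apply]
  refine Submodule.sum_mem _ fun i hi => Submodule.smul_mem _ _ ?_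
  clear hi
  induction i with
  | zero => simpa using hY
  | succ i ih => rw [pow_succ']; exact hS _ ih

/-- The series for `exp (ad X)` stops at the quadratic term. This covers the action of a root vector
on the Cartan subalgebra and on its own `sl₂`-triple. -/
theorem exp_mul_mul_exp_neg_of_order_three {X : A} (hX : IsNilpotent X) {Y Z W : A}
    (h1 : X * Y - Y * X = Z) (h2 : X * Z - Z * X = W) (h3 : X * W - W * X = 0) :
    IsNilpotent.exp X * Y * IsNilpotent.exp (-X) = Y + Z + (2⁻¹ : ℚ) • W := by
  have e1 : (LinearMap.mulLeft ℚ X - LinearMap.mulRight ℚ X) Y = Z := h1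
  have e2 : (LinearMap.mulLeft ℚ X - LinearMap.mulRight ℚ X) Z = W := h2
  have e3 : (LinearMap.mulLeft ℚ X - LinearMap.mulRight ℚ X) W = 0 := h3
  have := IsNilpotent.exp_smul_eq_sum (A := Module.End ℚ A) (m := Y) (k := 3)
    (a := LinearMap.mulLeft ℚ X - LinearMap.mulRight ℚ X)
    (by simp [pow_succ', Module.End.mul_apply, e1, e2, e3]) (isNilpotent_mulLeft_sub_mulRight hX)
  rw [exp_mul_mul_exp_neg hX, ← Module.End.smul_def, this]
  simp [Finset.sum_range_succ, pow_succ', Module.End.mul_apply, e1, e2]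

end Exp

/-! ### Root elements as exponentials -/

section Finite

variable {𝔤 : Type*} [LieRing 𝔤] [LieAlgebra ℂ 𝔤] [FiniteDimensional ℂ 𝔤] [IsKilling ℂ 𝔤]
variable {H : LieSubalgebra ℂ 𝔤} [H.IsCartanSubalgebra]
variable {V : Type*} [AddCommGroup V] [Module ℂ V] [LieRingModule 𝔤 V] [LieModule ℂ 𝔤 V]
variable {C : ChevalleyBasis H} {κ : Type*} [Fintype κ] [DecidableEq κ]

namespace AdmissibleLattice

variable (Λ : AdmissibleLattice C V κ)

/-- The matrix representation of `𝔤` given by the basis of the lattice. -/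
def rep : 𝔤 →ₗ[ℂ] Matrix κ κ ℂ :=
  (LinearMap.toMatrixAlgEquiv Λ.basis).toLinearMap ∘ₗ (LieModule.toEnd ℂ 𝔤 V : 𝔤 →ₗ[ℂ] _)

theorem rep_apply (x : 𝔤) :
    Λ.rep x = LinearMap.toMatrixAlgEquiv Λ.basis (LieModule.toEnd ℂ 𝔤 V x) := rfl

theorem rep_injective (hV : Function.Injective (LieModule.toEnd ℂ 𝔤 V)) :
    Function.Injective Λ.rep :=
  (LinearMap.toMatrixAlgEquiv Λ.basis).injective.comp hV

theorem rep_lie (x y : 𝔤) : Λ.rep ⁅x, y⁆ = Λ.rep x * Λ.rep y - Λ.rep y * Λ.rep x := by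
  have : LieModule.toEnd ℂ 𝔤 V ⁅x, y⁆ = LieModule.toEnd ℂ 𝔤 V x * LieModule.toEnd ℂ 𝔤 V y -
      LieModule.toEnd ℂ 𝔤 V y * LieModule.toEnd ℂ 𝔤 V x := by
    ext v; simp
  simp only [rep_apply, this, map_sub, map_mul]

open scoped Nat in
theorem divPowIn_complex (α : H.root) (m : ℕ) :
    Λ.divPowIn ℂ α m = (m ! : ℂ)⁻¹ • Λ.rep (C.e α) ^ m := by
  rw [divPowIn, Λ.divPow_spec, map_smul]
  congr 1
  exact map_pow (LinearMap.toMatrixAlgEquiv Λ.basis) _ m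

theorem divPowIn_map {F F' : Type*} [CommRing F] [CommRing F'] (φ : F →+* F') (α : H.root)
    (m : ℕ) : (Λ.divPowIn F α m).map φ = Λ.divPowIn F' α m := by
  ext i j; simp [divPowIn]

theorem rootMatrix_map {F F' : Type*} [CommRing F] [CommRing F'] (φ : F →+* F') (α : H.root)
    (f : F) : (Λ.rootMatrix α f).map φ = Λ.rootMatrix α (φ f) := by
  ext i j
  simp [rootMatrix, Matrix.sum_apply, divPowIn]

theorem map_rootElem {F F' : Type*} [CommRing F] [CommRing F'] (φ : F →+* F') (α : H.root)
    (f : F) : Matrix.GeneralLinearGroup.map φ (Λ.rootElem α f) = Λ.rootElem α (φ f) :=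
  Units.ext (Λ.rootMatrix_map φ α f)

theorem rootElem_add {F : Type*} [CommRing F] (α : H.root) (f g : F) :
    Λ.rootElem α (f + g) = Λ.rootElem α f * Λ.rootElem α g :=
  Units.ext (Λ.rootMatrix_mul α f g).symm

theorem rootElem_zero {F : Type*} [CommRing F] (α : H.root) :
    Λ.rootElem α (0 : F) = 1 := Units.ext (Λ.rootMatrix_zero α)

theorem rootElem_neg {F : Type*} [CommRing F] (α : H.root) (f : F) :
    Λ.rootElem α (-f) = (Λ.rootElem α f)⁻¹ := by
  rw [eq_inv_iff_mul_eq_one, ← rootElem_add, neg_add_cancel, rootElem_zero]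

/-- The matrix of `x ∈ 𝔤` over a `ℂ`-algebra. -/
def repIn (R : Type*) [CommRing R] [Algebra ℂ R] (x : 𝔤) : Matrix κ κ R :=
  (Λ.rep x).map (algebraMap ℂ R)

theorem rep_pow_card (α : H.root) : Λ.rep (C.e α) ^ Fintype.card κ = 0 := by
  have h := Λ.divPowIn_complex α (Fintype.card κ)
  have h0 : Λ.divPowIn ℂ α (Fintype.card κ) = 0 := by
    ext i j; simp [divPowIn, Λ.divPow_eq_zero α le_rfl]
  rw [h0] at h
  have : (((Fintype.card κ).factorial : ℂ))⁻¹ ≠ 0 :=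
    inv_ne_zero (by exact_mod_cast Nat.factorial_ne_zero _)
  simpa [this] using h.symm

theorem repIn_pow_card (R : Type*) [CommRing R] [Algebra ℂ R] (α : H.root) :
    Λ.repIn R (C.e α) ^ Fintype.card κ = 0 := by
  have : Λ.repIn R (C.e α) = (algebraMap ℂ R).mapMatrix (Λ.rep (C.e α)) := rfl
  rw [this, ← map_pow, rep_pow_card, map_zero]

theorem isNilpotent_smul_repIn {R : Type*} [CommRing R] [Algebra ℂ R] (α : H.root) (f : R) :
    IsNilpotent (f • Λ.repIn R (C.e α)) :=
  ⟨_, by rw [smul_pow, repIn_pow_card, smul_zero]⟩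

theorem rootMatrix_eq_exp {R : Type*} [CommRing R] [Algebra ℂ R] [Algebra ℚ R] (α : H.root)
    (f : R) : Λ.rootMatrix α f = IsNilpotent.exp (f • Λ.repIn R (C.e α)) := by
  rw [IsNilpotent.exp_eq_sum (k := Fintype.card κ) (by rw [smul_pow, repIn_pow_card, smul_zero]),
    rootMatrix]
  refine Finset.sum_congr rfl fun m _ => ?_
  have h1 : Λ.divPowIn R α m = (Λ.divPowIn ℂ α m).map (algebraMap ℂ R) :=
    (Λ.divPowIn_map _ α m).symm
  have h2 : (algebraMap ℂ R).mapMatrix (Λ.rep (C.e α) ^ m) = Λ.repIn R (C.e α) ^ m := by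
    rw [map_pow]; rfl
  have h3 : (algebraMap ℂ R) ((m.factorial : ℂ)⁻¹) = algebraMap ℚ R ((m.factorial : ℚ)⁻¹) := by
    -- `R` carries unrelated algebra structures over `ℂ` and `ℚ`; ring homomorphisms from `ℚ` are
    -- unique, so both give the same `1 / m!`.
    have : Subsingleton (ℚ →+* R) := inferInstance
    have h := DFunLike.congr_fun
      (Subsingleton.elim ((algebraMap ℂ R).comp (algebraMap ℚ ℂ)) (algebraMap ℚ R))
      ((m.factorial : ℚ)⁻¹)
    rw [← h]; simp
  rw [h1, divPowIn_complex, smul_pow, ← h2]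
  ext i j
  simp only [Matrix.smul_apply, Matrix.map_apply, smul_eq_mul, map_mul, RingHom.mapMatrix_apply,
    h3, Algebra.smul_def (R := ℚ)]
  ring

/-- Serves twice: for the image of `𝔤` in the complex matrices, and for the graded matrices behind
the commutator formula. -/
theorem rootMatrix_conj_mem {R : Type*} [CommRing R] [Algebra ℂ R] [Algebra ℚ R]
    (S : Submodule ℚ (Matrix κ κ R)) (α : H.root) (f : R)
    (hS : ∀ Y ∈ S, (f • Λ.repIn R (C.e α)) * Y - Y * (f • Λ.repIn R (C.e α)) ∈ S)
    {Y : Matrix κ κ R} (hY : Y ∈ S) :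
    (Λ.rootElem α f : Matrix κ κ R) * Y * ((Λ.rootElem α f)⁻¹ : GL κ R) ∈ S := by
  have h := exp_mul_mul_exp_neg_mem (Λ.isNilpotent_smul_repIn α f) S hS hY
  rw [← neg_smul, ← rootMatrix_eq_exp, ← rootMatrix_eq_exp] at h
  exact h

/-- Stating the second bracket as `2 • W` absorbs the `1 / 2!` of the exponential series, so that no
denominator remains. -/
theorem rootElem_conj_repIn {R : Type*} [CommRing R] [Algebra ℂ R] [Algebra ℚ R]
    (α : H.root) (f : R) {Y Z W : Matrix κ κ R}
    (h1 : Λ.repIn R (C.e α) * Y - Y * Λ.repIn R (C.e α) = Z)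
    (h2 : Λ.repIn R (C.e α) * Z - Z * Λ.repIn R (C.e α) = (2 : R) • W)
    (h3 : Λ.repIn R (C.e α) * W - W * Λ.repIn R (C.e α) = 0) :
    (Λ.rootElem α f : Matrix κ κ R) * Y * ((Λ.rootElem α f)⁻¹ : GL κ R) =
      Y + f • Z + f ^ 2 • W := by
  have h := exp_mul_mul_exp_neg_of_order_three (Λ.isNilpotent_smul_repIn α f) (Y := Y)
    (Z := f • Z) (W := (f ^ 2 * 2) • W) ?_ ?_ ?_
  · rw [← neg_smul, ← rootMatrix_eq_exp, ← rootMatrix_eq_exp] at h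
    refine h.trans ?_
    congr 1
    have : (2⁻¹ : ℚ) • ((f ^ 2 * 2) • W) = ((2⁻¹ : ℚ) • (f ^ 2 * 2)) • W := by
      ext i j; simp [Matrix.smul_apply]
    rw [this]; congr 1
    rw [mul_comm, ← smul_mul_assoc]
    have : (2⁻¹ : ℚ) • (2 : R) = 1 := by
      rw [Algebra.smul_def, ← map_ofNat (algebraMap ℚ R) 2, ← map_mul]; norm_num
    rw [this, one_mul]
  · rw [smul_mul_assoc, mul_smul_comm, ← smul_sub, h1]
  · rw [smul_mul_smul_comm, smul_mul_smul_comm, ← smul_sub, h2, smul_smul]; congr 1; ring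
  · rw [smul_mul_smul_comm, smul_mul_smul_comm, mul_comm (f ^ 2 * 2) f, ← smul_sub, h3, smul_zero]

end AdmissibleLattice

end Finite

end AffineFlag

end

noncomputable section

namespace AffineFlag

/-! ### The `sl₂`-triples of a Chevalley basis -/

section Finite

variable {𝔤 : Type*} [LieRing 𝔤] [LieAlgebra ℂ 𝔤] [FiniteDimensional ℂ 𝔤] [IsKilling ℂ 𝔤]
variable {H : LieSubalgebra ℂ 𝔤} [H.IsCartanSubalgebra]

@[simp] theorem root_negRoot (α : H.root) :
    (rootSystem H).root (negRoot α) = -(rootSystem H).root α := by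
  ext x; simp [negRoot]

@[simp] theorem negRoot_negRoot (α : H.root) : negRoot (negRoot α) = α := by
  apply Subtype.ext; simp [negRoot]

@[simp] theorem coroot_negRoot (α : H.root) : coroot (negRoot α).1 = -coroot α.1 := by
  simp [negRoot, coroot_neg]

theorem negRoot_eq_reflectionPerm (α : H.root) :
    negRoot α = (rootSystem H).reflectionPerm α α := by
  apply (rootSystem H).root.injective
  rw [root_negRoot, (rootSystem H).root_reflectionPerm, (rootSystem H).reflection_apply_self]

namespace ChevalleyBasis

variable (C : ChevalleyBasis H)

theorem lie_cartan (h : H) (α : H.root) :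
    ⁅(h : 𝔤), C.e α⁆ = (rootSystem H).root α h • C.e α :=
  lie_eq_smul_of_mem_rootSpace (C.mem_rootSpace α) h

theorem lie_coroot_self (α : H.root) :
    ⁅((coroot α.1 : H) : 𝔤), C.e α⁆ = (2 : ℂ) • C.e α := by
  rw [C.lie_cartan]
  congr 1
  exact root_apply_coroot (H.isNonZero_coe_root α)

theorem lie_coroot_neg (α : H.root) :
    ⁅((coroot α.1 : H) : 𝔤), C.e (negRoot α)⁆ = -((2 : ℂ) • C.e (negRoot α)) := by
  rw [C.lie_cartan, root_negRoot, LinearMap.neg_apply, neg_smul]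
  congr 2
  exact root_apply_coroot (H.isNonZero_coe_root α)

theorem coroot_ne_zero (α : H.root) : ((coroot α.1 : H) : 𝔤) ≠ 0 := by
  intro h
  have h0 : coroot α.1 = 0 := Subtype.ext h
  have := root_apply_coroot (H.isNonZero_coe_root α)
  rw [h0] at this; simp at this

theorem e_ne_zero (α : H.root) : C.e α ≠ 0 := by
  intro h
  apply coroot_ne_zero α
  rw [← C.lie_neg α, h, zero_lie]

theorem isSl2Triple (α : H.root) :
    IsSl2Triple ((coroot α.1 : H) : 𝔤) (C.e α) (C.e (negRoot α)) where
  h_ne_zero := coroot_ne_zero α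
  lie_e_f := C.lie_neg α
  lie_h_e_nsmul := by rw [C.lie_coroot_self, ofNat_smul_eq_nsmul ℂ 2]
  lie_h_f_nsmul := by rw [C.lie_coroot_neg, ofNat_smul_eq_nsmul ℂ 2]

end ChevalleyBasis

/-! ### Primitivity of root vectors in the lattice -/

variable {V : Type*} [AddCommGroup V] [Module ℂ V] [LieRingModule 𝔤 V] [LieModule ℂ 𝔤 V]
variable {C : ChevalleyBasis H} {κ : Type*} [Fintype κ] [DecidableEq κ]

namespace ChevalleyBasis

variable (C)

/-- On the image of the highest nonvanishing power `E ^ m` of `E = e_α`, the operator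
`E ^ m F ^ m` with `F = e_{-α}` is multiplication by `m! ^ 2`. -/
theorem toEnd_pow_mul_pow_mul_pow (α : H.root) (m : ℕ)
    (h0 : LieModule.toEnd ℂ 𝔤 V (C.e α) ^ (m + 1) = 0) :
    LieModule.toEnd ℂ 𝔤 V (C.e α) ^ m * LieModule.toEnd ℂ 𝔤 V (C.e (negRoot α)) ^ m *
      LieModule.toEnd ℂ 𝔤 V (C.e α) ^ m =
      ((m.factorial : ℂ) ^ 2) • LieModule.toEnd ℂ 𝔤 V (C.e α) ^ m := by
  set t := C.isSl2Triple α
  set E := LieModule.toEnd ℂ 𝔤 V (C.e α)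
  set F := LieModule.toEnd ℂ 𝔤 V (C.e (negRoot α))
  set h : 𝔤 := ((coroot α.1 : H) : 𝔤)
  set A := LieModule.toEnd ℂ 𝔤 V h
  have hAE : A * E = E * A + (2 : ℂ) • E := by
    ext v
    have := congrArg (fun z : 𝔤 => ⁅z, v⁆) (C.lie_coroot_self α)
    simp only [lie_lie, smul_lie] at this
    simpa [A, E, sub_eq_iff_eq_add'] using this
  have hEF : E * F = F * E + A := by
    ext v
    have := congrArg (fun z : 𝔤 => ⁅z, v⁆) (C.lie_neg α)
    simp only [lie_lie] at this
    simpa [A, E, F, h, sub_eq_iff_eq_add'] using this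
  have hApow : ∀ n : ℕ, A * E ^ n = E ^ n * A + (2 * n : ℂ) • E ^ n := by
    intro n
    induction n with
    | zero => simp
    | succ n ih =>
      have e : A * E ^ (n + 1) = (A * E) * E ^ n := by rw [pow_succ', mul_assoc]
      rw [e, hAE, add_mul, mul_assoc, ih, mul_add, ← mul_assoc, ← pow_succ', smul_mul_assoc,
        ← pow_succ', mul_smul_comm, ← pow_succ', add_assoc, ← add_smul]
      congr 2; push_cast; ring
  have hFpow : ∀ n : ℕ, E ^ (n + 1) * F = F * E ^ (n + 1) +
      ((n + 1 : ℂ)) • (E ^ n * A) + ((n : ℂ) * (n + 1)) • E ^ n := by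
    intro n
    induction n with
    | zero => simp [hEF]
    | succ n ih =>
      have e : E ^ (n + 2) * F = E * (E ^ (n + 1) * F) := by
        rw [pow_succ' E (n + 1), mul_assoc]
      rw [e, ih, mul_add, mul_add, ← mul_assoc, hEF, add_mul, mul_assoc F, ← pow_succ', hApow,
        mul_smul_comm, mul_smul_comm, ← mul_assoc, ← pow_succ']
      have e2 : ((n + 1 : ℕ) + 1 : ℂ) • (E ^ (n + 1) * A) =
        (n + 1 : ℂ) • (E ^ (n + 1) * A) + E ^ (n + 1) * A := by
        push_cast; rw [add_smul _ (1 : ℂ), one_smul]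
      have e3 : (((n + 1 : ℕ) : ℂ) * ((n + 1 : ℕ) + 1)) • E ^ (n + 1) =
        ((n : ℂ) * (n + 1)) • E ^ (n + 1) + (2 * ((n + 1 : ℕ) : ℂ)) • E ^ (n + 1) := by
        rw [← add_smul]; congr 1; push_cast; ring
      rw [e2, e3]; abel
  -- Since `E ^ (m + 1) = 0`, the rule for `E ^ (m + 1) F` leaves `E ^ m A = -m E ^ m`, whence `A E
  -- ^ m = m E ^ m`: nonzero vectors in the image of `E ^ m` are highest weight vectors of weight
  -- `m`.
  have hm : A * E ^ m = (m : ℂ) • E ^ m := by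
    have h1 := hFpow m
    rw [h0, zero_mul, mul_zero, zero_add] at h1
    have h2 : (m + 1 : ℂ) ≠ 0 := by exact_mod_cast Nat.succ_ne_zero m
    have h3 : E ^ m * A = -(m : ℂ) • E ^ m := by
      have h4 : (m + 1 : ℂ) • (E ^ m * A + (m : ℂ) • E ^ m) = 0 := by
        rw [smul_add, smul_smul, mul_comm (m + 1 : ℂ) m]; exact h1.symm
      rw [neg_smul]
      exact eq_neg_of_add_eq_zero_left ((smul_eq_zero.1 h4).resolve_left h2)
    rw [hApow, h3, ← add_smul]; congr 1; ring
  ext v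
  simp only [Module.End.mul_apply, LinearMap.smul_apply]
  by_cases hv : (E ^ m) v = 0
  · simp [hv]
  have P : t.HasPrimitiveVectorWith ((E ^ m) v) (m : ℂ) :=
    { ne_zero := hv
      lie_h := by
        have := congrArg (fun T : Module.End ℂ V => T v) hm
        simpa [A] using this
      lie_e := by
        have := congrArg (fun T : Module.End ℂ V => T v) h0
        rw [pow_succ'] at this
        simpa [E] using this }
  -- On a primitive vector of weight `m`, `E F ^ (n + 1)` is `(n + 1)(m - n) F ^ n`; the product of
  -- these factors is `n! · m (m - 1) ⋯ (m - n + 1)`, which is `m! ^ 2` for `n = m`.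
  have key : ∀ n ≤ m, (E ^ n) ((F ^ n) ((E ^ m) v)) =
      ((n.factorial : ℂ) * (m.descFactorial n : ℂ)) • (E ^ m) v := by
    intro n
    induction n with
    | zero => simp
    | succ n ih =>
      intro hn
      have h5 := P.lie_e_pow_succ_toEnd_f n
      have h6 : (E ^ (n + 1)) ((F ^ (n + 1)) ((E ^ m) v)) =
          (E ^ n) (E ((F ^ (n + 1)) ((E ^ m) v))) := by
        rw [pow_succ]; rfl
      have h7 : E ((F ^ (n + 1)) ((E ^ m) v)) = ((n + 1 : ℂ) * (m - n)) • (F ^ n) ((E ^ m) v) := h5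
      rw [h6, h7, map_smul, ih (by omega), smul_smul]
      congr 1
      rw [Nat.factorial_succ, Nat.descFactorial_succ, Nat.cast_mul, Nat.cast_mul,
        Nat.cast_sub (by omega)]
      push_cast; ring
  rw [key m le_rfl, Nat.descFactorial_self, sq]

end ChevalleyBasis

namespace AdmissibleLattice

variable (Λ : AdmissibleLattice C V κ)

theorem rep_e_ne_zero (hV : Function.Injective (LieModule.toEnd ℂ 𝔤 V)) (α : H.root) :
    Λ.rep (C.e α) ≠ 0 := by
  rw [Ne, ← map_zero Λ.rep]
  exact fun h => C.e_ne_zero α (Λ.rep_injective hV h)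

theorem divPow_one_map (α : H.root) :
    (Λ.divPow α 1).map (Int.cast : ℤ → ℂ) = Λ.rep (C.e α) := by
  have := Λ.divPowIn_complex α 1
  simpa [divPowIn] using this

/-- The matrix of a root vector is primitive: no prime divides all of its entries. -/
theorem exists_not_dvd_divPow_one (hV : Function.Injective (LieModule.toEnd ℂ 𝔤 V))
    (α : H.root) {p : ℕ} (hp : p.Prime) : ∃ i j, ¬ ((p : ℤ) ∣ Λ.divPow α 1 i j) := by
  by_contra! hdvd
  have hex : ∃ m, Λ.divPow α m = 0 := ⟨_, Λ.divPow_eq_zero α le_rfl⟩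
  classical
  obtain ⟨M, hM, hmin⟩ : ∃ m, Λ.divPow α m = 0 ∧ ∀ l < m, Λ.divPow α l ≠ 0 :=
    ⟨Nat.find hex, Nat.find_spec hex, fun l hl => Nat.find_min hex hl⟩
  have h1 : Λ.divPow α 1 ≠ 0 := by
    intro h
    apply Λ.rep_e_ne_zero hV α
    rw [← Λ.divPow_one_map, h]; ext; simp
  have hM2 : 2 ≤ M := by
    rcases Nat.lt_or_ge M 2 with h | h
    · interval_cases M
      · exfalso
        apply h1
        rw [divPow_zero] at hM
        rw [← mul_one (Λ.divPow α 1), hM, mul_zero]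
      · exact absurd hM h1
    · exact h
  -- `m` is the order of the last divided power before the first vanishing one.
  obtain ⟨m, rfl⟩ : ∃ m, M = m + 1 := ⟨M - 1, by omega⟩
  have hm0 : Λ.divPow α m ≠ 0 := hmin m (Nat.lt_succ_self m)
  -- the power of the matrix
  have hpow : ∀ n : ℕ, Λ.divPow α 1 ^ n = (n.factorial : ℤ) • Λ.divPow α n := by
    intro n
    induction n with
    | zero => simp [divPow_zero]
    | succ n ih =>
      rw [pow_succ, ih, smul_mul_assoc, divPow_mul, Nat.choose_symm_add, Nat.choose_one_right,
        Nat.factorial_succ, ← natCast_zsmul, smul_smul]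
      congr 1; push_cast; ring
  obtain ⟨Q, hQ⟩ : ∃ Q : Matrix κ κ ℤ, Λ.divPow α 1 = (p : ℤ) • Q := by
    choose q hq using hdvd
    exact ⟨Matrix.of q, by ext i j; simp [hq i j]⟩
  -- The valuation of `m!` at `p` is less than `m`. If `p` divides `E`, then `p ^ m` divides `E ^ m
  -- = m! • E ^ (m) / m!`, and after cancelling the `p`-part of `m!` at least one factor `p` is left
  -- for the divided power.
  have hfac : ∃ r : ℤ, ¬ (p : ℤ) ∣ r ∧ ∃ a < m, (m.factorial : ℤ) = p ^ a * r := by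
    obtain ⟨a, r, hr, hr'⟩ := Nat.exists_eq_pow_mul_and_not_dvd (Nat.factorial_ne_zero m) p
      hp.ne_one
    have hf : Fact p.Prime := ⟨hp⟩
    refine ⟨r, by exact_mod_cast hr, a, lt_of_le_of_lt ?_
      (padicValNat_factorial_lt_of_ne_zero p (n := m) (by omega)), by exact_mod_cast hr'⟩
    rw [← padicValNat_dvd_iff_le (Nat.factorial_ne_zero m), hr']
    exact dvd_mul_right _ _
  obtain ⟨r, hr, a, ha, hra⟩ := hfac
  have hpz : (p : ℤ) ≠ 0 := by exact_mod_cast hp.ne_zero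
  have hdiv : ∀ i j, (p : ℤ) ∣ Λ.divPow α m i j := by
    intro i j
    have h2 := hpow m
    rw [hQ, smul_pow, hra] at h2
    have h3 := congrFun (congrFun h2 i) j
    simp only [Matrix.smul_apply, smul_eq_mul] at h3
    obtain ⟨d, rfl⟩ : ∃ d, m = a + d + 1 := ⟨m - a - 1, by omega⟩
    rw [pow_succ, pow_add, mul_assoc, mul_assoc, mul_assoc] at h3
    have h4 := mul_left_cancel₀ (pow_ne_zero a hpz) h3
    have h5 : (p : ℤ) ∣ r * Λ.divPow α (a + d + 1) i j := by
      rw [← h4]; exact Dvd.dvd.mul_left (dvd_mul_right _ _) _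
    exact ((Nat.prime_iff_prime_int.1 hp).dvd_or_dvd h5).resolve_left hr
  -- In divided powers the constant `m! ^ 2` disappears. The left factor brings in the divisibility
  -- already known and the right factor one more `p`, so the entries are divisible by every power of
  -- `p`.
  have htriple : Λ.divPow α m * Λ.divPow (negRoot α) m * Λ.divPow α m = Λ.divPow α m := by
    apply castMatrix_injective κ
    have e1 : ∀ A B : Matrix κ κ ℤ, (A * B).map (Int.cast : ℤ → ℂ) =
        A.map (Int.cast : ℤ → ℂ) * B.map (Int.cast : ℤ → ℂ) := fun A B =>
      Matrix.map_mul (f := Int.castRingHom ℂ)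
    have hE : LieModule.toEnd ℂ 𝔤 V (C.e α) ^ (m + 1) = 0 := by
      have := Λ.divPow_spec α (m + 1)
      rw [hM] at this
      have h4 : LinearMap.toMatrix Λ.basis Λ.basis ((((m + 1).factorial : ℂ))⁻¹ •
        (LieModule.toEnd ℂ 𝔤 V (C.e α)) ^ (m + 1)) = 0 := by rw [← this]; ext; simp
      rw [LinearEquiv.map_eq_zero_iff] at h4
      exact (smul_eq_zero.1 h4).resolve_left
        (inv_ne_zero (by exact_mod_cast Nat.factorial_ne_zero _))
    have key := C.toEnd_pow_mul_pow_mul_pow (V := V) α m hE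
    simp only [e1, Λ.divPow_spec, ← LinearMap.toMatrix_mul, smul_mul_assoc, mul_smul_comm, key,
      smul_smul]
    congr 2
    have hm : (m.factorial : ℂ) ≠ 0 := by exact_mod_cast m.factorial_ne_zero
    field_simp
  have hall : ∀ (n : ℕ) (i j : κ), (p : ℤ) ^ (n + 1) ∣ Λ.divPow α m i j := by
    intro n
    induction n with
    | zero => simpa using hdiv
    | succ n ih =>
      intro i j
      rw [← htriple, Matrix.mul_apply]
      refine Finset.dvd_sum fun l _ => ?_
      rw [pow_succ (p : ℤ) (n + 1)]
      refine mul_dvd_mul ?_ (hdiv l j)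
      rw [Matrix.mul_apply]
      exact Finset.dvd_sum fun l' _ => Dvd.dvd.mul_right (ih _ _) _
  apply hm0
  ext i j
  by_contra hne
  have hfin : FiniteMultiplicity (p : ℤ) (Λ.divPow α m i j) := by
    rw [Int.finiteMultiplicity_iff]
    exact ⟨by simpa using hp.ne_one, hne⟩
  obtain ⟨n, hn⟩ := hfin
  exact hn (hall n i j)

/-- Over any field, the matrix of a root vector does not vanish. -/
theorem divPowIn_one_ne_zero (hV : Function.Injective (LieModule.toEnd ℂ 𝔤 V)) (α : H.root)
    (k : Type*) [Field k] : Λ.divPowIn k α 1 ≠ 0 := by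
  intro h
  obtain ⟨p, hp⟩ := CharP.exists k
  have h1 : ∀ i j, (p : ℤ) ∣ Λ.divPow α 1 i j := fun i j => by
    have := congrFun (congrFun h i) j
    rw [← CharP.intCast_eq_zero_iff k p]
    simpa [divPowIn] using this
  rcases CharP.char_is_prime_or_zero k p with h2 | rfl
  · obtain ⟨i, j, hij⟩ := Λ.exists_not_dvd_divPow_one hV α h2
    exact hij (h1 i j)
  -- In characteristic zero any prime will do: it only has to exhibit a nonzero entry.
  · obtain ⟨i, j, hij⟩ := Λ.exists_not_dvd_divPow_one hV α Nat.prime_two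
    apply hij
    have := h1 i j
    simp only [Nat.cast_zero, zero_dvd_iff] at this
    simp [this]

/-- A complex multiple of a root vector which preserves the lattice is an integral multiple. -/
theorem exists_int_of_smul_rep (hV : Function.Injective (LieModule.toEnd ℂ 𝔤 V)) (α : H.root)
    (c : ℂ) (Z : Matrix κ κ ℤ) (hZ : Z.map (Int.cast : ℤ → ℂ) = c • Λ.rep (C.e α)) :
    ∃ n : ℤ, c = n := by
  have h1 : ∀ i j, (Z i j : ℂ) = c * Λ.divPow α 1 i j := fun i j => by
    rw [← divPow_one_map] at hZ
    simpa using congrFun (congrFun hZ i) j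
  obtain ⟨i, j, hij⟩ := Λ.exists_not_dvd_divPow_one hV α Nat.prime_two
  have h0 : Λ.divPow α 1 i j ≠ 0 := by rintro h; exact hij (by simp [h])
  obtain ⟨q, rfl⟩ : ∃ q : ℚ, c = q := by
    refine ⟨Z i j / Λ.divPow α 1 i j, ?_⟩
    have : (Λ.divPow α 1 i j : ℂ) ≠ 0 := by exact_mod_cast h0
    push_cast; rw [h1]; field_simp
  have h2 : ∀ i j, Z i j * (q.den : ℤ) = q.num * Λ.divPow α 1 i j := fun i j => by
    have h3 : (Z i j : ℚ) = q * Λ.divPow α 1 i j := by exact_mod_cast h1 i j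
    have h4 := q.mul_den_eq_num
    have : (Z i j : ℚ) * q.den = q.num * Λ.divPow α 1 i j := by
      rw [h3, ← h4]; ring
    exact_mod_cast this
  -- A prime divisor of the denominator is prime to the numerator, hence would divide every entry of
  -- the primitive matrix of `e_α`.
  have h5 : q.den = 1 := by
    by_contra hne
    obtain ⟨p, hp, hpd⟩ := Nat.exists_prime_and_dvd hne
    obtain ⟨i, j, hij⟩ := Λ.exists_not_dvd_divPow_one hV α hp
    have h6 : (p : ℤ) ∣ q.num * Λ.divPow α 1 i j := by
      rw [← h2]; exact Dvd.dvd.mul_left (by exact_mod_cast hpd) _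
    rcases (Nat.prime_iff_prime_int.1 hp).dvd_or_dvd h6 with h7 | h7
    · have h8 : p ∣ q.num.natAbs := Int.natCast_dvd.1 h7
      have := Nat.dvd_gcd h8 hpd
      rw [q.reduced] at this
      exact hp.one_lt.ne' (Nat.dvd_one.1 this)
    · exact hij h7
  exact ⟨q.num, by
    have : q = (q.num : ℚ) := by
      conv_lhs => rw [← Rat.num_div_den q, h5]
      simp
    rw [this]; push_cast; rfl⟩

end AdmissibleLattice

end Finite

end AffineFlag

end

noncomputable section

namespace AffineFlag

/-! ### The adjoint action of invertible matrices -/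

section AdMat

variable {κ : Type*} [Fintype κ] [DecidableEq κ] {R : Type*} [CommRing R]

/-- Conjugation of a matrix by an invertible matrix. -/
def adMat (g : GL κ R) : Matrix κ κ R →ₗ[R] Matrix κ κ R where
  toFun Y := g * Y * (g⁻¹ : GL κ R)
  map_add' Y Z := by rw [mul_add, add_mul]
  map_smul' c Y := by simp

theorem adMat_apply (g : GL κ R) (Y : Matrix κ κ R) :
    adMat g Y = g * Y * (g⁻¹ : GL κ R) := rfl

theorem adMat_mul (g h : GL κ R) (Y : Matrix κ κ R) : adMat (g * h) Y = adMat g (adMat h Y) := by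
  simp only [adMat_apply, mul_inv_rev, Units.val_mul, mul_assoc]

theorem adMat_one (Y : Matrix κ κ R) : adMat 1 Y = Y := by simp [adMat_apply]

theorem adMat_inv_adMat (g : GL κ R) (Y : Matrix κ κ R) : adMat g⁻¹ (adMat g Y) = Y := by
  rw [← adMat_mul, inv_mul_cancel, adMat_one]

theorem adMat_adMat_inv (g : GL κ R) (Y : Matrix κ κ R) : adMat g (adMat g⁻¹ Y) = Y := by
  rw [← adMat_mul, mul_inv_cancel, adMat_one]

theorem adMat_mul_apply (g : GL κ R) (Y Z : Matrix κ κ R) :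
    adMat g (Y * Z) = adMat g Y * adMat g Z := by
  simp only [adMat_apply]
  have : ((g⁻¹ : GL κ R) : Matrix κ κ R) * (g : Matrix κ κ R) = 1 := g.inv_mul
  calc (g : Matrix κ κ R) * (Y * Z) * (g⁻¹ : GL κ R)
      = g * Y * 1 * Z * (g⁻¹ : GL κ R) := by simp only [mul_one, mul_assoc]
    _ = _ := by rw [← this]; simp only [mul_assoc]

theorem mul_eq_adMat_mul (g : GL κ R) (Y : Matrix κ κ R) :
    (g : Matrix κ κ R) * Y = adMat g Y * g := by
  rw [adMat_apply, mul_assoc, Units.inv_mul, mul_one]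

end AdMat

/-! ### The adjoint action of root elements, Weyl elements and the torus -/

section Finite

variable {𝔤 : Type*} [LieRing 𝔤] [LieAlgebra ℂ 𝔤] [FiniteDimensional ℂ 𝔤] [IsKilling ℂ 𝔤]
variable {H : LieSubalgebra ℂ 𝔤} [H.IsCartanSubalgebra]
variable {V : Type*} [AddCommGroup V] [Module ℂ V] [LieRingModule 𝔤 V] [LieModule ℂ 𝔤 V]
variable {C : ChevalleyBasis H} {κ : Type*} [Fintype κ] [DecidableEq κ]

theorem ChevalleyBasis.exists_smul_of_mem_rootSpace (C : ChevalleyBasis H) (α : H.root) {x : 𝔤}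
    (hx : x ∈ rootSpace H α.1) : ∃ c : ℂ, x = c • C.e α := by
  have h := (finrank_eq_one_iff_of_nonzero' (⟨C.e α, C.mem_rootSpace α⟩ : rootSpace H α.1)
    (by simpa using C.e_ne_zero α)).1
    (finrank_rootSpace_eq_one α.1 (H.isNonZero_coe_root α)) ⟨x, hx⟩
  obtain ⟨c, hc⟩ := h
  exact ⟨c, (congrArg Subtype.val hc).symm⟩

namespace AdmissibleLattice

variable (Λ : AdmissibleLattice C V κ)

/-- The element `x_α(u) x_{-α}(-u⁻¹) x_α(u)`, the image of `!![0, u; -u⁻¹, 0]` under `φ_α`. -/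
def weylElem {F : Type*} [CommRing F] (α : H.root) (u : Fˣ) : GL κ F :=
  Λ.rootElem α (u : F) * Λ.rootElem (negRoot α) (-((u⁻¹ : Fˣ) : F)) * Λ.rootElem α (u : F)

theorem weylElem_neg {F : Type*} [CommRing F] (α : H.root) (u : Fˣ) :
    Λ.weylElem α (-u) = (Λ.weylElem α u)⁻¹ := by
  simp [weylElem, rootElem_neg, mul_assoc]

theorem corootElem_eq {F : Type*} [CommRing F] (α : H.root) (u : Fˣ) :
    Λ.corootElem α u = Λ.weylElem α u * (Λ.weylElem α 1)⁻¹ := by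
  rw [← weylElem_neg, corootElem, weylElem, weylElem]
  congr 2
  simp

theorem map_weylElem {F F' : Type*} [CommRing F] [CommRing F'] (φ : F →+* F') (α : H.root)
    (u : Fˣ) : Matrix.GeneralLinearGroup.map φ (Λ.weylElem α u) =
      Λ.weylElem α (Units.map (φ : F →* F') u) := by
  simp only [weylElem, map_mul, map_rootElem, map_neg]
  rfl

theorem map_corootElem {F F' : Type*} [CommRing F] [CommRing F'] (φ : F →+* F') (α : H.root)
    (u : Fˣ) : Matrix.GeneralLinearGroup.map φ (Λ.corootElem α u) =
      Λ.corootElem α (Units.map (φ : F →* F') u) := by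
  simp only [corootElem_eq, map_mul, map_inv, map_weylElem, map_one]

theorem repIn_complex (x : 𝔤) : Λ.repIn ℂ x = Λ.rep x := by ext; simp [repIn]

theorem adMat_rootElem_cartan (α : H.root) (f : ℂ) (h : H) :
    adMat (Λ.rootElem α f) (Λ.rep (h : 𝔤)) =
      Λ.rep (h : 𝔤) - (f * (rootSystem H).root α h) • Λ.rep (C.e α) := by
  have := Λ.rootElem_conj_repIn (R := ℂ) α f (Y := Λ.rep (h : 𝔤))
    (Z := -((rootSystem H).root α h • Λ.rep (C.e α))) (W := 0)
    (by rw [repIn_complex, ← rep_lie, ← lie_skew, C.lie_cartan, map_neg, map_smul])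
    (by simp [repIn_complex]) (by simp)
  rw [adMat_apply, this, smul_zero, add_zero, smul_neg, smul_smul, sub_eq_add_neg]

theorem adMat_rootElem_self (α : H.root) (f : ℂ) :
    adMat (Λ.rootElem α f) (Λ.rep (C.e α)) = Λ.rep (C.e α) := by
  have := Λ.rootElem_conj_repIn (R := ℂ) α f (Y := Λ.rep (C.e α)) (Z := 0) (W := 0)
    (by rw [repIn_complex, sub_self]) (by simp) (by simp)
  rw [adMat_apply, this]; simp

theorem adMat_rootElem_neg (α : H.root) (f : ℂ) :
    adMat (Λ.rootElem α f) (Λ.rep (C.e (negRoot α))) = Λ.rep (C.e (negRoot α)) +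
      f • Λ.rep ((coroot α.1 : H) : 𝔤) - f ^ 2 • Λ.rep (C.e α) := by
  have := Λ.rootElem_conj_repIn (R := ℂ) α f (Y := Λ.rep (C.e (negRoot α)))
    (Z := Λ.rep ((coroot α.1 : H) : 𝔤)) (W := -Λ.rep (C.e α))
    (by rw [repIn_complex, ← rep_lie, C.lie_neg])
    (by rw [repIn_complex, ← rep_lie, ← lie_skew, C.lie_coroot_self, map_neg, map_smul, smul_neg])
    (by rw [repIn_complex]; simp)
  rw [adMat_apply, this, smul_neg, sub_eq_add_neg]

theorem root_coroot_self (α : H.root) : (rootSystem H).root α (coroot α.1) = 2 :=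
  root_apply_coroot (H.isNonZero_coe_root α)

/-- A rank one computation with the three factors of the Weyl element. The parameter `u` drops out,
so all Weyl elements of `α` lift the reflection `s_α`. -/
theorem adMat_weylElem_cartan (α : H.root) (u : ℂˣ) (h : H) :
    adMat (Λ.weylElem α u) (Λ.rep (h : 𝔤)) =
      Λ.rep ((h - (rootSystem H).root α h • coroot α.1 : H) : 𝔤) := by
  have hneg : ∀ f : ℂ, adMat (Λ.rootElem (negRoot α) f) (Λ.rep (C.e α)) = Λ.rep (C.e α) -
      f • Λ.rep ((coroot α.1 : H) : 𝔤) - f ^ 2 • Λ.rep (C.e (negRoot α)) := fun f => by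
    have := Λ.adMat_rootElem_neg (negRoot α) f
    rw [negRoot_negRoot, coroot_negRoot] at this
    rw [this]; simp [sub_eq_add_neg]
  have hu : (u : ℂ) ≠ 0 := u.ne_zero
  simp only [weylElem, adMat_mul, adMat_rootElem_cartan, map_sub, map_smul, hneg,
    adMat_rootElem_self, adMat_rootElem_neg, root_negRoot, root_coroot_self,
    LinearMap.neg_apply, Units.val_inv_eq_inv_val]
  have e : Λ.rep ((h - (rootSystem H).root α h • coroot α.1 : H) : 𝔤) = Λ.rep (h : 𝔤) -
      (rootSystem H).root α h • Λ.rep ((coroot α.1 : H) : 𝔤) := by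
    rw [← map_smul, ← map_sub]; rfl
  rw [e]
  match_scalars <;> field_simp <;> ring

/-- The explicit coefficient is what determines the sign in `weylSign_self`. -/
theorem adMat_weylElem_self (α : H.root) (u : ℂˣ) :
    adMat (Λ.weylElem α u) (Λ.rep (C.e α)) =
      (-((u⁻¹ : ℂˣ) : ℂ) ^ 2) • Λ.rep (C.e (negRoot α)) := by
  have hneg : ∀ f : ℂ, adMat (Λ.rootElem (negRoot α) f) (Λ.rep (C.e α)) = Λ.rep (C.e α) -
      f • Λ.rep ((coroot α.1 : H) : 𝔤) - f ^ 2 • Λ.rep (C.e (negRoot α)) := fun f => by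
    have := Λ.adMat_rootElem_neg (negRoot α) f
    rw [negRoot_negRoot, coroot_negRoot] at this
    rw [this]; simp [sub_eq_add_neg]
  have hu : (u : ℂ) ≠ 0 := u.ne_zero
  simp only [weylElem, adMat_mul, adMat_rootElem_cartan, map_sub, map_smul, hneg,
    adMat_rootElem_self, adMat_rootElem_neg, root_coroot_self,
    Units.val_inv_eq_inv_val]
  match_scalars <;> field_simp <;> ring

theorem adMat_rootElem_mem_range (α : H.root) (f : ℂ) (x : 𝔤) :
    ∃ y, adMat (Λ.rootElem α f) (Λ.rep x) = Λ.rep y := by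
  have := Λ.rootMatrix_conj_mem (R := ℂ) ((LinearMap.range Λ.rep).restrictScalars ℚ) α f ?_
    (Y := Λ.rep x) ⟨x, rfl⟩
  · obtain ⟨y, hy⟩ := this
    exact ⟨y, hy.symm⟩
  · rintro _ ⟨y, rfl⟩
    refine ⟨⁅f • C.e α, y⁆, ?_⟩
    rw [rep_lie, map_smul, repIn_complex]

theorem adMat_weylElem_mem_range (α : H.root) (u : ℂˣ) (x : 𝔤) :
    ∃ y, adMat (Λ.weylElem α u) (Λ.rep x) = Λ.rep y := by
  obtain ⟨y, hy⟩ := Λ.adMat_rootElem_mem_range α u x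
  obtain ⟨z, hz⟩ := Λ.adMat_rootElem_mem_range (negRoot α) (-((u⁻¹ : ℂˣ) : ℂ)) y
  obtain ⟨w, hw⟩ := Λ.adMat_rootElem_mem_range α u z
  exact ⟨w, by rw [weylElem, adMat_mul, adMat_mul, hy, hz, hw]⟩

theorem root_reflectionPerm_apply (α β : H.root) (h : H) :
    (rootSystem H).root ((rootSystem H).reflectionPerm α β) h =
      (rootSystem H).root β (h - (rootSystem H).root α h • coroot α.1) := by
  rw [(rootSystem H).root_reflectionPerm, (rootSystem H).reflection_apply]
  simp [mul_comm]

/-- Conjugation carries `s_α h` to `h`, so the image of `e_β` is a weight vector of weight `s_α β`,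
and root spaces are lines. -/
theorem exists_adMat_weylElem (hV : Function.Injective (LieModule.toEnd ℂ 𝔤 V)) (α β : H.root)
    (u : ℂˣ) : ∃ c : ℂ, adMat (Λ.weylElem α u) (Λ.rep (C.e β)) =
      c • Λ.rep (C.e ((rootSystem H).reflectionPerm α β)) := by
  obtain ⟨y, hy⟩ := Λ.adMat_weylElem_mem_range α u (C.e β)
  set γ := (rootSystem H).reflectionPerm α β
  have hmem : y ∈ rootSpace H γ.1 := by
    apply LieModule.weightSpace_le_genWeightSpace
    rw [LieModule.mem_weightSpace]
    intro h
    apply Λ.rep_injective hV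
    set h' : H := h - (rootSystem H).root α h • coroot α.1
    have h1 : adMat (Λ.weylElem α u) (Λ.rep (h' : 𝔤)) = Λ.rep (h : 𝔤) := by
      rw [adMat_weylElem_cartan]
      congr 2
      simp only [h', map_sub, map_smul, root_coroot_self, smul_eq_mul]
      module
    change Λ.rep ⁅(h : 𝔤), y⁆ = _
    rw [rep_lie, ← hy, ← h1, ← adMat_mul_apply, ← adMat_mul_apply, ← map_sub, ← rep_lie,
      C.lie_cartan, map_smul, map_smul, hy, map_smul]
    congr 1
    exact (root_reflectionPerm_apply α β h).symm
  obtain ⟨c, hc⟩ := C.exists_smul_of_mem_rootSpace γ hmem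
  exact ⟨c, by rw [hy, hc, map_smul]⟩

/-- Conjugation is multiplicative, so the relation for `e_α` passes to its divided powers and to the
exponential. -/
theorem conj_rootElem_of_adMat {α β : H.root} {g : GL κ ℂ} {c : ℂ}
    (h : adMat g (Λ.rep (C.e α)) = c • Λ.rep (C.e β)) (f : ℂ) :
    g * Λ.rootElem α f * g⁻¹ = Λ.rootElem β (c * f) := by
  have hpow : ∀ m : ℕ, adMat g (Λ.rep (C.e α) ^ m) = c ^ m • Λ.rep (C.e β) ^ m := by
    intro m
    induction m with
    | zero => simp [adMat_apply]
    | succ m ih => rw [pow_succ, adMat_mul_apply, ih, h, smul_mul_smul_comm, ← pow_succ, ← pow_succ]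
  apply Units.ext
  change adMat g (Λ.rootMatrix α f) = Λ.rootMatrix β (c * f)
  simp only [rootMatrix, map_sum, map_smul, divPowIn_complex, hpow]
  refine Finset.sum_congr rfl fun m _ => ?_
  rw [mul_pow, smul_smul, smul_smul, smul_smul]
  congr 1; ring

/-! ### The torus over the complex numbers -/

open scoped Matrix.Norms.Operator in
theorem hasDerivAt_rootMatrix (α : H.root) (f : ℂ) :
    HasDerivAt (fun z : ℂ => Λ.rootMatrix α z) (Λ.rep (C.e α) * Λ.rootMatrix α f) f := by
  have h : ∀ z : ℂ, Λ.rootMatrix α z = NormedSpace.exp (z • Λ.rep (C.e α)) := by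
    intro z
    rw [NormedSpace.exp_eq_tsum ℂ]
    beta_reduce
    rw [tsum_eq_sum (s := Finset.range (Fintype.card κ))]
    · refine Finset.sum_congr rfl fun m _ => ?_
      rw [divPowIn_complex, smul_pow, smul_comm]
    · intro m hm
      rw [smul_pow, pow_eq_zero_of_le (by simpa using hm) (Λ.rep_pow_card α), smul_zero, smul_zero]
  simp only [h]
  exact hasDerivAt_exp_smul_const' _ _

/-- The unit `exp z`. -/
def expUnit (z : ℂ) : ℂˣ := Units.mk0 (Complex.exp z) (Complex.exp_ne_zero z)

theorem exists_expUnit (u : ℂˣ) : ∃ z, expUnit z = u := by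
  exact ⟨Complex.log u, Units.ext (Complex.exp_log u.ne_zero)⟩

open scoped Matrix.Norms.Operator in
-- By the product rule, after moving `E`, `F` and `A` to the left with the adjoint formulas. Thus `z
-- ↦ w_α(exp z)` solves the linear differential equation `X' = h_α X`.
theorem hasDerivAt_weylElem (α : H.root) (z : ℂ) :
    HasDerivAt (fun z : ℂ => (Λ.weylElem α (expUnit z) : Matrix κ κ ℂ))
      (Λ.rep ((coroot α.1 : H) : 𝔤) * (Λ.weylElem α (expUnit z) : Matrix κ κ ℂ)) z := by
  have h1 : HasDerivAt (fun z : ℂ => Λ.rootMatrix α (Complex.exp z)) 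
      (Complex.exp z • (Λ.rep (C.e α) * Λ.rootMatrix α (Complex.exp z))) z :=
    (Λ.hasDerivAt_rootMatrix α (Complex.exp z)).scomp z (Complex.hasDerivAt_exp z)
  have h2 : HasDerivAt (fun z : ℂ => -(Complex.exp z)⁻¹) ((Complex.exp z)⁻¹) z := by
    have := (Complex.hasDerivAt_exp z).inv (Complex.exp_ne_zero z)
    refine this.neg.congr_deriv ?_
    have := Complex.exp_ne_zero z
    field_simp
  have h3 : HasDerivAt (fun z : ℂ => Λ.rootMatrix (negRoot α) (-(Complex.exp z)⁻¹))
      ((Complex.exp z)⁻¹ • (Λ.rep (C.e (negRoot α)) *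
        Λ.rootMatrix (negRoot α) (-(Complex.exp z)⁻¹))) z :=
    (Λ.hasDerivAt_rootMatrix (negRoot α) _).scomp z h2
  have h4 : HasDerivAt (fun z : ℂ => Λ.rootMatrix α (Complex.exp z) *
      Λ.rootMatrix (negRoot α) (-(Complex.exp z)⁻¹) * Λ.rootMatrix α (Complex.exp z)) _ z :=
    (h1.mul h3).mul h1
  refine h4.congr_deriv ?_
  have hu := Complex.exp_ne_zero z
  set w := Complex.exp z
  set X := Λ.rootMatrix α w
  set M := Λ.rootMatrix (negRoot α) (-w⁻¹)
  set E := Λ.rep (C.e α)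
  set F := Λ.rep (C.e (negRoot α))
  set A := Λ.rep ((coroot α.1 : H) : 𝔤)
  have hXE : X * E = E * X := by
    have := mul_eq_adMat_mul (Λ.rootElem α w) E
    rwa [adMat_rootElem_self] at this
  have hXA : X * A = (A - (w * 2) • E) * X := by
    have := mul_eq_adMat_mul (Λ.rootElem α w) A
    rwa [adMat_rootElem_cartan, root_coroot_self] at this
  have hXF : X * F = (F + w • A - w ^ 2 • E) * X := by
    have := mul_eq_adMat_mul (Λ.rootElem α w) F
    rwa [adMat_rootElem_neg] at this
  have hME : M * E = (E + w⁻¹ • A - (w⁻¹) ^ 2 • F) * M := by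
    have := mul_eq_adMat_mul (Λ.rootElem (negRoot α) (-w⁻¹)) E
    have h5 := Λ.adMat_rootElem_neg (negRoot α) (-w⁻¹)
    rw [negRoot_negRoot, coroot_negRoot] at h5
    rw [h5] at this
    refine this.trans ?_
    congr 1
    simp [A, E, F]
  have hval : (Λ.weylElem α (expUnit z) : Matrix κ κ ℂ) = X * M * X := by
    simp [weylElem, expUnit, X, M, w, rootElem]
  have e1 : X * (F * M) = (F * X + w • (A * X) - w ^ 2 • (E * X)) * M := by
    rw [← mul_assoc, hXF, sub_mul, add_mul, smul_mul_assoc, smul_mul_assoc]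
  have e2 : X * M * (E * X) = (E * X + w⁻¹ • ((A * X - (w * 2) • (E * X))) -
      (w⁻¹) ^ 2 • (F * X + w • (A * X) - w ^ 2 • (E * X))) * (M * X) := by
    calc X * M * (E * X) = X * (M * E) * X := by simp only [mul_assoc]
      _ = (X * E + w⁻¹ • (X * A) - (w⁻¹) ^ 2 • (X * F)) * (M * X) := by
        rw [hME]; simp only [mul_add, mul_sub, mul_smul_comm, ← mul_assoc]
      _ = _ := by
        rw [hXE, hXA, hXF]
        simp only [sub_mul, add_mul, smul_mul_assoc]
  change (w • (E * X) * M + X * w⁻¹ • (F * M)) * X + X * M * w • (E * X) = _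
  rw [hval, mul_smul_comm, mul_smul_comm, smul_mul_assoc, e1, e2]
  simp only [sub_mul, add_mul, smul_mul_assoc, mul_assoc, smul_sub, smul_add, smul_smul]
  match_scalars <;> field_simp <;> ring

open scoped Matrix.Norms.Operator in
-- `exp (-z h_α) w_α(exp z)` has derivative zero, hence equals its value `w_α(1)` at `z = 0`.
theorem corootElem_expUnit (α : H.root) (z : ℂ) :
    (Λ.corootElem α (expUnit z) : Matrix κ κ ℂ) =
      NormedSpace.exp (z • Λ.rep ((coroot α.1 : H) : 𝔤)) := by
  set A := Λ.rep ((coroot α.1 : H) : 𝔤)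
  have h1 : ∀ z : ℂ, HasDerivAt (fun z : ℂ => NormedSpace.exp (z • -A) *
      (Λ.weylElem α (expUnit z) : Matrix κ κ ℂ)) 0 z := fun z => by
    refine ((hasDerivAt_exp_smul_const (-A) z).mul (Λ.hasDerivAt_weylElem α z)).congr_deriv ?_
    simp only [mul_neg, neg_mul, mul_assoc]
    exact neg_add_cancel _
  have h2 := is_const_of_deriv_eq_zero (fun z => (h1 z).differentiableAt) (fun z => (h1 z).deriv)
    z 0
  have h3 : expUnit 0 = 1 := Units.ext Complex.exp_zero
  rw [zero_smul, NormedSpace.exp_zero, one_mul, h3, smul_neg] at h2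
  have h4 : NormedSpace.exp (z • A) * NormedSpace.exp (-(z • A)) = 1 := by
    refine (NormedSpace.exp_add_of_commute (Commute.neg_right (Commute.refl (z • A)))).symm.trans ?_
    rw [add_neg_cancel, NormedSpace.exp_zero]
  rw [corootElem_eq, Units.val_mul, ← mul_one (NormedSpace.exp (z • A)),
    ← (Λ.weylElem α (1 : ℂˣ)).mul_inv, ← h2, ← mul_assoc, ← mul_assoc, h4, one_mul]

open scoped Matrix.Norms.Operator in
theorem corootElem_mul_complex (α : H.root) (u v : ℂˣ) :
    Λ.corootElem α (u * v) = Λ.corootElem α u * Λ.corootElem α v := by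
  obtain ⟨z, rfl⟩ := exists_expUnit u
  obtain ⟨w, rfl⟩ := exists_expUnit v
  have h : expUnit z * expUnit w = expUnit (z + w) := Units.ext (Complex.exp_add z w).symm
  apply Units.ext
  rw [h, Units.val_mul, corootElem_expUnit, corootElem_expUnit, corootElem_expUnit, add_smul]
  exact NormedSpace.exp_add_of_commute (((Commute.refl _).smul_right w).smul_left z)

open scoped Matrix.Norms.Operator in
-- With `m = ⟨β, α^∨⟩`, the relation `[h_α, e_β] = m e_β` makes `exp (m z)` times the conjugate of
-- `e_β` by `exp (-z h_α)` independent of `z`.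
theorem adMat_corootElem (α β : H.root) (u : ℂˣ) :
    adMat (Λ.corootElem α u) (Λ.rep (C.e β)) =
      ((u ^ (rootSystem H).pairingIn ℤ β α : ℂˣ) : ℂ) • Λ.rep (C.e β) := by
  obtain ⟨z, rfl⟩ := exists_expUnit u
  set A := Λ.rep ((coroot α.1 : H) : 𝔤) with hA
  set E := Λ.rep (C.e β) with hE
  set m := (rootSystem H).pairingIn ℤ β α
  have hm : (rootSystem H).root β (coroot α.1) = (m : ℂ) := by
    have := (rootSystem H).algebraMap_pairingIn ℤ β α
    rw [rootSystem_pairing_apply] at this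
    rw [rootSystem_root_apply]
    exact this.symm
  have hAE : A * E = E * A + (m : ℂ) • E := by
    rw [← sub_eq_iff_eq_add', hA, hE, ← rep_lie, C.lie_cartan, hm, map_smul]
  have h1 : ∀ z : ℂ, HasDerivAt (fun z : ℂ => Complex.exp (z * m) •
      (NormedSpace.exp (z • -A) * E * NormedSpace.exp (z • A))) 0 z := fun z => by
    have e1 : HasDerivAt (fun z : ℂ => Complex.exp (z * m)) (Complex.exp (z * m) * m) z := by
      simpa using ((hasDerivAt_id z).mul_const (m : ℂ)).cexp
    have e2 : NormedSpace.exp (z • -A) * -A * E * NormedSpace.exp (z • A) +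
        NormedSpace.exp (z • -A) * E * (A * NormedSpace.exp (z • A)) =
        -((m : ℂ) • (NormedSpace.exp (z • -A) * E * NormedSpace.exp (z • A))) := by
      rw [mul_assoc _ (-A) E, neg_mul, hAE]
      simp only [mul_neg, neg_mul, mul_add, add_mul, mul_smul_comm, smul_mul_assoc, mul_assoc]
      abel
    have e3 : HasDerivAt (fun z : ℂ => NormedSpace.exp (z • -A) * E * NormedSpace.exp (z • A))
        (-((m : ℂ) • (NormedSpace.exp (z • -A) * E * NormedSpace.exp (z • A)))) z :=
      (((hasDerivAt_exp_smul_const (-A) z).mul_const E).mul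
        (hasDerivAt_exp_smul_const' A z)).congr_deriv e2
    refine (e1.smul e3).congr_deriv ?_
    rw [smul_neg, smul_smul]
    exact neg_add_cancel _
  have h2 := is_const_of_deriv_eq_zero (fun z => (h1 z).differentiableAt) (fun z => (h1 z).deriv)
    (-z) 0
  have h3 : (((expUnit z) ^ m : ℂˣ) : ℂ) = Complex.exp (z * m) := by
    rw [Units.val_zpow_eq_zpow_val, mul_comm]
    exact (Complex.exp_int_mul z m).symm
  have h4 : (((Λ.corootElem α (expUnit z))⁻¹ : GL κ ℂ) : Matrix κ κ ℂ) =
      NormedSpace.exp ((-z) • A) := by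
    rw [← corootElem_expUnit]
    congr 1
    rw [inv_eq_iff_mul_eq_one, ← corootElem_mul_complex]
    have : expUnit z * expUnit (-z) = 1 := Units.ext (by simp [expUnit, ← Complex.exp_add])
    rw [this, corootElem_eq, mul_inv_cancel]
  rw [adMat_apply, h4, corootElem_expUnit, h3]
  simp only [neg_smul, smul_neg, neg_neg, zero_mul, zero_smul, neg_zero, NormedSpace.exp_zero,
    Complex.exp_zero, one_smul, one_mul, mul_one, neg_mul] at h2 ⊢
  rw [← h2, smul_smul, ← Complex.exp_add, add_neg_cancel, Complex.exp_zero, one_smul, h2]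

end AdmissibleLattice

end Finite

end AffineFlag

end

noncomputable section

namespace AffineFlag

/-! ### Transfer of identities from the complex numbers to commutative rings -/

open Cardinal in
-- A transcendence basis of `ℂ` has the cardinality of the continuum. Three elements are enough for
-- identities in two units and one further variable.
theorem exists_algebraicIndependent_complex :
    ∃ x : Fin 3 → ℂ, AlgebraicIndependent ℤ x := by
  obtain ⟨s, hs⟩ := exists_isTranscendenceBasis ℤ ℂ
  have h := IsAlgClosed.cardinal_eq_cardinal_transcendence_basis_of_aleph0_lt' _ hs
    (by simp) (by rw [Cardinal.mk_complex]; exact aleph0_lt_continuum)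
  rw [Cardinal.mk_complex] at h
  have : Infinite s := by
    rw [Cardinal.infinite_iff, ← h]; exact aleph0_le_continuum
  obtain ⟨f⟩ : Nonempty (Fin 3 ↪ s) :=
    ⟨(Fin.valEmbedding).trans (Infinite.natEmbedding s)⟩
  exact ⟨_, hs.1.comp f f.injective⟩

/-- Two units and an element of a commutative ring lift to a ring which embeds into `ℂ`. -/
theorem exists_lift_to_complex {F : Type*} [CommRing F] (u v : Fˣ) (f : F) :
    ∃ (R : Type) (_ : CommRing R) (ψ : R →+* ℂ) (φ : R →+* F) (u' v' : Rˣ) (f' : R),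
      Function.Injective ψ ∧ Units.map (φ : R →* F) u' = u ∧ Units.map (φ : R →* F) v' = v ∧
        φ f' = f := by
  obtain ⟨x, hx⟩ := exists_algebraicIndependent_complex
  let S := MvPolynomial (Fin 3) ℤ
  let X : Fin 3 → S := MvPolynomial.X
  let p : S := X 0 * X 1
  let g : S →+* ℂ := (MvPolynomial.aeval x : S →ₐ[ℤ] ℂ)
  have hg : Function.Injective g := hx
  let q : S →+* F := (MvPolynomial.aeval ![(u : F), v, f] : S →ₐ[ℤ] F)
  have hp0 : p ≠ 0 := mul_ne_zero (MvPolynomial.X_ne_zero _) (MvPolynomial.X_ne_zero _)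
  have hgp : IsUnit (g p) := IsUnit.mk0 _ fun h => hp0 (hg (by rw [h, map_zero]))
  have hq : ∀ i, q (X i) = ![(u : F), v, f] i := fun i => MvPolynomial.aeval_X _ i
  have hqp : IsUnit (q p) := by
    rw [map_mul, hq, hq]; exact u.isUnit.mul v.isUnit
  -- The universal ring `ℤ[X₀, X₁, X₂]` with `X₀` and `X₁` inverted. An identity between matrices
  -- over it can be checked after the embedding in `ℂ` and then specialized to any commutative ring.
  let R := Localization.Away p
  have hu : IsUnit (algebraMap S R (X 0) * algebraMap S R (X 1)) := by
    rw [← map_mul]; exact IsLocalization.Away.algebraMap_isUnit p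
  have hle : Submonoid.powers p ≤ nonZeroDivisors S := by
    rw [Submonoid.powers_le]; exact mem_nonZeroDivisors_of_ne_zero hp0
  have hinj : Function.Injective (algebraMap S R) := IsLocalization.injective R hle
  refine ⟨R, inferInstance, IsLocalization.Away.lift p hgp, IsLocalization.Away.lift p hqp,
    (isUnit_of_mul_isUnit_left hu).unit, (isUnit_of_mul_isUnit_right hu).unit,
    algebraMap S R (X 2), ?_, Units.ext ?_, Units.ext ?_, ?_⟩
  · rw [IsLocalization.Away.lift, IsLocalization.lift_injective_iff]
    exact fun a b => by rw [hinj.eq_iff, hg.eq_iff]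
  · simp [IsLocalization.Away.lift_eq, hq]
  · simp [IsLocalization.Away.lift_eq, hq]
  · simp [IsLocalization.Away.lift_eq, hq]

theorem GL_map_injective {κ : Type*} [Fintype κ] [DecidableEq κ] {R S : Type*} [CommRing R]
    [CommRing S] {ψ : R →+* S} (h : Function.Injective ψ) :
    Function.Injective (Matrix.GeneralLinearGroup.map (n := κ) ψ) := by
  intro a b hab
  apply Units.ext
  apply Matrix.map_injective h
  exact congrArg Units.val hab

/-! ### Chevalley relations over commutative rings -/

section Finite

variable {𝔤 : Type*} [LieRing 𝔤] [LieAlgebra ℂ 𝔤] [FiniteDimensional ℂ 𝔤] [IsKilling ℂ 𝔤]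
variable {H : LieSubalgebra ℂ 𝔤} [H.IsCartanSubalgebra]

/-- The reflection `s_α β` of a root. -/
def reflRoot (α β : H.root) : H.root := (rootSystem H).reflectionPerm α β

/-- The integer `⟨β, α^∨⟩`. -/
def pair (β α : H.root) : ℤ := (rootSystem H).pairingIn ℤ β α

theorem pair_reflRoot_left (α β : H.root) : pair (reflRoot α β) α = -pair β α := by
  rw [pair, reflRoot, ← (rootSystem H).pairingIn_reflectionPerm,
    (rootSystem H).pairingIn_reflectionPerm_self_right, pair]

theorem root_coroot_eq_pair (β α : H.root) :
    (rootSystem H).root β (coroot α.1) = (pair β α : ℂ) := by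
  have := (rootSystem H).algebraMap_pairingIn ℤ β α
  rw [rootSystem_pairing_apply] at this
  rw [rootSystem_root_apply]
  exact this.symm

theorem root_reflRoot (α β : H.root) : (rootSystem H).root (reflRoot α β) =
    (rootSystem H).root β - pair β α • (rootSystem H).root α := by
  rw [reflRoot, (rootSystem H).root_reflectionPerm, (rootSystem H).reflection_apply_root,
    ← (rootSystem H).algebraMap_pairingIn ℤ, pair]
  congr 1
  exact Int.cast_smul_eq_zsmul ℂ _ _

@[simp] theorem reflRoot_reflRoot (α β : H.root) : reflRoot α (reflRoot α β) = β := by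
  simp [reflRoot]

theorem reflRoot_negRoot (α β : H.root) : reflRoot α (negRoot β) = negRoot (reflRoot α β) := by
  apply (rootSystem H).root.injective
  rw [root_negRoot, reflRoot, reflRoot, (rootSystem H).root_reflectionPerm, root_negRoot, map_neg,
    (rootSystem H).root_reflectionPerm]

theorem reflRoot_self (α : H.root) : reflRoot α α = negRoot α :=
  (negRoot_eq_reflectionPerm α).symm

@[simp] theorem pair_self (α : H.root) : pair α α = 2 := by
  have h := root_coroot_eq_pair α α
  rw [AdmissibleLattice.root_coroot_self] at h
  exact_mod_cast h.symm

@[simp] theorem pair_negRoot_left (β α : H.root) : pair (negRoot β) α = -pair β α := by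
  have h1 := root_coroot_eq_pair β α
  have h2 := root_coroot_eq_pair (negRoot β) α
  rw [root_negRoot, LinearMap.neg_apply, h1] at h2
  exact_mod_cast h2.symm

@[simp] theorem pair_negRoot_right (β α : H.root) : pair β (negRoot α) = -pair β α := by
  have h1 := root_coroot_eq_pair β α
  have h2 := root_coroot_eq_pair β (negRoot α)
  rw [coroot_negRoot, map_neg, h1] at h2
  exact_mod_cast h2.symm

theorem coroot_reflRoot (α β : H.root) : coroot (reflRoot α β).1 =
    coroot β.1 - (rootSystem H).root α (coroot β.1) • coroot α.1 := by
  have h := (rootSystem H).coroot_reflectionPerm α β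
  rw [(rootSystem H).coreflection_apply] at h
  exact h

variable {V : Type*} [AddCommGroup V] [Module ℂ V] [LieRingModule 𝔤 V] [LieModule ℂ 𝔤 V]
variable {C : ChevalleyBasis H} {κ : Type*} [Fintype κ] [DecidableEq κ]

namespace AdmissibleLattice

variable (Λ : AdmissibleLattice C V κ)

/-- For `u = ±1` the Weyl element and its inverse are integral, so the integral matrix of `e_β` goes
to an integral matrix. Primitivity of root vectors turns this into integrality of the scalar. -/
theorem exists_int_adMat_weylElem (hV : Function.Injective (LieModule.toEnd ℂ 𝔤 V))
    (α β : H.root) (u : ℤˣ) : ∃ n : ℤ,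
      adMat (Λ.weylElem α (Units.map (Int.castRingHom ℂ : ℤ →* ℂ) u)) (Λ.rep (C.e β)) =
        (n : ℂ) • Λ.rep (C.e (reflRoot α β)) := by
  obtain ⟨c, hc⟩ := Λ.exists_adMat_weylElem hV α β (Units.map (Int.castRingHom ℂ : ℤ →* ℂ) u)
  obtain ⟨n, rfl⟩ := Λ.exists_int_of_smul_rep hV (reflRoot α β) c
    (adMat (Λ.weylElem α u) (Λ.divPow β 1)) (by
      refine Eq.trans ?_ hc
      rw [← map_weylElem, ← divPow_one_map, adMat_apply, adMat_apply, ← map_inv]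
      have e1 : ∀ A B : Matrix κ κ ℤ, (A * B).map (Int.cast : ℤ → ℂ) =
        A.map (Int.cast : ℤ → ℂ) * B.map (Int.cast : ℤ → ℂ) := fun A B =>
          Matrix.map_mul (f := Int.castRingHom ℂ)
      rw [e1, e1]; rfl)
  exact ⟨n, hc⟩

/-- The sign `η` for which conjugation by `x_α(1) x_{-α}(-1) x_α(1)` maps `e_β` to
`η e_{s_α β}`. -/
def weylSign (α β : H.root) : ℤˣ :=
  Classical.epsilon fun η : ℤˣ => adMat (Λ.weylElem α 1) (Λ.rep (C.e β)) =
    ((η : ℤ) : ℂ) • Λ.rep (C.e (reflRoot α β))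

theorem adMat_weylElem_one (hV : Function.Injective (LieModule.toEnd ℂ 𝔤 V)) (α β : H.root) :
    adMat (Λ.weylElem α 1) (Λ.rep (C.e β)) =
      ((Λ.weylSign α β : ℤ) : ℂ) • Λ.rep (C.e (reflRoot α β)) := by
  -- A sign exists because `w_α(-1)` is the inverse of `w_α(1)`: the integers found for the two
  -- directions multiply to `1`.
  apply Classical.epsilon_spec (p := fun η : ℤˣ => adMat (Λ.weylElem α 1) (Λ.rep (C.e β)) =
    ((η : ℤ) : ℂ) • Λ.rep (C.e (reflRoot α β)))
  obtain ⟨n, hn⟩ := Λ.exists_int_adMat_weylElem hV α β 1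
  obtain ⟨m, hm⟩ := Λ.exists_int_adMat_weylElem hV α (reflRoot α β) (-1)
  have h1 : Units.map (Int.castRingHom ℂ : ℤ →* ℂ) (-1) = -1 := Units.ext (by simp)
  rw [map_one] at hn
  rw [h1, weylElem_neg, reflRoot_reflRoot] at hm
  have h2 := congrArg (adMat (Λ.weylElem α 1)⁻¹) hn
  rw [adMat_inv_adMat, map_smul, hm, smul_smul] at h2
  have h3 : ((n : ℂ) * m - 1) • Λ.rep (C.e β) = 0 := by rw [sub_smul, one_smul, ← h2, sub_self]
  have h4 := (smul_eq_zero.1 h3).resolve_right (Λ.rep_e_ne_zero hV β)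
  have h5 : n * m = 1 := by
    have : (n : ℂ) * m = 1 := by linear_combination h4
    exact_mod_cast this
  exact ⟨Units.mkOfMulEqOne n m h5, hn⟩

/-- The bracket `[e_β, e_{-β}]` is the coroot, which is mapped to the coroot of `s_α β` without a
sign; so the signs of `β` and `-β` have product `1`. -/
theorem weylSign_negRoot (hV : Function.Injective (LieModule.toEnd ℂ 𝔤 V)) (α β : H.root) :
    Λ.weylSign α (negRoot β) = Λ.weylSign α β := by
  have h1 := Λ.adMat_weylElem_one hV α β
  have h2 := Λ.adMat_weylElem_one hV α (negRoot β)
  have h3 := Λ.adMat_weylElem_cartan α 1 (coroot β.1)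
  rw [← C.lie_neg β, rep_lie, map_sub, adMat_mul_apply, adMat_mul_apply, h1, h2,
    reflRoot_negRoot, smul_mul_smul_comm, smul_mul_smul_comm,
    mul_comm ((Λ.weylSign α (negRoot β) : ℤ) : ℂ), ← smul_sub, ← rep_lie, C.lie_neg,
    ← coroot_reflRoot] at h3
  have h4 : (((Λ.weylSign α β : ℤ) : ℂ) * ((Λ.weylSign α (negRoot β) : ℤ) : ℂ) - 1) •
      Λ.rep ((coroot (reflRoot α β).1 : H) : 𝔤) = 0 := by rw [sub_smul, h3, one_smul, sub_self]
  have h0 : Λ.rep ((coroot (reflRoot α β).1 : H) : 𝔤) ≠ 0 := by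
    rw [Ne, ← map_zero Λ.rep]
    exact fun h => ChevalleyBasis.coroot_ne_zero _ (Λ.rep_injective hV h)
  have h5 := (smul_eq_zero.1 h4).resolve_right h0
  have h6 : (Λ.weylSign α β) * (Λ.weylSign α (negRoot β)) = 1 := by
    have : ((Λ.weylSign α β : ℤ) : ℂ) * ((Λ.weylSign α (negRoot β) : ℤ) : ℂ) = 1 := by
      linear_combination h5
    apply Units.ext
    rw [Units.val_mul, Units.val_one]
    exact_mod_cast this
  rw [← Int.units_inv_eq_self (Λ.weylSign α β)]
  exact (inv_eq_of_mul_eq_one_right h6).symm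

theorem weylSign_self (hV : Function.Injective (LieModule.toEnd ℂ 𝔤 V)) (α : H.root) :
    Λ.weylSign α α = -1 := by
  have h1 := Λ.adMat_weylElem_one hV α α
  rw [adMat_weylElem_self, reflRoot_self] at h1
  have h2 : (((Λ.weylSign α α : ℤ) : ℂ) + 1) • Λ.rep (C.e (negRoot α)) = 0 := by
    rw [add_smul, ← h1]; simp
  have h3 := (smul_eq_zero.1 h2).resolve_right (Λ.rep_e_ne_zero hV _)
  have h4 : (Λ.weylSign α α : ℤ) = -1 := by
    have : ((Λ.weylSign α α : ℤ) : ℂ) = -1 := by linear_combination h3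
    exact_mod_cast this
  exact Units.ext h4

/-- The coefficient `± u ^ (-⟨β, α^∨⟩)`. -/
def weylCoeff {F : Type*} [CommRing F] (α β : H.root) (u : Fˣ) : Fˣ :=
  Units.map (Int.castRingHom F : ℤ →* F) (Λ.weylSign α β) * u ^ (-pair β α)

theorem map_weylCoeff {F F' : Type*} [CommRing F] [CommRing F'] (φ : F →+* F') (α β : H.root)
    (u : Fˣ) : Units.map (φ : F →* F') (Λ.weylCoeff α β u) =
      Λ.weylCoeff α β (Units.map (φ : F →* F') u) := by
  simp only [weylCoeff, map_mul, map_zpow]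
  congr 1
  exact Units.ext (by simp)

/-- In `w_α(u) = h_α(u) w_α(1)`, the second factor contributes the sign and the first one the power
of `u`. -/
theorem weylElem_conj_complex (hV : Function.Injective (LieModule.toEnd ℂ 𝔤 V)) (α β : H.root)
    (u : ℂˣ) (f : ℂ) : Λ.weylElem α u * Λ.rootElem β f * (Λ.weylElem α u)⁻¹ =
      Λ.rootElem (reflRoot α β) (Λ.weylCoeff α β u * f) := by
  apply conj_rootElem_of_adMat
  have h1 : Λ.weylElem α u = Λ.corootElem α u * Λ.weylElem α 1 := by
    rw [corootElem_eq, inv_mul_cancel_right]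
  have h2 := Λ.adMat_corootElem α (reflRoot α β) u
  change _ = ((u ^ pair (reflRoot α β) α : ℂˣ) : ℂ) • _ at h2
  rw [h1, adMat_mul, adMat_weylElem_one Λ hV, map_smul, h2, smul_smul, pair_reflRoot_left]
  simp [weylCoeff]

variable {F : Type*} [CommRing F]

theorem weylElem_conj (hV : Function.Injective (LieModule.toEnd ℂ 𝔤 V)) (α β : H.root)
    (u : Fˣ) (f : F) : Λ.weylElem α u * Λ.rootElem β f * (Λ.weylElem α u)⁻¹ =
      Λ.rootElem (reflRoot α β) (Λ.weylCoeff α β u * f) := by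
  obtain ⟨R, _, ψ, φ, u, v, f, hψ, rfl, -, rfl⟩ := exists_lift_to_complex u u f
  have h : Λ.weylElem α u * Λ.rootElem β f * (Λ.weylElem α u)⁻¹ =
      Λ.rootElem (reflRoot α β) (Λ.weylCoeff α β u * f) := by
    apply GL_map_injective hψ
    have := Λ.weylElem_conj_complex hV α β (Units.map (ψ : R →* ℂ) u) (ψ f)
    rw [← map_weylCoeff] at this
    simp only [map_mul, map_inv, map_weylElem, map_rootElem]
    exact this
  have := congrArg (Matrix.GeneralLinearGroup.map φ) h
  rw [← map_weylCoeff]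
  simp only [map_mul, map_inv, map_weylElem, map_rootElem] at this
  exact this

theorem corootElem_mul (α : H.root) (u v : Fˣ) :
    Λ.corootElem α (u * v) = Λ.corootElem α u * Λ.corootElem α v := by
  obtain ⟨R, _, ψ, φ, u, v, f, hψ, rfl, rfl, -⟩ := exists_lift_to_complex u v 0
  have h : Λ.corootElem α (u * v) = Λ.corootElem α u * Λ.corootElem α v := by
    apply GL_map_injective hψ
    simp only [map_mul, map_corootElem, corootElem_mul_complex]
  rw [← map_mul, ← map_corootElem, h, map_mul, map_corootElem, map_corootElem]

theorem corootElem_one (α : H.root) : Λ.corootElem α (1 : Fˣ) = 1 := by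
  rw [corootElem_eq, mul_inv_cancel]

theorem corootElem_inv (α : H.root) (u : Fˣ) :
    Λ.corootElem α u⁻¹ = (Λ.corootElem α u)⁻¹ := by
  rw [eq_inv_iff_mul_eq_one, ← corootElem_mul, inv_mul_cancel, corootElem_one]

theorem weylElem_eq_corootElem_mul (α : H.root) (u v : Fˣ) :
    Λ.weylElem α (u * v) = Λ.corootElem α u * Λ.weylElem α v := by
  have h : ∀ w : Fˣ, Λ.weylElem α w = Λ.corootElem α w * Λ.weylElem α 1 := fun w => by
    rw [corootElem_eq, inv_mul_cancel_right]
  rw [h (u * v), h v, corootElem_mul, mul_assoc]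

/-- In `h_α(u) = w_α(u) w_α(1)⁻¹` both factors contribute the same sign, and it cancels. -/
theorem corootElem_conj (hV : Function.Injective (LieModule.toEnd ℂ 𝔤 V)) (α β : H.root)
    (u : Fˣ) (f : F) : Λ.corootElem α u * Λ.rootElem β f * (Λ.corootElem α u)⁻¹ =
      Λ.rootElem β ((u ^ pair β α : Fˣ) * f) := by
  have h1 := Λ.weylElem_conj hV α (reflRoot α β) 1 (((Λ.weylCoeff α (reflRoot α β) 1)⁻¹ : Fˣ) * f)
  rw [reflRoot_reflRoot, Units.mul_inv_cancel_left] at h1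
  rw [corootElem_eq, mul_inv_rev, inv_inv, ← h1]
  have h2 := Λ.weylElem_conj hV α (reflRoot α β) u (((Λ.weylCoeff α (reflRoot α β) 1)⁻¹ : Fˣ) * f)
  rw [reflRoot_reflRoot, ← mul_assoc, ← Units.val_mul] at h2
  have h3 : Λ.weylCoeff α (reflRoot α β) u * (Λ.weylCoeff α (reflRoot α β) 1)⁻¹ =
      u ^ pair β α := by
    simp [weylCoeff, pair_reflRoot_left, mul_comm, mul_assoc]
  rw [h3] at h2
  rw [← h2]
  group

theorem weylCoeff_negRoot (hV : Function.Injective (LieModule.toEnd ℂ 𝔤 V)) (α β : H.root)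
    (u : Fˣ) : Λ.weylCoeff α (negRoot β) u = (Λ.weylCoeff α β u)⁻¹ := by
  rw [weylCoeff, weylCoeff, weylSign_negRoot Λ hV, pair_negRoot_left, mul_inv, ← map_inv,
    Int.units_inv_eq_self, ← zpow_neg]

theorem conj_weylElem_of {g : GL κ F} {β γ : H.root} {c : Fˣ}
    (h : ∀ f : F, g * Λ.rootElem β f * g⁻¹ = Λ.rootElem γ (c * f))
    (h' : ∀ f : F, g * Λ.rootElem (negRoot β) f * g⁻¹ = Λ.rootElem (negRoot γ) ((c⁻¹ : Fˣ) * f))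
    (v : Fˣ) : g * Λ.weylElem β v * g⁻¹ = Λ.weylElem γ (c * v) := by
  have e : g * Λ.weylElem β v * g⁻¹ = (g * Λ.rootElem β (v : F) * g⁻¹) *
    (g * Λ.rootElem (negRoot β) (-((v⁻¹ : Fˣ) : F)) * g⁻¹) * (g * Λ.rootElem β (v : F) * g⁻¹) := by
    rw [weylElem]; group
  rw [e, h, h', weylElem]
  simp [mul_comm]

theorem weylElem_conj_weylElem (hV : Function.Injective (LieModule.toEnd ℂ 𝔤 V)) (α β : H.root)
    (u v : Fˣ) : Λ.weylElem α u * Λ.weylElem β v * (Λ.weylElem α u)⁻¹ =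
      Λ.weylElem (reflRoot α β) (Λ.weylCoeff α β u * v) := by
  refine Λ.conj_weylElem_of (Λ.weylElem_conj hV α β u) (fun f => ?_) v
  rw [weylElem_conj Λ hV, reflRoot_negRoot, weylCoeff_negRoot Λ hV]

/-- `h_β(v)` is a quotient of two Weyl elements, whose parameters are multiplied by the same
coefficient. -/
theorem weylElem_conj_corootElem (hV : Function.Injective (LieModule.toEnd ℂ 𝔤 V))
    (α β : H.root) (u v : Fˣ) : Λ.weylElem α u * Λ.corootElem β v * (Λ.weylElem α u)⁻¹ =
      Λ.corootElem (reflRoot α β) v := by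
  have e : Λ.weylElem α u * Λ.corootElem β v * (Λ.weylElem α u)⁻¹ =
      (Λ.weylElem α u * Λ.weylElem β v * (Λ.weylElem α u)⁻¹) *
      (Λ.weylElem α u * Λ.weylElem β 1 * (Λ.weylElem α u)⁻¹)⁻¹ := by
    rw [corootElem_eq]; group
  rw [e, weylElem_conj_weylElem Λ hV, weylElem_conj_weylElem Λ hV, mul_comm, mul_one,
    weylElem_eq_corootElem_mul, mul_inv_cancel_right]

theorem corootElem_conj_weylElem (hV : Function.Injective (LieModule.toEnd ℂ 𝔤 V))
    (α β : H.root) (u v : Fˣ) : Λ.corootElem α u * Λ.weylElem β v * (Λ.corootElem α u)⁻¹ =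
      Λ.weylElem β (u ^ pair β α * v) := by
  refine Λ.conj_weylElem_of (Λ.corootElem_conj hV α β u) (fun f => ?_) v
  rw [corootElem_conj Λ hV, pair_negRoot_left, zpow_neg]

theorem corootElem_conj_corootElem (hV : Function.Injective (LieModule.toEnd ℂ 𝔤 V))
    (α β : H.root) (u v : Fˣ) : Λ.corootElem α u * Λ.corootElem β v * (Λ.corootElem α u)⁻¹ =
      Λ.corootElem β v := by
  have e : Λ.corootElem α u * Λ.corootElem β v * (Λ.corootElem α u)⁻¹ =
      (Λ.corootElem α u * Λ.weylElem β v * (Λ.corootElem α u)⁻¹) *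
      (Λ.corootElem α u * Λ.weylElem β 1 * (Λ.corootElem α u)⁻¹)⁻¹ := by
    rw [corootElem_eq Λ β]; group
  rw [e, corootElem_conj_weylElem Λ hV, corootElem_conj_weylElem Λ hV, mul_comm, mul_one,
    weylElem_eq_corootElem_mul, mul_inv_cancel_right]

/-- `w_α(-u⁻¹)` is unchanged by conjugation with itself, while the general rule turns it into a Weyl
element of `s_α α = -α`, with parameter `u`. -/
theorem weylElem_negRoot (hV : Function.Injective (LieModule.toEnd ℂ 𝔤 V)) (α : H.root)
    (u : Fˣ) : Λ.weylElem (negRoot α) u = Λ.weylElem α (-u⁻¹) := by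
  have h := Λ.weylElem_conj_weylElem hV α α (-u⁻¹) (-u⁻¹)
  rw [mul_inv_cancel_right, reflRoot_self] at h
  rw [h]
  congr 1
  have h1 : Units.map (Int.castRingHom F : ℤ →* F) (-1) = -1 := Units.ext (by simp)
  rw [weylCoeff, weylSign_self Λ hV, pair_self, h1]
  apply Units.ext
  simp [zpow_neg, zpow_ofNat, sq]

/-- Conjugating a root element by the opposite root group. -/
theorem rootElem_neg_conj (hV : Function.Injective (LieModule.toEnd ℂ 𝔤 V)) (α : H.root)
    (u : Fˣ) (f : F) : Λ.weylElem α u * Λ.rootElem α f * (Λ.weylElem α u)⁻¹ =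
      Λ.rootElem (negRoot α) (-((u⁻¹ : Fˣ) : F) ^ 2 * f) := by
  rw [weylElem_conj Λ hV, reflRoot_self, weylCoeff, weylSign_self Λ hV, pair_self]
  congr 2
  simp [zpow_neg, zpow_ofNat]

/-- The factorization of `x_α(c) x_{-α}(f)` when `1 + c f` is invertible. -/
theorem rootElem_mul_rootElem_negRoot (hV : Function.Injective (LieModule.toEnd ℂ 𝔤 V))
    (α : H.root) (c : F) (f D : Fˣ) (hD : (D : F) = 1 + c * f) :
    Λ.rootElem α c * Λ.rootElem (negRoot α) (f : F) =
      Λ.rootElem (negRoot α) ((f : F) * (D⁻¹ : Fˣ)) * Λ.corootElem α D *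
        Λ.rootElem α (c * (D⁻¹ : Fˣ)) := by
  -- Solves the definition of `w_α(a⁻¹)` for its middle factor. Applied to `f` and to `f D⁻¹`, it
  -- reduces the claim to additivity of `x_α` and the torus action; this is why `f` has to be a
  -- unit.
  have key : ∀ a : Fˣ, Λ.rootElem (negRoot α) (a : F) = Λ.rootElem α ((a⁻¹ : Fˣ) : F) *
      (Λ.weylElem α a⁻¹)⁻¹ * Λ.rootElem α ((a⁻¹ : Fˣ) : F) := by
    intro a
    rw [weylElem, inv_inv, rootElem_neg]
    group
  have e1 : Λ.rootElem (negRoot α) ((f : F) * (D⁻¹ : Fˣ)) =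
      Λ.rootElem α ((D : F) * (f⁻¹ : Fˣ)) * (Λ.weylElem α (D * f⁻¹))⁻¹ *
        Λ.rootElem α ((D : F) * (f⁻¹ : Fˣ)) := by
    have := key (f * D⁻¹)
    rw [mul_inv_rev, inv_inv] at this
    exact this
  have e2 : Λ.rootElem α ((D : F) * (f⁻¹ : Fˣ)) =
      Λ.rootElem α c * Λ.rootElem α ((f⁻¹ : Fˣ) : F) := by
    rw [← rootElem_add]; congr 1; rw [hD, add_mul, one_mul, mul_assoc, Units.mul_inv]; ring
  have e3 : Λ.weylElem α (D * f⁻¹) = Λ.corootElem α D * Λ.weylElem α f⁻¹ :=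
    Λ.weylElem_eq_corootElem_mul α D f⁻¹
  have e4 : Λ.rootElem α ((D : F) * (f⁻¹ : Fˣ)) * Λ.corootElem α D =
      Λ.corootElem α D * Λ.rootElem α (((f⁻¹ : Fˣ) : F) * (D⁻¹ : Fˣ)) := by
    have e5 := Λ.corootElem_conj hV α α D (((f⁻¹ : Fˣ) : F) * (D⁻¹ : Fˣ))
    rw [mul_inv_eq_iff_eq_mul] at e5
    rw [e5, pair_self]
    congr 2
    have : (((D ^ (2 : ℤ)) : Fˣ) : F) = D * D := by simp [zpow_ofNat, sq]
    rw [this]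
    calc (D : F) * (f⁻¹ : Fˣ) = D * (f⁻¹ : Fˣ) * (D * (D⁻¹ : Fˣ)) := by rw [Units.mul_inv, mul_one]
      _ = _ := by ring
  have e5 : Λ.rootElem α (((f⁻¹ : Fˣ) : F) * (D⁻¹ : Fˣ)) * Λ.rootElem α (c * (D⁻¹ : Fˣ)) =
      Λ.rootElem α ((f⁻¹ : Fˣ) : F) := by
    rw [← rootElem_add]
    congr 1
    have h1 : (((f⁻¹ : Fˣ) : F) + c) = D * (f⁻¹ : Fˣ) := by
      rw [hD, add_mul, one_mul, mul_assoc, Units.mul_inv, mul_one]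
    rw [← add_mul, h1, mul_right_comm, Units.mul_inv, one_mul]
  rw [key f, e1, e3, mul_inv_rev]
  calc Λ.rootElem α c * (Λ.rootElem α ((f⁻¹ : Fˣ) : F) * (Λ.weylElem α f⁻¹)⁻¹ *
        Λ.rootElem α ((f⁻¹ : Fˣ) : F))
      = Λ.rootElem α ((D : F) * (f⁻¹ : Fˣ)) * (Λ.weylElem α f⁻¹)⁻¹ *
        Λ.rootElem α ((f⁻¹ : Fˣ) : F) := by rw [e2]; group
    _ = Λ.rootElem α ((D : F) * (f⁻¹ : Fˣ)) * ((Λ.weylElem α f⁻¹)⁻¹ * (Λ.corootElem α D)⁻¹) *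
        (Λ.corootElem α D * Λ.rootElem α (((f⁻¹ : Fˣ) : F) * (D⁻¹ : Fˣ))) *
          Λ.rootElem α (c * (D⁻¹ : Fˣ)) := by rw [← e5]; group
    _ = _ := by rw [← e4]; group

end AdmissibleLattice

end Finite

end AffineFlag

end

noncomputable section

namespace AffineFlag

/-! ### Coefficients of matrices over a polynomial ring in two variables -/

section Coeff

set_option linter.unusedSectionVars false

variable {κ : Type*} [Fintype κ] [DecidableEq κ] {R : Type*} [CommRing R]

/-- The matrix of coefficients of a monomial. -/
def coeffMat (m : Fin 2 →₀ ℕ) : Matrix κ κ (MvPolynomial (Fin 2) R) →ₗ[R] Matrix κ κ R :=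
  (MvPolynomial.lcoeff R m).mapMatrix

theorem coeffMat_apply (m : Fin 2 →₀ ℕ) (Y : Matrix κ κ (MvPolynomial (Fin 2) R)) (i j : κ) :
    coeffMat m Y i j = (Y i j).coeff m := rfl

theorem coeffMat_mul (m : Fin 2 →₀ ℕ) (Y Z : Matrix κ κ (MvPolynomial (Fin 2) R)) :
    coeffMat m (Y * Z) = ∑ p ∈ Finset.HasAntidiagonal.antidiagonal m,
      coeffMat p.1 Y * coeffMat p.2 Z := by
  ext i j
  simp only [coeffMat_apply, Matrix.mul_apply, MvPolynomial.coeff_sum, MvPolynomial.coeff_mul,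
    Matrix.sum_apply]
  exact Finset.sum_comm

theorem coeffMat_one (m : Fin 2 →₀ ℕ) :
    coeffMat m (1 : Matrix κ κ (MvPolynomial (Fin 2) R)) = if m = 0 then 1 else 0 := by
  ext i j
  rw [coeffMat_apply, Matrix.one_apply]
  split_ifs with h1 h2 h2
  · rw [MvPolynomial.coeff_one, if_pos h2.symm, h1, Matrix.one_apply_eq]
  · rw [MvPolynomial.coeff_one, if_neg (Ne.symm h2), Matrix.zero_apply]
  · rw [MvPolynomial.coeff_zero, Matrix.one_apply_ne h1]
  · rw [MvPolynomial.coeff_zero, Matrix.zero_apply]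

theorem coeffMat_monomial_smul (m n : Fin 2 →₀ ℕ) (c : R) (Y : Matrix κ κ R) :
    coeffMat m (MvPolynomial.monomial n c • Y.map (MvPolynomial.C : R → MvPolynomial (Fin 2) R)) =
      if n = m then c • Y else 0 := by
  ext i j
  rw [coeffMat_apply, Matrix.smul_apply, Matrix.map_apply, smul_eq_mul, mul_comm,
    MvPolynomial.coeff_C_mul, MvPolynomial.coeff_monomial]
  split_ifs
  · rw [Matrix.smul_apply, smul_eq_mul, mul_comm]
  · simp

theorem matrix_ext_coeffMat {Y Z : Matrix κ κ (MvPolynomial (Fin 2) R)}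
    (h : ∀ m, coeffMat m Y = coeffMat m Z) : Y = Z := by
  ext i j m
  exact congrFun (congrFun (h m) i) j

theorem coeffMat_map {R' : Type*} [CommRing R'] (φ : R →+* R') (m : Fin 2 →₀ ℕ)
    (Y : Matrix κ κ (MvPolynomial (Fin 2) R)) :
    coeffMat m (Y.map (MvPolynomial.map φ)) = (coeffMat m Y).map φ := by
  ext i j
  simp [coeffMat_apply, MvPolynomial.coeff_map]

end Coeff

/-! ### The commutator formula -/

section Finite

variable {𝔤 : Type*} [LieRing 𝔤] [LieAlgebra ℂ 𝔤] [FiniteDimensional ℂ 𝔤] [IsKilling ℂ 𝔤]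
variable {H : LieSubalgebra ℂ 𝔤} [H.IsCartanSubalgebra]
variable {V : Type*} [AddCommGroup V] [Module ℂ V] [LieRingModule 𝔤 V] [LieModule ℂ 𝔤 V]
variable {C : ChevalleyBasis H} {κ : Type*} [Fintype κ] [DecidableEq κ]

/-- The functional `m₀ α + m₁ β`. -/
def pairWeight (α β : H.root) (m : Fin 2 →₀ ℕ) : Module.Dual ℂ H :=
  m 0 • (rootSystem H).root α + m 1 • (rootSystem H).root β

theorem pairWeight_add (α β : H.root) (m n : Fin 2 →₀ ℕ) :
    pairWeight α β (m + n) = pairWeight α β m + pairWeight α β n := by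
  simp only [pairWeight, Finsupp.add_apply, add_smul]; abel

theorem linearIndependent_pair_of_ne {α β : H.root} (h : β ≠ α) (h' : β ≠ negRoot α) :
    LinearIndependent ℂ ![(rootSystem H).root α, (rootSystem H).root β] := by
  refine RootPairing.IsReduced.linearIndependent (rootSystem H) h.symm fun h2 => h' ?_
  apply (rootSystem H).root.injective
  rw [root_negRoot, h2, neg_neg]

/-- As `α` and `β` are independent, the weight determines the monomial, so each root occurs in at
most one bidegree. -/
theorem pairWeight_injective {α β : H.root} (h : β ≠ α) (h' : β ≠ negRoot α) {m n : Fin 2 →₀ ℕ}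
    (hmn : pairWeight α β m = pairWeight α β n) : m = n := by
  have hli := LinearIndependent.pair_iff.1 (linearIndependent_pair_of_ne h h')
    ((m 0 : ℂ) - n 0) ((m 1 : ℂ) - n 1) (by
      simp only [pairWeight, ← Nat.cast_smul_eq_nsmul ℂ] at hmn
      rw [sub_smul, sub_smul, ← sub_eq_zero.2 hmn]; abel)
  ext i
  fin_cases i
  · exact_mod_cast sub_eq_zero.1 hli.1
  · exact_mod_cast sub_eq_zero.1 hli.2

/-- If `m₀ α + m₁ β ≠ 0` is not a root, the root space is trivial. -/
theorem exists_root_of_mem_rootSpace {χ : Module.Dual ℂ H} (hχ : χ ≠ 0) {x : 𝔤}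
    (hx : x ∈ rootSpace H χ) (hx0 : x ≠ 0) : ∃ γ : H.root, (rootSystem H).root γ = χ := by
  have hne : LieModule.genWeightSpace 𝔤 (χ : H → ℂ) ≠ ⊥ := by
    intro h
    exact hx0 (by simpa using h.le hx)
  refine ⟨⟨⟨χ, hne⟩, ?_⟩, ?_⟩
  · simp only [Finset.mem_filter, Finset.mem_univ, true_and]
    intro h
    apply hχ
    ext y
    exact congrFun h y
  · ext y
    simp

namespace AdmissibleLattice

variable (Λ : AdmissibleLattice C V κ)

/-- The matrices over `ℂ[s, t]` whose coefficient at `s ^ i t ^ j` lies in the root space of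
`i α + j β`. -/
def graded (α β : H.root) : Submodule ℚ (Matrix κ κ (MvPolynomial (Fin 2) ℂ)) where
  carrier := {Y | ∀ m, ∃ x ∈ rootSpace H (pairWeight α β m), coeffMat m Y = Λ.rep x}
  zero_mem' m := ⟨0, zero_mem _, by simp⟩
  add_mem' hY hZ m := by
    obtain ⟨x, hx, ex⟩ := hY m
    obtain ⟨y, hy, ey⟩ := hZ m
    exact ⟨x + y, add_mem hx hy, by rw [map_add, map_add, ex, ey]⟩
  smul_mem' c Y hY m := by
    obtain ⟨x, hx, ex⟩ := hY m
    refine ⟨(c : ℂ) • x, (rootSpace H (pairWeight α β m)).smul_mem _ hx, ?_⟩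
    have e : c • Y = (c : ℂ) • Y := by
      ext i j : 2
      simp only [Matrix.smul_apply, Algebra.smul_def]
      congr 1
    rw [e, map_smul, ex, map_smul]

theorem lie_mem_graded {α β : H.root} {X Y : Matrix κ κ (MvPolynomial (Fin 2) ℂ)}
    (hX : X ∈ Λ.graded α β) (hY : Y ∈ Λ.graded α β) : X * Y - Y * X ∈ Λ.graded α β := by
  intro m
  choose x hx ex using hX
  choose y hy ey using hY
  refine ⟨∑ p ∈ Finset.HasAntidiagonal.antidiagonal m, ⁅x p.1, y p.2⁆, ?_, ?_⟩
  · refine sum_mem fun p hp => ?_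
    have h1 := lie_mem_genWeightSpace_of_mem_genWeightSpace (hx p.1) (hy p.2)
    have h2 : (pairWeight α β m : H → ℂ) = pairWeight α β p.1 + pairWeight α β p.2 := by
      rw [← Finset.HasAntidiagonal.mem_antidiagonal.1 hp, pairWeight_add]; rfl
    rw [h2]; exact h1
  · rw [map_sub, coeffMat_mul, coeffMat_mul,
      Finsupp.sum_antidiagonal_swap m (fun a b => coeffMat a Y * coeffMat b X),
      ← Finset.sum_sub_distrib, map_sum]
    refine Finset.sum_congr rfl fun p _ => ?_
    rw [rep_lie, ex, ey]

theorem monomial_smul_mem_graded {α β γ : H.root} {m : Fin 2 →₀ ℕ}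
    (h : (rootSystem H).root γ = pairWeight α β m) (c : ℂ) :
    MvPolynomial.monomial m c • Λ.repIn (MvPolynomial (Fin 2) ℂ) (C.e γ) ∈ Λ.graded α β := by
  intro n
  by_cases hmn : m = n
  · subst hmn
    refine ⟨c • C.e γ, ?_, ?_⟩
    · rw [← h]
      exact (rootSpace H γ.1).smul_mem _ (C.mem_rootSpace γ)
    · rw [repIn, MvPolynomial.algebraMap_eq, coeffMat_monomial_smul, if_pos rfl, map_smul]
  · exact ⟨0, zero_mem _, by
      rw [repIn, MvPolynomial.algebraMap_eq, coeffMat_monomial_smul, if_neg hmn, map_zero]⟩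

/-- Invertible matrices over `ℂ[s, t]` which preserve the graded subspace and whose logarithmic
derivative with respect to `t` lies in it. -/
structure HasGradedLog (α β : H.root) (g : GL κ (MvPolynomial (Fin 2) ℂ)) : Prop where
  inv_mem : ∀ Y ∈ Λ.graded α β, adMat g⁻¹ Y ∈ Λ.graded α β
  exists_log : ∃ Z ∈ Λ.graded α β, ∀ m : Fin 2 →₀ ℕ,
    (m 1 : ℂ) • coeffMat m (g : Matrix κ κ (MvPolynomial (Fin 2) ℂ)) =
      coeffMat m ((g : Matrix κ κ (MvPolynomial (Fin 2) ℂ)) * Z)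

/-- With `∂ = t ∂/∂t` one has `(g h)⁻¹ ∂(g h) = h⁻¹ (g⁻¹ ∂g) h + h⁻¹ ∂h`, which is why stability
under `h⁻¹` is part of the structure. -/
theorem HasGradedLog.mul {α β : H.root} {g h : GL κ (MvPolynomial (Fin 2) ℂ)}
    (hg : Λ.HasGradedLog α β g) (hh : Λ.HasGradedLog α β h) : Λ.HasGradedLog α β (g * h) := by
  obtain ⟨hg1, Z, hZ, eZ⟩ := hg
  obtain ⟨hh1, W, hW, eW⟩ := hh
  refine ⟨fun Y hY => ?_, adMat h⁻¹ Z + W, add_mem (hh1 Z hZ) hW, fun m => ?_⟩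
  · rw [mul_inv_rev, adMat_mul]
    exact hh1 _ (hg1 _ hY)
  · have e : ((g * h : GL κ _) : Matrix κ κ (MvPolynomial (Fin 2) ℂ)) * (adMat h⁻¹ Z + W) =
        (g * Z) * h + g * (h * W) := by
      have := mul_eq_adMat_mul h (adMat h⁻¹ Z)
      rw [adMat_adMat_inv] at this
      rw [Units.val_mul, mul_add, mul_assoc, this]
      simp only [mul_assoc]
    rw [e, map_add, Units.val_mul, coeffMat_mul, coeffMat_mul, coeffMat_mul,
      ← Finset.sum_add_distrib, Finset.smul_sum]
    refine Finset.sum_congr rfl fun p hp => ?_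
    have hp' : p.1 1 + p.2 1 = m 1 := by
      rw [← Finset.HasAntidiagonal.mem_antidiagonal.1 hp]; rfl
    rw [← hp', ← eZ, ← eW, Nat.cast_add, add_smul, smul_mul_assoc, mul_smul_comm]

/-- The logarithmic derivative of `x_γ(c s ^ i t ^ j)` with respect to `t` is `j c s ^ i t ^ j e_γ`,
where `j` is `m 1`. -/
theorem hasGradedLog_rootElem {α β γ : H.root} {m : Fin 2 →₀ ℕ}
    (h : (rootSystem H).root γ = pairWeight α β m) (c : ℂ) :
    Λ.HasGradedLog α β (Λ.rootElem γ (MvPolynomial.monomial m c)) := by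
  have hpow : ∀ r : ℕ, (MvPolynomial.monomial m c) ^ r • Λ.divPowIn (MvPolynomial (Fin 2) ℂ) γ r =
      MvPolynomial.monomial (r • m) (c ^ r) •
        (Λ.divPowIn ℂ γ r).map (MvPolynomial.C : ℂ → MvPolynomial (Fin 2) ℂ) := by
    intro r
    rw [MvPolynomial.monomial_pow]
    congr 1
  refine ⟨fun Y hY => ?_, (m 1 : ℚ) • (MvPolynomial.monomial m c •
    Λ.repIn (MvPolynomial (Fin 2) ℂ) (C.e γ)), Submodule.smul_mem _ _
      (Λ.monomial_smul_mem_graded h c), fun n => ?_⟩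
  · rw [← rootElem_neg, ← map_neg]
    exact Λ.rootMatrix_conj_mem (Λ.graded α β) γ _
      (fun Y hY => Λ.lie_mem_graded (Λ.monomial_smul_mem_graded h (-c)) hY) hY
  · have e1 : Λ.repIn (MvPolynomial (Fin 2) ℂ) (C.e γ) =
        Λ.divPowIn (MvPolynomial (Fin 2) ℂ) γ 1 := by
      rw [repIn, MvPolynomial.algebraMap_eq,
        ← Λ.divPowIn_map (MvPolynomial.C : ℂ →+* MvPolynomial (Fin 2) ℂ), divPowIn_complex,
        Nat.factorial_one, Nat.cast_one, inv_one, one_smul, pow_one]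
    set N := Fintype.card κ
    have e2 : (Λ.rootElem γ (MvPolynomial.monomial m c) : Matrix κ κ _) *
        ((m 1 : ℚ) • (MvPolynomial.monomial m c •
          Λ.repIn (MvPolynomial (Fin 2) ℂ) (C.e γ))) =
        ∑ r ∈ Finset.range N, ((m 1 * (r + 1) : ℕ) : ℂ) • ((MvPolynomial.monomial m c) ^ (r + 1) •
          Λ.divPowIn (MvPolynomial (Fin 2) ℂ) γ (r + 1)) := by
      rw [e1]
      change Λ.rootMatrix γ _ * _ = _
      rw [rootMatrix, Finset.sum_mul]
      refine Finset.sum_congr rfl fun r _ => ?_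
      rw [mul_smul_comm, smul_mul_smul_comm, divPowIn_mul, Nat.choose_symm_add,
        Nat.choose_one_right, ← pow_succ]
      rw [Nat.cast_smul_eq_nsmul, Nat.cast_smul_eq_nsmul, Nat.cast_smul_eq_nsmul, mul_smul,
        smul_comm (_ ^ _) (r + 1)]
    rw [e2]
    change _ • coeffMat n (Λ.rootMatrix γ _) = _
    rw [Λ.rootMatrix_eq_sum γ _ (Nat.le_succ N), Finset.sum_range_succ', map_add, map_sum, map_sum,
      smul_add, Finset.smul_sum]
    have e3 : (n 1 : ℂ) • coeffMat n ((MvPolynomial.monomial m c) ^ 0 •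
        Λ.divPowIn (MvPolynomial (Fin 2) ℂ) γ 0) = 0 := by
      rw [hpow, coeffMat_monomial_smul]
      split_ifs with h0
      · rw [← h0]; simp
      · rw [smul_zero]
    rw [e3, add_zero]
    refine Finset.sum_congr rfl fun r _ => ?_
    rw [hpow, LinearMap.map_smul, coeffMat_monomial_smul]
    split_ifs with h0
    · congr 1
      rw [← h0]; simp [mul_comm]
    · rw [smul_zero, smul_zero]

/-- The reduction of an element over `ℤ[s, t]` to `ℂ[s, t]`. -/
abbrev toComplexPoly : GL κ (MvPolynomial (Fin 2) ℤ) →* GL κ (MvPolynomial (Fin 2) ℂ) :=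
  Matrix.GeneralLinearGroup.map (MvPolynomial.map (Int.castRingHom ℂ))

theorem coeffMat_toComplexPoly (g : GL κ (MvPolynomial (Fin 2) ℤ)) (m : Fin 2 →₀ ℕ) :
    coeffMat m (toComplexPoly g : Matrix κ κ (MvPolynomial (Fin 2) ℂ)) =
      (coeffMat m (g : Matrix κ κ (MvPolynomial (Fin 2) ℤ))).map (Int.cast : ℤ → ℂ) :=
  coeffMat_map (Int.castRingHom ℂ) m (g : Matrix κ κ (MvPolynomial (Fin 2) ℤ))

/-- An element is trivial up to order `N` in `t`. -/
def TrivialTo (N : ℕ) (g : GL κ (MvPolynomial (Fin 2) ℤ)) : Prop :=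
  ∀ m : Fin 2 →₀ ℕ, m 1 < N → coeffMat m (g : Matrix κ κ (MvPolynomial (Fin 2) ℤ)) = coeffMat m 1

/-- Let `Z` be the logarithmic derivative. Where `g` agrees with `1` up to order `N`, both `g Z` and
`Z` vanish in `t`-degrees below `N` and agree in degree `N`. There `N` times the coefficient of `g`
is the coefficient of `Z`, which lies in the root space by assumption. -/
theorem coeffMat_mem_of_trivialTo {α β : H.root} {N : ℕ} (hN : 1 ≤ N)
    {g : GL κ (MvPolynomial (Fin 2) ℤ)} (hg : TrivialTo N g)
    (hl : Λ.HasGradedLog α β (toComplexPoly g)) {m : Fin 2 →₀ ℕ} (hm : m 1 = N) :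
    ∃ x ∈ rootSpace H (pairWeight α β m),
      coeffMat m (toComplexPoly g : Matrix κ κ (MvPolynomial (Fin 2) ℂ)) = Λ.rep x := by
  obtain ⟨-, Z, hZ, eZ⟩ := hl
  set G := toComplexPoly g
  have hG : ∀ n : Fin 2 →₀ ℕ, n 1 < N → coeffMat n (G : Matrix κ κ (MvPolynomial (Fin 2) ℂ)) = if n = 0 then 1 else 0 := by
    intro n hn
    rw [coeffMat_toComplexPoly, hg n hn, coeffMat_one]
    split_ifs
    · exact Matrix.map_one _ (by simp) (by simp)
    · exact Matrix.map_zero _ (by simp)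
  have h1 : ∀ n : Fin 2 →₀ ℕ, n 1 < N → coeffMat n ((G : Matrix κ κ (MvPolynomial (Fin 2) ℂ)) * Z) = 0 := by
    intro n hn
    rw [← eZ, hG n hn]
    split_ifs with h0
    · rw [h0]; simp
    · rw [smul_zero]
  have h2 : ∀ n : Fin 2 →₀ ℕ, n 1 < N → coeffMat n Z = 0 := by
    intro n hn
    have e : Z = ((G⁻¹ : GL κ _) : Matrix κ κ _) * ((G : Matrix κ κ (MvPolynomial (Fin 2) ℂ)) * Z) := by
      rw [← mul_assoc, Units.inv_mul, one_mul]
    rw [e, coeffMat_mul]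
    refine Finset.sum_eq_zero fun p hp => ?_
    rw [h1, mul_zero]
    have : p.1 1 + p.2 1 = n 1 := by
      rw [← Finset.HasAntidiagonal.mem_antidiagonal.1 hp]; rfl
    omega
  have h3 : coeffMat m ((G : Matrix κ κ (MvPolynomial (Fin 2) ℂ)) * Z) = coeffMat m Z := by
    rw [coeffMat_mul, Finset.sum_eq_single (0, m)]
    · rw [hG 0 (by rw [Finsupp.zero_apply]; omega), if_pos rfl, one_mul]
    · intro p hp hne
      have hp2 := Finset.HasAntidiagonal.mem_antidiagonal.1 hp
      have hp' : p.1 1 + p.2 1 = m 1 := by rw [← hp2]; rfl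
      rcases Nat.lt_or_ge (p.2 1) N with h | h
      · rw [h2 _ h, mul_zero]
      · rw [hG p.1 (by omega), if_neg, zero_mul]
        intro h0
        apply hne
        rw [h0, zero_add] at hp2
        exact Prod.ext h0 hp2
    · intro h
      exact absurd (Finset.HasAntidiagonal.mem_antidiagonal.2 (zero_add m)) h
  obtain ⟨z, hz, ez⟩ := hZ m
  refine ⟨(N : ℂ)⁻¹ • z, (rootSpace H (pairWeight α β m)).smul_mem _ hz, ?_⟩
  have hN0 : (N : ℂ) ≠ 0 := by exact_mod_cast (by omega : N ≠ 0)
  rw [map_smul, ← ez, ← h3, ← eZ, hm, smul_smul, inv_mul_cancel₀ hN0, one_smul]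

theorem coeffMat_rootElem_of_le {γ : H.root} {N : ℕ} (hN : 1 ≤ N) {m : Fin 2 →₀ ℕ} (hm : m 1 = N)
    (c : ℤ) {n : Fin 2 →₀ ℕ} (hn : n 1 ≤ N) :
    coeffMat n (Λ.rootElem γ (MvPolynomial.monomial m c) : Matrix κ κ _) =
      coeffMat n 1 + if n = m then c • Λ.divPow γ 1 else 0 := by
  have hpow : ∀ r : ℕ, (MvPolynomial.monomial m c) ^ r • Λ.divPowIn (MvPolynomial (Fin 2) ℤ) γ r =
      MvPolynomial.monomial (r • m) (c ^ r) •
        (Λ.divPow γ r).map (MvPolynomial.C : ℤ → MvPolynomial (Fin 2) ℤ) := by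
    intro r
    rw [MvPolynomial.monomial_pow]
    congr 1
  change coeffMat n (Λ.rootMatrix γ _) = _
  rw [Λ.rootMatrix_eq_sum γ _ (Nat.le_add_right _ 2), Finset.sum_range_succ',
    Finset.sum_range_succ', map_add, map_add, map_sum, Finset.sum_eq_zero, zero_add, hpow, hpow,
    coeffMat_monomial_smul, coeffMat_monomial_smul, coeffMat_one, divPow_zero, add_comm]
  · simp only [zero_add, one_smul, zero_smul, pow_one, pow_zero, eq_comm]
  · intro r _
    -- The divided powers of order at least two live in `t`-degree at least `2 N > N`.
    rw [hpow, coeffMat_monomial_smul, if_neg]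
    intro h
    rw [← h, Finsupp.smul_apply, hm] at hn
    simp only [smul_eq_mul] at hn
    nlinarith

/-- The set `T` contains the monomials of `t`-degree `N` that may still occur. Each coefficient
there is a complex multiple of a root vector, an integral one by primitivity, so a root element over
`ℤ[s, t]` removes it without touching the other coefficients of `t`-degree at most `N`. -/
theorem exists_trivialTo_succ (hV : Function.Injective (LieModule.toEnd ℂ 𝔤 V)) {α β : H.root}
    (hβ : β ≠ α) (hβ' : β ≠ negRoot α) (S : Subgroup (GL κ (MvPolynomial (Fin 2) ℤ)))
    (hS : ∀ (γ : H.root) (m : Fin 2 →₀ ℕ) (c : ℤ), 1 ≤ m 1 →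
      (rootSystem H).root γ = pairWeight α β m → Λ.rootElem γ (MvPolynomial.monomial m c) ∈ S)
    {N : ℕ} (hN : 1 ≤ N) (T : Finset (Fin 2 →₀ ℕ)) :
    ∀ (g : GL κ (MvPolynomial (Fin 2) ℤ)), TrivialTo N g →
      Λ.HasGradedLog α β (toComplexPoly g) →
      (∀ m, m 1 = N → m ∉ T → coeffMat m (g : Matrix κ κ (MvPolynomial (Fin 2) ℤ)) = 0) →
      ∃ p ∈ S, TrivialTo (N + 1) (g * p) ∧ Λ.HasGradedLog α β (toComplexPoly (g * p)) := by
  classical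
  induction T using Finset.induction_on with
  | empty =>
    intro g hg hl h
    refine ⟨1, one_mem _, fun m hm => ?_, by rwa [mul_one]⟩
    rw [mul_one]
    rcases Nat.lt_or_ge (m 1) N with h1 | h1
    · exact hg m h1
    · rw [h m (by omega) (by simp), coeffMat_one, if_neg]
      rintro rfl
      simp at h1; omega
  | insert m T hmT ih =>
    intro g hg hl h
    by_cases hm : m 1 = N ∧ coeffMat m (g : Matrix κ κ (MvPolynomial (Fin 2) ℤ)) ≠ 0
    · obtain ⟨hm1, hm2⟩ := hm
      obtain ⟨x, hx, ex⟩ := Λ.coeffMat_mem_of_trivialTo hN hg hl hm1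
      rw [coeffMat_toComplexPoly] at ex
      have hx0 : x ≠ 0 := by
        rintro rfl
        apply hm2
        apply castMatrix_injective κ
        change (coeffMat m (g : Matrix κ κ (MvPolynomial (Fin 2) ℤ))).map (Int.cast : ℤ → ℂ) = _
        rw [ex, map_zero]; ext; simp
      have hχ : pairWeight α β m ≠ 0 := by
        intro h0
        have : m = 0 := pairWeight_injective hβ hβ' (by rw [h0]; simp [pairWeight])
        rw [this] at hm1; simp at hm1; omega
      obtain ⟨γ, hγ⟩ := exists_root_of_mem_rootSpace hχ hx hx0
      rw [← hγ] at hx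
      obtain ⟨c, rfl⟩ := C.exists_smul_of_mem_rootSpace γ hx
      rw [map_smul] at ex
      obtain ⟨c, rfl⟩ := Λ.exists_int_of_smul_rep hV γ c _ ex
      have ec : coeffMat m (g : Matrix κ κ (MvPolynomial (Fin 2) ℤ)) = c • Λ.divPow γ 1 := by
        apply castMatrix_injective κ
        change (coeffMat m (g : Matrix κ κ (MvPolynomial (Fin 2) ℤ))).map (Int.cast : ℤ → ℂ) = _
        rw [ex, ← divPow_one_map]; ext; simp [Matrix.smul_apply, -zsmul_eq_mul]
      set q := Λ.rootElem γ (MvPolynomial.monomial m (-c))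
      have hq : q ∈ S := hS γ m (-c) (by omega) hγ
      have hcoeff : ∀ n : Fin 2 →₀ ℕ, n 1 ≤ N → coeffMat n ((g * q : GL κ _) : Matrix κ κ _) =
          coeffMat n (g : Matrix κ κ (MvPolynomial (Fin 2) ℤ)) - if n = m then c • Λ.divPow γ 1 else 0 := by
        intro n hn
        have e1 : ∀ p ∈ Finset.HasAntidiagonal.antidiagonal n,
            coeffMat p.1 (g : Matrix κ κ (MvPolynomial (Fin 2) ℤ)) * coeffMat p.2 (q : Matrix κ κ (MvPolynomial (Fin 2) ℤ)) =
            coeffMat p.1 (g : Matrix κ κ (MvPolynomial (Fin 2) ℤ)) * coeffMat p.2 1 -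
            if p.2 = m then coeffMat p.1 (g : Matrix κ κ (MvPolynomial (Fin 2) ℤ)) * (c • Λ.divPow γ 1) else 0 := by
          intro p hp
          have : p.1 1 + p.2 1 = n 1 := by
            rw [← Finset.HasAntidiagonal.mem_antidiagonal.1 hp]; rfl
          rw [Λ.coeffMat_rootElem_of_le hN hm1 (-c) (by omega), mul_add]
          split_ifs
          · rw [neg_smul, mul_neg, sub_eq_add_neg]
          · rw [mul_zero, add_zero, sub_zero]
        rw [Units.val_mul, coeffMat_mul, Finset.sum_congr rfl e1, Finset.sum_sub_distrib,
          ← coeffMat_mul, mul_one]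
        congr 1
        have e2 : ∀ p ∈ Finset.HasAntidiagonal.antidiagonal n,
            (if p.2 = m then coeffMat p.1 (g : Matrix κ κ (MvPolynomial (Fin 2) ℤ)) * (c • Λ.divPow γ 1) else 0) =
            if p = (0, m) then c • Λ.divPow γ 1 else 0 := by
          rintro ⟨a, b⟩ hp
          have hab : a 1 + b 1 = n 1 := by
            rw [← Finset.HasAntidiagonal.mem_antidiagonal.1 hp]; rfl
          simp only [Prod.mk.injEq]
          by_cases hb : b = m
          · subst hb
            rw [hg a (by omega), coeffMat_one]
            by_cases ha : a = 0 <;> simp [ha]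
          · simp [hb]
        rw [Finset.sum_congr rfl e2, Finset.sum_ite_eq']
        simp [eq_comm]
      have hq' : Λ.HasGradedLog α β (toComplexPoly q) := by
        have : toComplexPoly q = Λ.rootElem γ (MvPolynomial.monomial m ((-c : ℤ) : ℂ)) := by
          rw [toComplexPoly, map_rootElem, MvPolynomial.map_monomial]; rfl
        rw [this]
        exact Λ.hasGradedLog_rootElem hγ _
      obtain ⟨p, hp, hp1, hp2⟩ := ih (g * q) (fun n hn => by
          rw [hcoeff n hn.le, if_neg (by rintro rfl; omega), sub_zero, hg n hn])
        (by rw [map_mul]; exact HasGradedLog.mul Λ hl hq') (fun n hn hnT => by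
          rw [hcoeff n hn.le]
          by_cases hnm : n = m
          · rw [if_pos hnm, hnm, ec, sub_self]
          · rw [if_neg hnm, sub_zero, h n hn (by simp [hnm, hnT])])
      exact ⟨q * p, mul_mem hq hp, by rwa [← mul_assoc], by rwa [← mul_assoc]⟩
    · refine ih g hg hl fun n hn hnT => ?_
      by_cases hnm : n = m
      · subst hnm
        by_contra h0
        exact hm ⟨hn, h0⟩
      · exact h n hn (by simp [hnm, hnT])

/-- The conjugate differs from `1` by `g (q - 1) g⁻¹`, and every coefficient of `q - 1` has positive
`t`-degree. -/
theorem trivialTo_conj {β : H.root} {n : Fin 2 →₀ ℕ} (hn : n 1 = 1)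
    (g : GL κ (MvPolynomial (Fin 2) ℤ)) :
    TrivialTo 1 (g * Λ.rootElem β (MvPolynomial.monomial n 1) * g⁻¹) := by
  intro l hl
  set q := Λ.rootElem β (MvPolynomial.monomial n (1 : ℤ))
  have e : ((g * q * g⁻¹ : GL κ (MvPolynomial (Fin 2) ℤ)) :
      Matrix κ κ (MvPolynomial (Fin 2) ℤ)) =
      g * ((q : Matrix κ κ (MvPolynomial (Fin 2) ℤ)) - 1) *
        (g⁻¹ : GL κ (MvPolynomial (Fin 2) ℤ)) + 1 := by
    rw [mul_sub, sub_mul, mul_one, Units.mul_inv, Units.val_mul, Units.val_mul, sub_add_cancel]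
  have h0 : ∀ p : Fin 2 →₀ ℕ, p 1 = 0 →
      coeffMat p ((q : Matrix κ κ (MvPolynomial (Fin 2) ℤ)) - 1) = 0 := by
    intro p hp
    rw [map_sub, Λ.coeffMat_rootElem_of_le le_rfl hn 1 (by omega), if_neg, add_zero, sub_self]
    rintro rfl
    omega
  rw [e, map_add, coeffMat_mul, Finset.sum_eq_zero, zero_add]
  intro p hp
  rw [coeffMat_mul, Finset.sum_eq_zero, zero_mul]
  intro r hr
  have h1 : p.1 1 + p.2 1 = l 1 := by
    rw [← Finset.HasAntidiagonal.mem_antidiagonal.1 hp]; rfl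
  have h2 : r.1 1 + r.2 1 = p.1 1 := by
    rw [← Finset.HasAntidiagonal.mem_antidiagonal.1 hr]; rfl
  rw [h0 r.2 (by omega), mul_zero]

theorem exists_trivialTo (hV : Function.Injective (LieModule.toEnd ℂ 𝔤 V)) {α β : H.root}
    (hβ : β ≠ α) (hβ' : β ≠ negRoot α) (S : Subgroup (GL κ (MvPolynomial (Fin 2) ℤ)))
    (hS : ∀ (γ : H.root) (m : Fin 2 →₀ ℕ) (c : ℤ), 1 ≤ m 1 →
      (rootSystem H).root γ = pairWeight α β m → Λ.rootElem γ (MvPolynomial.monomial m c) ∈ S)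
    (g : GL κ (MvPolynomial (Fin 2) ℤ)) (hg : TrivialTo 1 g)
    (hl : Λ.HasGradedLog α β (toComplexPoly g)) (N : ℕ) :
    ∃ p ∈ S, TrivialTo (N + 1) (g * p) ∧ Λ.HasGradedLog α β (toComplexPoly (g * p)) := by
  classical
  induction N with
  | zero => exact ⟨1, one_mem _, by rwa [mul_one], by rwa [mul_one]⟩
  | succ N ih =>
    obtain ⟨p, hp, h1, h2⟩ := ih
    -- The finite set is the union of the supports of the entries, hence contains every monomial
    -- that occurs.
    obtain ⟨q, hq, h3, h4⟩ := Λ.exists_trivialTo_succ hV hβ hβ' S hS (N.succ_pos)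
      (Finset.univ.biUnion fun i => Finset.univ.biUnion fun j =>
        ((g * p : GL κ (MvPolynomial (Fin 2) ℤ)) :
          Matrix κ κ (MvPolynomial (Fin 2) ℤ)) i j |>.support) (g * p) h1 h2 (by
        intro m _ hm
        ext i j
        by_contra h0
        refine hm (Finset.mem_biUnion.2 ⟨i, Finset.mem_univ _, Finset.mem_biUnion.2
          ⟨j, Finset.mem_univ _, MvPolynomial.mem_support_iff.2 h0⟩⟩))
    exact ⟨p * q, mul_mem hp hq, by rwa [← mul_assoc], by rwa [← mul_assoc]⟩

/-- Beyond degree `N` no monomial has a root as its weight, so the next coefficients lie in trivial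
root spaces, degree after degree. -/
theorem trivialTo_eq_one {α β : H.root}
    {N : ℕ} (hN : 1 ≤ N) (hroot : ∀ (γ : H.root) (m : Fin 2 →₀ ℕ),
      (rootSystem H).root γ = pairWeight α β m → m 1 < N)
    (hli : ∀ m, pairWeight α β m = 0 → m = 0)
    {g : GL κ (MvPolynomial (Fin 2) ℤ)} (hg : TrivialTo N g)
    (hl : Λ.HasGradedLog α β (toComplexPoly g)) : g = 1 := by
  have key : ∀ d, TrivialTo (N + d) g := by
    intro d
    induction d with
    | zero => exact hg
    | succ d ih =>
      intro m hm
      rcases Nat.lt_or_ge (m 1) (N + d) with h | h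
      · exact ih m h
      · obtain ⟨x, hx, ex⟩ := Λ.coeffMat_mem_of_trivialTo (by omega) ih hl
          (m := m) (by omega)
        have hm0 : m ≠ 0 := by
          rintro rfl
          rw [Finsupp.zero_apply] at h; omega
        have hx0 : x = 0 := by
          by_contra hx0
          obtain ⟨γ, hγ⟩ := exists_root_of_mem_rootSpace (fun h0 => hm0 (hli m h0)) hx hx0
          have := hroot γ m hγ
          omega
        rw [hx0, map_zero, coeffMat_toComplexPoly] at ex
        rw [coeffMat_one, if_neg hm0]
        apply castMatrix_injective κ
        change (coeffMat m (g : Matrix κ κ (MvPolynomial (Fin 2) ℤ))).map (Int.cast : ℤ → ℂ) = _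
        rw [ex]; ext; simp
  apply Units.ext
  refine matrix_ext_coeffMat fun m => ?_
  exact key (m 1 + 1) m (by omega)

theorem exists_bound_pairWeight {α β : H.root} (hβ : β ≠ α) (hβ' : β ≠ negRoot α) :
    ∃ N, 1 ≤ N ∧ ∀ (γ : H.root) (m : Fin 2 →₀ ℕ),
      (rootSystem H).root γ = pairWeight α β m → m 1 < N := by
  classical
  have h : ∀ γ : H.root, ∃ N, ∀ m : Fin 2 →₀ ℕ,
      (rootSystem H).root γ = pairWeight α β m → m 1 < N := by
    intro γ
    by_cases h : ∃ m, (rootSystem H).root γ = pairWeight α β m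
    · obtain ⟨m, hm⟩ := h
      refine ⟨m 1 + 1, fun n hn => ?_⟩
      rw [pairWeight_injective hβ hβ' (hm.symm.trans hn)]
      omega
    · exact ⟨0, fun m hm => absurd ⟨m, hm⟩ h⟩
  choose N hN using h
  refine ⟨1 + ∑ γ, N γ, by omega, fun γ m hm => ?_⟩
  have := Finset.single_le_sum (f := N) (fun i _ => Nat.zero_le _) (Finset.mem_univ γ)
  have := hN γ m hm
  omega

/-- A form of the Chevalley commutator formula: `x_α(s) x_β(t) x_α(-s)` lies in the group
generated by the `x_{iα + jβ}(c s ^ i t ^ j)` with `1 ≤ j`. -/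
theorem rootElem_conj_mem (hV : Function.Injective (LieModule.toEnd ℂ 𝔤 V)) {α β : H.root}
    (hβ : β ≠ α) (hβ' : β ≠ negRoot α) {F : Type*} [CommRing F] (s t : F)
    (S : Subgroup (GL κ F))
    (hS : ∀ (γ : H.root) (i j : ℕ) (c : ℤ), 1 ≤ j → (rootSystem H).root γ =
      i • (rootSystem H).root α + j • (rootSystem H).root β →
        Λ.rootElem γ (c * s ^ i * t ^ j) ∈ S) :
    Λ.rootElem α s * Λ.rootElem β t * Λ.rootElem α (-s) ∈ S := by
  -- The formula is proved for the variables of `ℤ[s, t]` and specialized by `φ`; the subgroup `S`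
  -- is pulled back along it.
  let φ : MvPolynomial (Fin 2) ℤ →+* F := MvPolynomial.eval₂Hom (Int.castRingHom F) ![s, t]
  have hφ : ∀ (m : Fin 2 →₀ ℕ) (c : ℤ),
      φ (MvPolynomial.monomial m c) = c * s ^ m 0 * t ^ m 1 := by
    intro m c
    simp only [φ, MvPolynomial.coe_eval₂Hom, MvPolynomial.eval₂_monomial]
    rw [Finsupp.prod_fintype _ _ (by simp)]
    simp [Fin.prod_univ_two, mul_assoc]
  let S' := S.comap (Matrix.GeneralLinearGroup.map φ)
  have hS' : ∀ (γ : H.root) (m : Fin 2 →₀ ℕ) (c : ℤ), 1 ≤ m 1 →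
      (rootSystem H).root γ = pairWeight α β m →
        Λ.rootElem γ (MvPolynomial.monomial m c) ∈ S' := by
    intro γ m c hm hγ
    rw [Subgroup.mem_comap, map_rootElem, hφ]
    exact hS γ (m 0) (m 1) c hm hγ
  set m₀ : Fin 2 →₀ ℕ := Finsupp.single 0 1
  set m₁ : Fin 2 →₀ ℕ := Finsupp.single 1 1
  set g := Λ.rootElem α (MvPolynomial.monomial m₀ (1 : ℤ)) *
    Λ.rootElem β (MvPolynomial.monomial m₁ 1) *
    (Λ.rootElem α (MvPolynomial.monomial m₀ (1 : ℤ)))⁻¹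
  have hα : (rootSystem H).root α = pairWeight α β m₀ := by simp [pairWeight, m₀]
  have hβr : (rootSystem H).root β = pairWeight α β m₁ := by simp [pairWeight, m₁]
  have hg : TrivialTo 1 g := Λ.trivialTo_conj (by simp [m₁]) _
  have hl : Λ.HasGradedLog α β (toComplexPoly g) := by
    have h1 : ∀ (γ : H.root) (m : Fin 2 →₀ ℕ) (c : ℤ), (rootSystem H).root γ = pairWeight α β m →
        Λ.HasGradedLog α β (toComplexPoly (Λ.rootElem γ (MvPolynomial.monomial m c))) := by
      intro γ m c h
      have : toComplexPoly (Λ.rootElem γ (MvPolynomial.monomial m c)) =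
          Λ.rootElem γ (MvPolynomial.monomial m (c : ℂ)) := by
        rw [toComplexPoly, map_rootElem, MvPolynomial.map_monomial]; rfl
      rw [this]
      exact Λ.hasGradedLog_rootElem h _
    have e : g = Λ.rootElem α (MvPolynomial.monomial m₀ (1 : ℤ)) *
        Λ.rootElem β (MvPolynomial.monomial m₁ 1) *
        Λ.rootElem α (MvPolynomial.monomial m₀ (-1 : ℤ)) := by
      rw [map_neg, rootElem_neg]
    rw [e, map_mul, map_mul]
    exact HasGradedLog.mul Λ (HasGradedLog.mul Λ (h1 α m₀ 1 hα) (h1 β m₁ 1 hβr)) (h1 α m₀ (-1) hα)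
  obtain ⟨N, hN, hroot⟩ := exists_bound_pairWeight hβ hβ'
  obtain ⟨p, hp, h1, h2⟩ := Λ.exists_trivialTo hV hβ hβ' S' hS' g hg hl (N - 1)
  rw [Nat.sub_add_cancel hN] at h1
  have h3 := Λ.trivialTo_eq_one hN hroot
    (fun m hm => pairWeight_injective hβ hβ' (by rw [hm]; simp [pairWeight])) h1 h2
  have h4 : g ∈ S' := by
    rw [mul_eq_one_iff_eq_inv.1 h3]
    exact inv_mem hp
  rw [Subgroup.mem_comap, map_mul, map_mul, map_inv, map_rootElem, map_rootElem, hφ, hφ,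
    ← rootElem_neg] at h4
  simpa [m₀, m₁] using h4

end AdmissibleLattice

end Finite

end AffineFlag

end

noncomputable section

namespace AffineFlag

/-! ### Positive roots -/

section Finite

variable {𝔤 : Type*} [LieRing 𝔤] [LieAlgebra ℂ 𝔤] [FiniteDimensional ℂ 𝔤] [IsKilling ℂ 𝔤]
variable {H : LieSubalgebra ℂ 𝔤} [H.IsCartanSubalgebra]
variable {b : (rootSystem H).Base}

/-- The monoid generated by the simple roots. -/
abbrev simpleCone (b : (rootSystem H).Base) : AddSubmonoid (Module.Dual ℂ H) :=
  AddSubmonoid.closure ((rootSystem H).root '' (b.support : Set H.root))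

theorem root_mem_simpleCone {i : H.root} (hi : i ∈ b.support) :
    (rootSystem H).root i ∈ simpleCone b :=
  AddSubmonoid.subset_closure ⟨i, hi, rfl⟩

theorem root_ne_zero (α : H.root) : (rootSystem H).root α ≠ 0 := (rootSystem H).ne_zero α

open Classical in
/-- The sum of the positive coroots. -/
def twoRho (b : (rootSystem H).Base) : H :=
  ∑ α : H.root with b.IsPos α, coroot α.1

/-- The reflection `s_i` permutes the positive roots other than `α_i`, so the sum of `α_i` over
their coroots equals its own negative. Only the coroot of `α_i` contributes. -/
theorem root_twoRho {i : H.root} (hi : i ∈ b.support) :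
    (rootSystem H).root i (twoRho b) = 2 := by
  classical
  have hneg : ∀ α : H.root, b.IsPos α → α ≠ negRoot i := by
    rintro α hα rfl
    have h1 := RootPairing.Base.height_reflectionPerm_self b i
    have h2 : 0 < b.height i := RootPairing.Base.isPos_of_mem_support hi
    have h3 : 0 < b.height (negRoot i) := hα
    rw [negRoot_eq_reflectionPerm] at h3
    exact absurd (h1 ▸ h3 : 0 < -b.height i) (by omega)
  have hmaps : ∀ α ∈ ({α : H.root | b.IsPos α} : Finset H.root).erase i,
      reflRoot i α ∈ ({α : H.root | b.IsPos α} : Finset H.root).erase i := by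
    intro α hα
    simp only [Finset.mem_erase, Finset.mem_filter, Finset.mem_univ, true_and] at hα ⊢
    refine ⟨fun h => hneg α hα.2 ?_, RootPairing.Base.IsPos.reflectionPerm hα.2 hi hα.1⟩
    rw [← reflRoot_reflRoot i α, h, reflRoot_self]
  have hsum : ∑ α ∈ ({α : H.root | b.IsPos α} : Finset H.root).erase i,
      (rootSystem H).root i (coroot α.1) = 0 := by
    have h1 : ∑ α ∈ ({α : H.root | b.IsPos α} : Finset H.root).erase i,
        (rootSystem H).root i (coroot α.1) =
        ∑ α ∈ ({α : H.root | b.IsPos α} : Finset H.root).erase i,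
          (rootSystem H).root i (coroot (reflRoot i α).1) :=
      Finset.sum_nbij' (reflRoot i) (reflRoot i) hmaps hmaps
        (fun α _ => reflRoot_reflRoot i α) (fun α _ => reflRoot_reflRoot i α)
        (fun α _ => by rw [reflRoot_reflRoot])
    have h2 : ∀ α : H.root, (rootSystem H).root i (coroot (reflRoot i α).1) =
        -(rootSystem H).root i (coroot α.1) := by
      intro α
      rw [coroot_reflRoot, map_sub, map_smul, root_coroot_eq_pair i i, pair_self, smul_eq_mul]
      push_cast; ring
    rw [Finset.sum_congr rfl fun α _ => h2 α, Finset.sum_neg_distrib] at h1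
    exact self_eq_neg.1 h1
  have hi' : i ∈ ({α : H.root | b.IsPos α} : Finset H.root) := by
    simp [RootPairing.Base.isPos_of_mem_support hi]
  rw [twoRho, map_sum, ← Finset.add_sum_erase _ _ hi', hsum, root_coroot_eq_pair, pair_self]
  norm_num

/-- Evaluation at the sum of the positive coroots is twice the height. -/
theorem exists_nat_of_mem_simpleCone {x : Module.Dual ℂ H} (hx : x ∈ simpleCone b) :
    ∃ n : ℕ, x (twoRho b) = n ∧ (n = 0 → x = 0) := by
  induction hx using AddSubmonoid.closure_induction with
  | mem x hx =>
    obtain ⟨i, hi, rfl⟩ := hx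
    exact ⟨2, by rw [root_twoRho hi]; norm_num, by omega⟩
  | zero => exact ⟨0, by simp, fun _ => rfl⟩
  | add x y _ _ hx hy =>
    obtain ⟨n, hn, h1⟩ := hx
    obtain ⟨m, hm, h2⟩ := hy
    refine ⟨n + m, by rw [LinearMap.add_apply, hn, hm]; push_cast; rfl, fun h => ?_⟩
    rw [h1 (by omega), h2 (by omega), add_zero]

theorem eq_zero_of_mem_simpleCone {x y : Module.Dual ℂ H} (hx : x ∈ simpleCone b)
    (hy : y ∈ simpleCone b) (h : x + y = 0) : x = 0 := by
  obtain ⟨n, hn, h1⟩ := exists_nat_of_mem_simpleCone hx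
  obtain ⟨m, hm, -⟩ := exists_nat_of_mem_simpleCone hy
  apply h1
  have : ((n + m : ℕ) : ℂ) = 0 := by
    rw [Nat.cast_add, ← hn, ← hm, ← LinearMap.add_apply, h, LinearMap.zero_apply]
  have := Nat.cast_eq_zero.1 this
  omega

theorem isPositive_of_mem_support {i : H.root} (hi : i ∈ b.support) : IsPositive b i :=
  root_mem_simpleCone hi

theorem isPositive_or_negRoot (b : (rootSystem H).Base) (α : H.root) :
    IsPositive b α ∨ IsPositive b (negRoot α) := by
  rw [IsPositive, IsPositive, root_negRoot]
  exact b.root_mem_or_neg_mem α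

theorem IsPositive.not_negRoot {α : H.root} (h : IsPositive b α) :
    ¬ IsPositive b (negRoot α) := by
  intro h'
  rw [IsPositive, root_negRoot] at h'
  exact root_ne_zero α (eq_zero_of_mem_simpleCone h h' (add_neg_cancel _))

theorem isPositive_negRoot_iff {α : H.root} : IsPositive b (negRoot α) ↔ ¬ IsPositive b α :=
  ⟨fun h h' => h'.not_negRoot h, fun h => (isPositive_or_negRoot b α).resolve_left h⟩

theorem isPositive_iff_isPos {α : H.root} : IsPositive b α ↔ b.IsPos α := by
  have key : ∀ β : H.root, b.IsPos β → IsPositive b β := fun β hβ =>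
    hβ.induction_on_add (fun i hi => isPositive_of_mem_support hi) fun i j k hk hi hj => by
      rw [IsPositive, hk]
      exact add_mem hi (root_mem_simpleCone hj)
  refine ⟨fun h => ?_, key α⟩
  rcases RootPairing.Base.IsPos.or_neg b α with h1 | h1
  · exact h1
  · refine absurd (key (negRoot α) ?_) h.not_negRoot
    rw [negRoot_eq_reflectionPerm]
    exact h1

theorem IsPositive.reflRoot {α i : H.root} (h : IsPositive b α) (hi : i ∈ b.support)
    (hαi : α ≠ i) : IsPositive b (reflRoot i α) :=
  isPositive_iff_isPos.2 ((isPositive_iff_isPos.1 h).reflectionPerm hi hαi)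

theorem IsPositive.exists_root_twoRho {α : H.root} (h : IsPositive b α) :
    ∃ n : ℕ, 1 ≤ n ∧ (rootSystem H).root α (twoRho b) = n := by
  obtain ⟨n, hn, h0⟩ := exists_nat_of_mem_simpleCone h
  exact ⟨n, Nat.one_le_iff_ne_zero.2 fun h1 => root_ne_zero α (h0 h1), hn⟩

/-! ### The highest root -/

variable {θ : H.root}

/-- Both `x` and `θ - α = -x` lie in the cone, which is pointed. -/
theorem IsHighestRoot.eq_of_sub_mem (hθ : IsHighestRoot b θ) {α : H.root} {x : Module.Dual ℂ H}
    (hx : x ∈ simpleCone b)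
    (h : (rootSystem H).root α = (rootSystem H).root θ + x) : x = 0 := by
  refine eq_zero_of_mem_simpleCone hx (hθ α) ?_
  rw [h]; abel

theorem IsHighestRoot.isPositive (hθ : IsHighestRoot b θ) : IsPositive b θ := by
  by_contra h
  rw [← isPositive_negRoot_iff] at h
  have h1 := hθ (negRoot θ)
  rw [root_negRoot, sub_neg_eq_add] at h1
  refine root_ne_zero θ ?_
  rw [← neg_eq_zero, ← root_negRoot]
  refine eq_zero_of_mem_simpleCone h (y := (rootSystem H).root θ) ?_ ?_
  · have h2 := add_mem h h1
    rwa [root_negRoot, neg_add_cancel_left] at h2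
  · rw [root_negRoot, neg_add_cancel]

/-- If `⟨β, θ^∨⟩ = -(n + 1)`, then `s_θ β = θ + (β + n θ)` would lie above `θ`. -/
theorem IsHighestRoot.pair_nonneg (hθ : IsHighestRoot b θ) {β : H.root} (hβ : IsPositive b β) :
    0 ≤ pair β θ := by
  by_contra h
  obtain ⟨n, hn⟩ : ∃ n : ℕ, pair β θ = -(n + 1 : ℕ) :=
    ⟨(-pair β θ - 1).toNat, by omega⟩
  refine root_ne_zero β (eq_zero_of_mem_simpleCone hβ
    (nsmul_mem hθ.isPositive n) (hθ.eq_of_sub_mem (α := reflRoot θ β)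
      (add_mem hβ (nsmul_mem hθ.isPositive n)) ?_))
  rw [root_reflRoot, hn, neg_smul, natCast_zsmul, succ_nsmul]
  abel

/-- If `⟨β, θ^∨⟩ = n + 2`, comparing `θ` with the root `-s_θ β` puts `β - θ` in the cone, which also
contains `θ - β`. -/
theorem IsHighestRoot.pair_le_one (hθ : IsHighestRoot b θ) {β : H.root} (hβ : β ≠ θ) :
    pair β θ ≤ 1 := by
  by_contra h
  obtain ⟨n, hn⟩ : ∃ n : ℕ, pair β θ = (n + 2 : ℕ) := ⟨(pair β θ - 2).toNat, by omega⟩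
  have h1 := hθ (negRoot (reflRoot θ β))
  rw [root_negRoot, root_reflRoot, hn, natCast_zsmul, sub_neg_eq_add] at h1
  have h2 := add_mem h1 (nsmul_mem hθ.isPositive n)
  refine hβ ((rootSystem H).root.injective (sub_eq_zero.1 ?_))
  refine eq_zero_of_mem_simpleCone ?_ (hθ β) (by abel)
  convert h2 using 1
  rw [add_smul, two_smul]
  abel

/-! ### Affine roots -/

/-- The finite part of the affine simple root of a vertex. -/
def nodeRoot (b : (rootSystem H).Base) (θ : H.root) : Node b → H.root
  | none => negRoot θ
  | some i => i.1

/-- The coefficient of `δ` in the affine simple root of a vertex. -/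
def nodeLevel (b : (rootSystem H).Base) : Node b → ℤ
  | none => 1
  | some _ => 0

/-- The reflection of affine real roots `β + m δ` in the affine simple root of a vertex. -/
def affRefl (b : (rootSystem H).Base) (θ : H.root) (j : Node b) (a : H.root × ℤ) : H.root × ℤ :=
  (reflRoot (nodeRoot b θ j) a.1, a.2 - pair a.1 (nodeRoot b θ j) * nodeLevel b j)

/-- The positive affine real roots. -/
def AffPos (b : (rootSystem H).Base) (a : H.root × ℤ) : Prop :=
  1 ≤ a.2 ∨ (a.2 = 0 ∧ IsPositive b a.1)

/-- The affine simple root of a vertex. -/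
def nodeAff (b : (rootSystem H).Base) (θ : H.root) (j : Node b) : H.root × ℤ :=
  (nodeRoot b θ j, nodeLevel b j)

/-- The negative of an affine real root. -/
def affNeg (a : H.root × ℤ) : H.root × ℤ := (negRoot a.1, -a.2)

theorem affNeg_affNeg (a : H.root × ℤ) : affNeg (affNeg a) = a := by
  simp [affNeg, negRoot_negRoot]

theorem affRefl_affNeg (j : Node b) (a : H.root × ℤ) :
    affRefl b θ j (affNeg a) = affNeg (affRefl b θ j a) := by
  simp only [affRefl, affNeg, reflRoot_negRoot, pair_negRoot_left, Prod.mk.injEq, true_and]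
  ring

theorem affRefl_nodeAff (j : Node b) :
    affRefl b θ j (nodeAff b θ j) = affNeg (nodeAff b θ j) := by
  simp only [affRefl, affNeg, nodeAff, reflRoot_self, pair_self, Prod.mk.injEq, true_and]
  ring

theorem affRefl_affRefl (j : Node b) (a : H.root × ℤ) :
    affRefl b θ j (affRefl b θ j a) = a := by
  refine Prod.ext (reflRoot_reflRoot _ _) ?_
  simp only [affRefl, pair_reflRoot_left]
  ring

theorem affPos_or_affNeg (b : (rootSystem H).Base) (a : H.root × ℤ) :
    AffPos b a ∨ AffPos b (affNeg a) := by
  simp only [AffPos, affNeg]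
  rcases lt_trichotomy a.2 0 with h | h | h
  · right; left; omega
  · rcases isPositive_or_negRoot b a.1 with h1 | h1
    · left; right; exact ⟨h, h1⟩
    · right; right; exact ⟨by omega, h1⟩
  · left; left; omega

theorem AffPos.not_affNeg {a : H.root × ℤ} (h : AffPos b a) : ¬ AffPos b (affNeg a) := by
  simp only [AffPos, affNeg] at h ⊢
  rintro (h' | ⟨h1, h2⟩)
  · rcases h with h | ⟨h, -⟩ <;> omega
  · rcases h with h | ⟨-, h⟩
    · omega
    · exact h.not_negRoot h2

theorem affPos_nodeAff (j : Node b) : AffPos b (nodeAff b θ j) := by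
  cases j with
  | none => exact Or.inl le_rfl
  | some i => exact Or.inr ⟨rfl, isPositive_of_mem_support i.2⟩

/-- For a vertex of the finite diagram this is the corresponding fact on positive roots. For the
vertex `0` the level changes by `⟨β, θ^∨⟩`, which away from `±θ` is `0` or `±1`, never opposite in
sign to `β`. The delicate point is a drop to level `0`: from `β` with pairing `-1` one arrives at `β
+ θ`, positive because `θ` is highest, and from `-θ + 2 δ` at `θ`. -/
theorem AffPos.affRefl (hθ : IsHighestRoot b θ) {j : Node b} {a : H.root × ℤ} (h : AffPos b a)
    (ha : a ≠ nodeAff b θ j) : AffPos b (affRefl b θ j a) := by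
  obtain ⟨β, m⟩ := a
  cases j with
  | some i =>
    simp only [AffPos, AffineFlag.affRefl, nodeRoot, nodeLevel, mul_zero, sub_zero] at h ⊢
    refine h.imp_right fun h => ⟨h.1, h.2.reflRoot i.2 ?_⟩
    rintro rfl
    exact ha (by rw [h.1]; rfl)
  | none =>
    have hr : (rootSystem H).root (reflRoot (negRoot θ) β) =
        (rootSystem H).root β - pair β θ • (rootSystem H).root θ := by
      rw [root_reflRoot, pair_negRoot_right, root_negRoot, neg_smul_neg]
    simp only [AffPos, AffineFlag.affRefl, nodeRoot, nodeLevel, mul_one, pair_negRoot_right,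
      sub_neg_eq_add] at h ⊢
    rw [IsPositive, hr]
    by_cases h1 : β = θ
    · subst h1
      rw [pair_self]
      left
      rcases h with h | h <;> omega
    by_cases h2 : β = negRoot θ
    · subst h2
      have h3 : m ≠ 1 := by rintro rfl; exact ha rfl
      rw [pair_negRoot_left, pair_self, root_negRoot]
      rcases h with h | h
      · by_cases h4 : m = 2
        · right
          refine ⟨by omega, ?_⟩
          have : -(rootSystem H).root θ - (-2 : ℤ) • (rootSystem H).root θ =
              (rootSystem H).root θ := by
            rw [neg_smul, two_smul]; abel
          rw [this]
          exact hθ.isPositive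
        · left; omega
      · exact absurd h.2 hθ.isPositive.not_negRoot
    have h3 := hθ.pair_le_one h1
    have h4 := hθ.pair_le_one (β := negRoot β) (by
      rintro h; exact h2 (by rw [← h, negRoot_negRoot]))
    rw [pair_negRoot_left] at h4
    rcases isPositive_or_negRoot b β with h5 | h5
    · have h6 := hθ.pair_nonneg h5
      by_cases h7 : pair β θ = 0
      · rw [h7, zero_smul, sub_zero, add_zero]
        exact h
      · left
        rcases h with h | h <;> omega
    · have h6 := hθ.pair_nonneg h5
      rw [pair_negRoot_left] at h6
      have hm : 1 ≤ m := h.resolve_right fun h => h.2.not_negRoot h5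
      by_cases h7 : pair β θ = 0
      · rw [h7, zero_smul, sub_zero, add_zero]
        exact h
      · have h8 : pair β θ = -1 := by omega
        rw [h8]
        by_cases h9 : m = 1
        · right
          refine ⟨by omega, ?_⟩
          have := hθ (negRoot β)
          rw [root_negRoot, sub_neg_eq_add] at this
          rwa [neg_smul, one_smul, sub_neg_eq_add, add_comm]
        · left; omega

/-- A nonnegative combination of positive affine roots is positive. -/
theorem AffPos.add {a a' a'' : H.root × ℤ} (h : AffPos b a) (h' : AffPos b a') {i j : ℕ}
    (h1 : (rootSystem H).root a''.1 = i • (rootSystem H).root a.1 + j • (rootSystem H).root a'.1)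
    (h2 : a''.2 = i * a.2 + j * a'.2) : AffPos b a'' := by
  have e1 : 0 ≤ a.2 := by rcases h with h | h <;> omega
  have e2 : 0 ≤ a'.2 := by rcases h' with h' | h' <;> omega
  have e3 : 0 ≤ (i : ℤ) * a.2 := by positivity
  have e4 : 0 ≤ (j : ℤ) * a'.2 := by positivity
  by_cases h3 : a''.2 = 0
  · refine Or.inr ⟨h3, ?_⟩
    rw [IsPositive, h1]
    have e5 : (i : ℤ) * a.2 = 0 := by omega
    have e6 : (j : ℤ) * a'.2 = 0 := by omega
    refine add_mem ?_ ?_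
    · rcases mul_eq_zero.1 e5 with h4 | h4
      · rw [Nat.cast_eq_zero.1 h4, zero_smul]; exact zero_mem _
      · exact nsmul_mem (h.resolve_left (by omega)).2 i
    · rcases mul_eq_zero.1 e6 with h4 | h4
      · rw [Nat.cast_eq_zero.1 h4, zero_smul]; exact zero_mem _
      · exact nsmul_mem (h'.resolve_left (by omega)).2 j
  · left; omega

/-- The least level of a positive affine root with a given finite part. -/
def minLevel (b : (rootSystem H).Base) (β : H.root) : ℤ := open Classical in
  if IsPositive b β then 0 else 1

theorem affPos_iff_minLevel_le {a : H.root × ℤ} : AffPos b a ↔ minLevel b a.1 ≤ a.2 := by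
  unfold AffPos minLevel
  split_ifs with h <;> simp only [h, and_true, and_false, or_false] <;> omega

theorem minLevel_negRoot (β : H.root) : minLevel b (negRoot β) = 1 - minLevel b β := by
  unfold minLevel
  rw [isPositive_negRoot_iff]
  split_ifs <;> simp_all

theorem minLevel_nodeRoot (hθ : IsHighestRoot b θ) (j : Node b) :
    minLevel b (nodeRoot b θ j) = nodeLevel b j := by
  cases j with
  | none => simp [minLevel, nodeRoot, nodeLevel, hθ.isPositive.not_negRoot]
  | some i => simp [minLevel, nodeRoot, nodeLevel, isPositive_of_mem_support i.2]

/-- The action of a word in the simple reflections on affine roots. -/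
def affWord (b : (rootSystem H).Base) (θ : H.root) (u : List (Node b)) (a : H.root × ℤ) :
    H.root × ℤ :=
  u.foldr (affRefl b θ) a

theorem affWord_affNeg (u : List (Node b)) (a : H.root × ℤ) :
    affWord b θ u (affNeg a) = affNeg (affWord b θ u a) := by
  induction u with
  | nil => rfl
  | cons i u ih =>
    change affRefl b θ i (affWord b θ u (affNeg a)) = _
    rw [ih, affRefl_affNeg]; rfl

theorem affWord_append (u v : List (Node b)) (a : H.root × ℤ) :
    affWord b θ (u ++ v) a = affWord b θ u (affWord b θ v a) := by
  simp [affWord, List.foldr_append]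

/-- For a simple Lie algebra, a set of roots which is stable under all reflections and contains
all roots which are not orthogonal to a given root contains all roots. -/
theorem forall_root_of_reflRoot [(rootSystem H).IsIrreducible] (A : Set H.root)
    (hA : ∀ α β : H.root, β ∈ A → reflRoot α β ∈ A) (θ : H.root)
    (hθ : ∀ β, pair β θ ≠ 0 → β ∈ A) (β : H.root) : β ∈ A := by
  by_contra hβ
  -- The span of the roots outside `A` is stable under reflections, so it is everything once it is
  -- nonzero; but the coroot of `θ` vanishes on it and not on `θ`.
  let q : Submodule ℂ (Module.Dual ℂ H) := Submodule.span ℂ ((rootSystem H).root '' Aᶜ)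
  have hq : q = ⊤ := by
    refine RootPairing.IsIrreducible.eq_top_of_invtSubmodule_reflection (P := rootSystem H) q
      (fun α => ?_) ?_
    · rw [Module.End.mem_invtSubmodule, Submodule.span_le]
      rintro _ ⟨γ, hγ, rfl⟩
      refine Submodule.subset_span ⟨reflRoot α γ, fun h => hγ ?_, ?_⟩
      · rw [← reflRoot_reflRoot α γ]; exact hA α _ h
      · exact RootPairing.root_reflectionPerm _ _ _
    · intro h
      have : (rootSystem H).root β ∈ q := Submodule.subset_span ⟨β, hβ, rfl⟩
      rw [h, Submodule.mem_bot] at this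
      exact root_ne_zero β this
  have h1 : (rootSystem H).root θ ∈ q := hq ▸ Submodule.mem_top
  have h2 : q ≤ LinearMap.ker (Module.Dual.eval ℂ H (coroot θ.1)) := by
    rw [Submodule.span_le]
    rintro _ ⟨γ, hγ, rfl⟩
    have : pair γ θ = 0 := by
      by_contra h; exact hγ (hθ γ h)
    change (rootSystem H).root γ (coroot θ.1) = 0
    rw [root_coroot_eq_pair, this, Int.cast_zero]
  have h3 : (rootSystem H).root θ (coroot θ.1) = 0 := h2 h1
  rw [root_coroot_eq_pair, pair_self] at h3
  norm_num at h3

end Finite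

end AffineFlag

end

noncomputable section

namespace AffineFlag

/-! ### Discretely valued loop rings -/

/-- The properties of a loop ring which make it behave like `k((ε))`. -/
structure LoopRing.IsLocal {k : Type u} [Field k] (L : LoopRing k) : Prop where
  incl_injective : Function.Injective L.incl
  exists_const : ∀ c, ∃ a, L.incl a = L.const c ∧ L.evalZero a = c
  exists_eps : ∃ e, L.incl e = L.eps ∧ L.evalZero e = 0
  exists_eq_eps_mul : ∀ a, L.evalZero a = 0 → ∃ a', L.incl a = L.eps * L.incl a'
  isUnit : ∀ a, L.evalZero a ≠ 0 → IsUnit a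
  exists_zpow : ∀ f : L.F, f ≠ 0 →
    ∃ (n : ℤ) (v : L.oˣ), f = ((L.eps ^ n : L.Fˣ) : L.F) * L.incl v

section Filtration

variable {k : Type u} [Field k] (L : LoopRing k)

/-- The `o`-submodule `ε ^ m o`. -/
def LoopRing.fil (m : ℤ) : AddSubgroup L.F where
  carrier := {f | ∃ a, f = ((L.eps ^ m : L.Fˣ) : L.F) * L.incl a}
  zero_mem' := ⟨0, by simp⟩
  add_mem' := by
    rintro _ _ ⟨a, rfl⟩ ⟨b, rfl⟩
    exact ⟨a + b, by rw [map_add, mul_add]⟩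
  neg_mem' := by
    rintro _ ⟨a, rfl⟩
    exact ⟨-a, by rw [map_neg, mul_neg]⟩

variable {L}

theorem LoopRing.eps_zpow_mul_incl_mem (m : ℤ) (a : L.o) :
    ((L.eps ^ m : L.Fˣ) : L.F) * L.incl a ∈ L.fil m := ⟨a, rfl⟩

theorem LoopRing.incl_mem_fil (a : L.o) : L.incl a ∈ L.fil 0 := ⟨a, by simp⟩

theorem LoopRing.mul_mem_fil {m n : ℤ} {f g : L.F} (hf : f ∈ L.fil m) (hg : g ∈ L.fil n) :
    f * g ∈ L.fil (m + n) := by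
  obtain ⟨a, rfl⟩ := hf
  obtain ⟨b, rfl⟩ := hg
  refine ⟨a * b, ?_⟩
  rw [zpow_add, Units.val_mul, map_mul]; ring

theorem LoopRing.incl_mul_mem_fil {m : ℤ} {f : L.F} (a : L.o) (hf : f ∈ L.fil m) :
    L.incl a * f ∈ L.fil m := by
  simpa using LoopRing.mul_mem_fil (LoopRing.incl_mem_fil a) hf

theorem LoopRing.pow_mem_fil {m : ℤ} {f : L.F} (hf : f ∈ L.fil m) (i : ℕ) :
    f ^ i ∈ L.fil (i * m) := by
  induction i with
  | zero => simpa using LoopRing.incl_mem_fil (L := L) 1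
  | succ i ih =>
    have := LoopRing.mul_mem_fil ih hf
    rw [pow_succ]
    convert this using 2
    push_cast; ring

theorem LoopRing.eps_zpow_mem_fil (m : ℤ) : ((L.eps ^ m : L.Fˣ) : L.F) ∈ L.fil m :=
  ⟨1, by simp⟩

theorem LoopRing.IsLocal.fil_anti (hL : L.IsLocal) {m n : ℤ} (h : m ≤ n) : L.fil n ≤ L.fil m := by
  obtain ⟨e, he, -⟩ := hL.exists_eps
  obtain ⟨d, rfl⟩ := Int.le.dest h
  rintro _ ⟨a, rfl⟩
  refine ⟨e ^ d * a, ?_⟩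
  rw [zpow_add, zpow_natCast, Units.val_mul, Units.val_pow_eq_pow_val, map_mul, map_pow, he]
  ring

theorem LoopRing.IsLocal.const_mem_fil (hL : L.IsLocal) (c : k) : L.const c ∈ L.fil 0 := by
  obtain ⟨a, ha, -⟩ := hL.exists_const c
  exact ha ▸ LoopRing.incl_mem_fil a

theorem LoopRing.IsLocal.const_mul_mem_fil (hL : L.IsLocal) {m : ℤ} {f : L.F} (c : k)
    (hf : f ∈ L.fil m) : L.const c * f ∈ L.fil m := by
  simpa using LoopRing.mul_mem_fil (hL.const_mem_fil c) hf

/-- Splits off the leading coefficient; this is what isolates the one-parameter group `x_{α_j}(k)`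
inside an affine root group. -/
theorem LoopRing.IsLocal.exists_sub_mem_fil (hL : L.IsLocal) {m : ℤ} {f : L.F}
    (hf : f ∈ L.fil m) :
    ∃ c, f - L.const c * ((L.eps ^ m : L.Fˣ) : L.F) ∈ L.fil (m + 1) := by
  obtain ⟨a, rfl⟩ := hf
  obtain ⟨a0, h0, h1⟩ := hL.exists_const (L.evalZero a)
  obtain ⟨a', ha'⟩ := hL.exists_eq_eps_mul (a - a0) (by rw [map_sub, h1, sub_self])
  refine ⟨L.evalZero a, a', ?_⟩
  rw [map_sub, h0] at ha'
  rw [zpow_add_one, Units.val_mul, mul_assoc, ← ha']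
  ring

theorem LoopRing.IsLocal.evalZero_eq_zero (hL : L.IsLocal) {a : L.o}
    (ha : L.incl a ∈ L.fil 1) : L.evalZero a = 0 := by
  obtain ⟨a', ha'⟩ := ha
  obtain ⟨e, he, he'⟩ := hL.exists_eps
  rw [zpow_one, ← he, ← map_mul] at ha'
  rw [hL.incl_injective ha', map_mul, he', zero_mul]

theorem LoopRing.IsLocal.exists_unit_add (hL : L.IsLocal) {f : L.F} (hf : f ∈ L.fil 1) :
    ∃ v : L.oˣ, L.incl v = 1 + f := by
  obtain ⟨a, rfl⟩ := hf
  obtain ⟨e, he, he'⟩ := hL.exists_eps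
  obtain ⟨v, hv⟩ := hL.isUnit (1 + e * a) (by rw [map_add, map_mul, he']; simp)
  exact ⟨v, by rw [hv, map_add, map_mul, he, map_one, zpow_one]⟩

/-- The inclusion of the units of `o`. -/
abbrev LoopRing.inclUnit (L : LoopRing k) : L.oˣ →* L.Fˣ := Units.map (L.incl : L.o →* L.F)

/-- The inclusion of the units of `k`. -/
abbrev LoopRing.constUnit (L : LoopRing k) : kˣ →* L.Fˣ := Units.map (L.const : k →* L.F)

theorem LoopRing.IsLocal.exists_inclUnit_eq_constUnit (hL : L.IsLocal) (c : kˣ) :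
    ∃ v, L.inclUnit v = L.constUnit c ∧ L.evalZero v = c := by
  obtain ⟨a, ha, ha'⟩ := hL.exists_const c
  obtain ⟨v, rfl⟩ := hL.isUnit a (by rw [ha']; exact c.ne_zero)
  exact ⟨v, Units.ext ha, ha'⟩

end Filtration

/-! ### Groups attached to concave functions -/

theorem conj_mem_of_mem_closure {G : Type*} [Group G] {s : Set G} {S : Subgroup G} {n : G}
    (h : ∀ y ∈ s, n * y * n⁻¹ ∈ S) {x : G} (hx : x ∈ Subgroup.closure s) : n * x * n⁻¹ ∈ S := by
  induction hx using Subgroup.closure_induction with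
  | mem x hx => exact h x hx
  | one => simp
  | mul x y _ _ hx hy =>
    have := mul_mem hx hy
    rwa [show n * x * n⁻¹ * (n * y * n⁻¹) = n * (x * y) * n⁻¹ by group] at this
  | inv x _ hx =>
    have := inv_mem hx
    rwa [show (n * x * n⁻¹)⁻¹ = n * x⁻¹ * n⁻¹ by group] at this

namespace AdmissibleLattice

variable {𝔤 : Type*} [LieRing 𝔤] [LieAlgebra ℂ 𝔤] [FiniteDimensional ℂ 𝔤] [IsKilling ℂ 𝔤]
variable {H : LieSubalgebra ℂ 𝔤} [H.IsCartanSubalgebra]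
variable {V : Type*} [AddCommGroup V] [Module ℂ V] [LieRingModule 𝔤 V] [LieModule ℂ 𝔤 V]
variable {C : ChevalleyBasis H} {κ : Type*} [Fintype κ] [DecidableEq κ]
variable (Λ : AdmissibleLattice C V κ) {k : Type u} [Field k] (L : LoopRing k)
variable (b : (rootSystem H).Base) (θ : H.root)

/-- The group generated by the integral points of the torus. -/
def torus : Subgroup (GL κ L.F) :=
  Subgroup.closure {g | ∃ (β : H.root) (v : L.oˣ), g = Λ.corootElem β (L.inclUnit v)}

/-- The group generated by the integral points of the torus and by the `x_β(f)` with
`f ∈ ε ^ (m β) o`. -/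
def par (m : H.root → ℤ) : Subgroup (GL κ L.F) :=
  Subgroup.closure ({g | ∃ (β : H.root) (v : L.oˣ), g = Λ.corootElem β (L.inclUnit v)} ∪
    {g | ∃ (β : H.root) (f : L.F), f ∈ L.fil (m β) ∧ g = Λ.rootElem β f})

/-- The Iwahori subgroup given by generators. -/
abbrev iwahoriGen : Subgroup (GL κ L.F) := Λ.par L (minLevel b)

open Classical in
/-- The levels of the positive affine roots without one simple root. -/
def subLevel (j : Node b) (β : H.root) : ℤ :=
  if β = nodeRoot b θ j then nodeLevel b j + 1 else minLevel b β

/-- The group generated by the root groups of positive affine roots without one simple root. -/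
abbrev nodeRadical (j : Node b) : Subgroup (GL κ L.F) := Λ.par L (subLevel b θ j)

/-- The lift of a simple reflection. -/
def nodeWeyl (j : Node b) : GL κ L.F := Λ.weylElem (nodeRoot b θ j) (L.eps ^ nodeLevel b j)

/-- The elements of the root group of a simple affine root. -/
def nodeElem (j : Node b) (c : k) : GL κ L.F :=
  Λ.rootElem (nodeRoot b θ j) (L.const c * ((L.eps ^ nodeLevel b j : L.Fˣ) : L.F))

variable {L b θ}

theorem corootElem_mem_torus (β : H.root) (v : L.oˣ) :
    Λ.corootElem β (L.inclUnit v) ∈ Λ.torus L :=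
  Subgroup.subset_closure ⟨β, v, rfl⟩

theorem corootElem_mem_par (m : H.root → ℤ) (β : H.root) (v : L.oˣ) :
    Λ.corootElem β (L.inclUnit v) ∈ Λ.par L m :=
  Subgroup.subset_closure (Or.inl ⟨β, v, rfl⟩)

theorem rootElem_mem_par {m : H.root → ℤ} {β : H.root} {f : L.F} (hf : f ∈ L.fil (m β)) :
    Λ.rootElem β f ∈ Λ.par L m :=
  Subgroup.subset_closure (Or.inr ⟨β, f, hf, rfl⟩)

theorem torus_le_par (m : H.root → ℤ) : Λ.torus L ≤ Λ.par L m :=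
  Subgroup.closure_mono Set.subset_union_left

theorem par_le {m : H.root → ℤ} {S : Subgroup (GL κ L.F)}
    (h1 : ∀ (β : H.root) (v : L.oˣ), Λ.corootElem β (L.inclUnit v) ∈ S)
    (h2 : ∀ (β : H.root) (f : L.F), f ∈ L.fil (m β) → Λ.rootElem β f ∈ S) : Λ.par L m ≤ S := by
  rw [par, Subgroup.closure_le]
  rintro _ (⟨β, v, rfl⟩ | ⟨β, f, hf, rfl⟩)
  · exact h1 β v
  · exact h2 β f hf

theorem subLevel_of_ne {j : Node b} {β : H.root} (h : β ≠ nodeRoot b θ j) :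
    subLevel b θ j β = minLevel b β := if_neg h

theorem subLevel_nodeRoot (j : Node b) :
    subLevel b θ j (nodeRoot b θ j) = nodeLevel b j + 1 := if_pos rfl

theorem minLevel_le_subLevel (hθ : IsHighestRoot b θ) (j : Node b) (β : H.root) :
    minLevel b β ≤ subLevel b θ j β := by
  by_cases h : β = nodeRoot b θ j
  · rw [h, subLevel_nodeRoot, minLevel_nodeRoot hθ]; omega
  · rw [subLevel_of_ne h]

theorem par_mono (hL : L.IsLocal) {m m' : H.root → ℤ} (h : ∀ β, m' β ≤ m β) :
    Λ.par L m ≤ Λ.par L m' :=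
  Λ.par_le (Λ.corootElem_mem_par m') fun β _ hf => Λ.rootElem_mem_par (hL.fil_anti (h β) hf)

theorem nodeRadical_le (hL : L.IsLocal) (hθ : IsHighestRoot b θ) (j : Node b) :
    Λ.nodeRadical L b θ j ≤ Λ.iwahoriGen L b :=
  Λ.par_mono hL (minLevel_le_subLevel hθ j)

theorem negRoot_ne (α : H.root) : negRoot α ≠ α := by
  intro h
  have h1 := pair_negRoot_left α α
  rw [h, pair_self] at h1
  omega

/-- Commutators with `x_α` therefore never fall into the root group of `α`, the only one whose level
is raised in the radical. -/
theorem ne_of_root_eq {α β γ : H.root} (hβ : β ≠ α) (hβ' : β ≠ negRoot α) {i j : ℕ} (hj : 1 ≤ j)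
    (h : (rootSystem H).root γ = i • (rootSystem H).root α + j • (rootSystem H).root β) :
    γ ≠ α := by
  rintro rfl
  have := (LinearIndependent.pair_iff.1 (linearIndependent_pair_of_ne hβ hβ')
    ((i : ℂ) - 1) j (by
      rw [sub_smul, one_smul, Nat.cast_smul_eq_nsmul, Nat.cast_smul_eq_nsmul, sub_add_eq_add_sub,
        ← h, sub_self])).2
  rw [Nat.cast_eq_zero] at this
  omega

theorem nodeElem_neg (j : Node b) (c : k) :
    Λ.nodeElem L b θ j (-c) = (Λ.nodeElem L b θ j c)⁻¹ := by
  rw [nodeElem, map_neg, neg_mul, rootElem_neg, nodeElem]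

theorem nodeElem_zero (j : Node b) : Λ.nodeElem L b θ j 0 = 1 := by
  rw [nodeElem, map_zero, zero_mul, rootElem_zero]

theorem nodeElem_mem_iwahoriGen (hL : L.IsLocal) (hθ : IsHighestRoot b θ) (j : Node b) (c : k) :
    Λ.nodeElem L b θ j c ∈ Λ.iwahoriGen L b := by
  refine Λ.rootElem_mem_par ?_
  rw [minLevel_nodeRoot hθ]
  exact hL.const_mul_mem_fil c (LoopRing.eps_zpow_mem_fil _)

theorem exists_nodeElem_mul_rootElem (hL : L.IsLocal) (j : Node b) {f : L.F}
    (hf : f ∈ L.fil (nodeLevel b j)) :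
    ∃ c, (Λ.nodeElem L b θ j c)⁻¹ * Λ.rootElem (nodeRoot b θ j) f ∈ Λ.nodeRadical L b θ j := by
  obtain ⟨c, hc⟩ := hL.exists_sub_mem_fil hf
  refine ⟨c, ?_⟩
  rw [nodeElem, ← rootElem_neg, ← rootElem_add, neg_add_eq_sub]
  refine Λ.rootElem_mem_par ?_
  rwa [subLevel_nodeRoot]

/-- One generator at a time is moved past `x_{α_j}(c)`. The torus rescales the parameter,
`x_{α_j}(f)` adds to it, and in both cases only the leading coefficient matters modulo the radical.
The root group of `-α_j` needs the rank one factorization, the remaining ones the commutator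
formula. -/
theorem exists_nodeElem_mul (hV : Function.Injective (LieModule.toEnd ℂ 𝔤 V))
    (hL : L.IsLocal) (hθ : IsHighestRoot b θ) (j : Node b) (c : k) {y : GL κ L.F}
    (hy : (∃ (β : H.root) (v : L.oˣ), y = Λ.corootElem β (L.inclUnit v)) ∨
      ∃ (β : H.root) (f : L.F), f ∈ L.fil (minLevel b β) ∧ y = Λ.rootElem β f) :
    ∃ c', (Λ.nodeElem L b θ j c')⁻¹ * (y * Λ.nodeElem L b θ j c) ∈ Λ.nodeRadical L b θ j := by
  set α := nodeRoot b θ j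
  set l := nodeLevel b j
  set x : L.F := L.const c * ((L.eps ^ l : L.Fˣ) : L.F)
  have hx : x ∈ L.fil l := hL.const_mul_mem_fil c (LoopRing.eps_zpow_mem_fil _)
  have hxe : Λ.nodeElem L b θ j c = Λ.rootElem α x := rfl
  obtain ⟨β, v, rfl⟩ | ⟨β, f, hf, rfl⟩ := hy
  · obtain ⟨c', hc'⟩ := Λ.exists_nodeElem_mul_rootElem (θ := θ) hL j
      (f := ((L.inclUnit v ^ pair α β : L.Fˣ) : L.F) * x) (by
        rw [← map_zpow]
        exact LoopRing.incl_mul_mem_fil _ hx)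
    refine ⟨c', ?_⟩
    have h1 := Λ.corootElem_conj hV β α (L.inclUnit v) x
    rw [mul_inv_eq_iff_eq_mul] at h1
    rw [hxe, h1, ← mul_assoc]
    exact mul_mem hc' (Λ.corootElem_mem_par _ β v)
  · by_cases h1 : β = α
    · subst h1
      rw [minLevel_nodeRoot hθ] at hf
      obtain ⟨c', hc'⟩ := Λ.exists_nodeElem_mul_rootElem (θ := θ) hL j (add_mem hf hx)
      exact ⟨c', by rwa [hxe, ← rootElem_add]⟩
    refine ⟨c, ?_⟩
    rw [hxe, ← rootElem_neg]
    by_cases h2 : β = negRoot α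
    · subst h2
      rw [minLevel_negRoot, minLevel_nodeRoot hθ] at hf
      -- The factorization requires a unit, and every nonzero `f` is one.
      by_cases hf0 : f = 0
      · rw [hf0, rootElem_zero, one_mul, ← rootElem_add, neg_add_cancel, rootElem_zero]
        exact one_mem _
      obtain ⟨n, w, hw⟩ := hL.exists_zpow f hf0
      set fu : L.Fˣ := L.eps ^ n * L.inclUnit w
      have hfu : (fu : L.F) = f := by rw [hw]; rfl
      have hxf : x * f ∈ L.fil 1 := by
        have := LoopRing.mul_mem_fil hx hf
        rwa [add_sub_cancel] at this
      obtain ⟨D, hD⟩ := hL.exists_unit_add (neg_mem hxf)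
      have h3 := Λ.rootElem_mul_rootElem_negRoot hV α (-x) fu (L.inclUnit D) (by
        change L.incl D = _
        rw [hD, hfu]; ring)
      rw [hfu] at h3
      rw [← mul_assoc, h3, mul_assoc, ← rootElem_add]
      have hDinv : L.incl D * L.incl ((D⁻¹ : L.oˣ) : L.o) = 1 := by
        rw [← map_mul, Units.mul_inv, map_one]
      have e1 : (((L.inclUnit D)⁻¹ : L.Fˣ) : L.F) = L.incl ((D⁻¹ : L.oˣ) : L.o) := by
        rw [← map_inv]; rfl
      rw [e1]
      refine mul_mem (mul_mem (Λ.rootElem_mem_par ?_) (Λ.corootElem_mem_par _ _ D))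
        (Λ.rootElem_mem_par ?_)
      · rw [subLevel_of_ne (negRoot_ne α), minLevel_negRoot, minLevel_nodeRoot hθ, mul_comm]
        exact LoopRing.incl_mul_mem_fil _ hf
      · rw [subLevel_nodeRoot]
        -- With `D = 1 - x f` this is `x (D - 1) D⁻¹`, of level one higher than `x` because `x f ∈ ε
        -- o`.
        have e2 : -x * L.incl ((D⁻¹ : L.oˣ) : L.o) + x =
            -(L.incl ((D⁻¹ : L.oˣ) : L.o) * (x * (x * f))) := by
          linear_combination -x * hDinv + x * L.incl ((D⁻¹ : L.oˣ) : L.o) * hD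
        rw [e2]
        exact neg_mem (LoopRing.incl_mul_mem_fil _ (LoopRing.mul_mem_fil hx hxf))
    · have h3 := Λ.rootElem_conj_mem hV h1 h2 (-x) f (Λ.nodeRadical L b θ j) (by
        intro γ i r n hr hγ
        refine Λ.rootElem_mem_par ?_
        rw [subLevel_of_ne (ne_of_root_eq h1 h2 hr hγ)]
        have h4 : AffPos b (γ, i * l + r * minLevel b β) :=
          AffPos.add (a := (α, l)) (a' := (β, minLevel b β)) (affPos_nodeAff j)
            (affPos_iff_minLevel_le.2 le_rfl) hγ rfl
        refine hL.fil_anti (affPos_iff_minLevel_le.1 h4) ?_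
        rw [← map_intCast L.incl, mul_assoc]
        exact LoopRing.incl_mul_mem_fil _ (LoopRing.mul_mem_fil
          (LoopRing.pow_mem_fil (neg_mem hx) i) (LoopRing.pow_mem_fil hf r)))
      rwa [neg_neg, mul_assoc] at h3

/-- The Iwahori subgroup is the product of the root group of a simple affine root and of the
radical. -/
theorem exists_nodeElem_inv_mul_mem (hV : Function.Injective (LieModule.toEnd ℂ 𝔤 V))
    (hL : L.IsLocal) (hθ : IsHighestRoot b θ) (j : Node b) {g : GL κ L.F}
    (hg : g ∈ Λ.iwahoriGen L b) :
    ∃ c, (Λ.nodeElem L b θ j c)⁻¹ * g ∈ Λ.nodeRadical L b θ j := by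
  have step : ∀ y h : GL κ L.F, ((∃ (β : H.root) (v : L.oˣ),
        y = Λ.corootElem β (L.inclUnit v)) ∨
      ∃ (β : H.root) (f : L.F), f ∈ L.fil (minLevel b β) ∧ y = Λ.rootElem β f) →
      (∃ c, (Λ.nodeElem L b θ j c)⁻¹ * h ∈ Λ.nodeRadical L b θ j) →
      ∃ c, (Λ.nodeElem L b θ j c)⁻¹ * (y * h) ∈ Λ.nodeRadical L b θ j := by
    rintro y h hy ⟨c, hc⟩
    obtain ⟨c', hc'⟩ := Λ.exists_nodeElem_mul hV hL hθ j c hy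
    refine ⟨c', ?_⟩
    have := mul_mem hc' hc
    rwa [mul_assoc, mul_assoc, mul_inv_cancel_left] at this
  induction hg using Subgroup.closure_induction_left with
  | one => exact ⟨0, by rw [nodeElem_zero, inv_one, one_mul]; exact one_mem _⟩
  | mul_left y hy g hg ih => exact step y g hy ih
  | inv_mul_cancel y hy g hg ih =>
    refine step y⁻¹ g ?_ ih
    rcases hy with ⟨β, v, rfl⟩ | ⟨β, f, hf, rfl⟩
    · exact Or.inl ⟨β, v⁻¹, by rw [map_inv, corootElem_inv]⟩
    · exact Or.inr ⟨β, -f, neg_mem hf, by rw [rootElem_neg]⟩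

/-! ### Conjugation by lifts of simple reflections -/

theorem inclUnit_intUnit (η : ℤˣ) :
    Units.map (Int.castRingHom L.F : ℤ →* L.F) η =
      L.inclUnit (Units.map (Int.castRingHom L.o : ℤ →* L.o) η) := by
  apply Units.ext
  simp

/-- The sign is a unit of `o`, and the power of `ε` in the coefficient shifts the level exactly as
the affine reflection does. -/
theorem nodeWeyl_conj_rootElem (hV : Function.Injective (LieModule.toEnd ℂ 𝔤 V)) (j : Node b)
    (a : H.root × ℤ) {f : L.F} (hf : f ∈ L.fil a.2) :
    ∃ f' ∈ L.fil (affRefl b θ j a).2, Λ.nodeWeyl L b θ j * Λ.rootElem a.1 f *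
      (Λ.nodeWeyl L b θ j)⁻¹ = Λ.rootElem (affRefl b θ j a).1 f' := by
  refine ⟨_, ?_, Λ.weylElem_conj hV _ _ _ _⟩
  rw [weylCoeff, inclUnit_intUnit, Units.val_mul, mul_assoc, ← zpow_mul]
  refine LoopRing.incl_mul_mem_fil _ ?_
  have := LoopRing.mul_mem_fil (LoopRing.eps_zpow_mem_fil (L := L)
    (nodeLevel b j * -pair a.1 (nodeRoot b θ j))) hf
  convert this using 2
  simp only [affRefl]; ring

theorem nodeWeyl_conj_weylElem (hV : Function.Injective (LieModule.toEnd ℂ 𝔤 V)) (j : Node b)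
    (a : H.root × ℤ) (v : L.oˣ) :
    ∃ v', Λ.nodeWeyl L b θ j * Λ.weylElem a.1 (L.inclUnit v * L.eps ^ a.2) *
      (Λ.nodeWeyl L b θ j)⁻¹ =
        Λ.weylElem (affRefl b θ j a).1 (L.inclUnit v' * L.eps ^ (affRefl b θ j a).2) := by
  refine ⟨Units.map (Int.castRingHom L.o : ℤ →* L.o) (Λ.weylSign (nodeRoot b θ j) a.1) * v, ?_⟩
  rw [nodeWeyl, weylElem_conj_weylElem Λ hV, weylCoeff, inclUnit_intUnit, ← zpow_mul, map_mul]
  congr 1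
  have : (affRefl b θ j a).2 = nodeLevel b j * -pair a.1 (nodeRoot b θ j) + a.2 := by
    simp only [affRefl]; ring
  rw [this, zpow_add]
  exact mul_mul_mul_comm _ _ _ _

theorem nodeWeyl_conj_mem_torus (hV : Function.Injective (LieModule.toEnd ℂ 𝔤 V)) (j : Node b)
    {h : GL κ L.F} (hh : h ∈ Λ.torus L) :
    Λ.nodeWeyl L b θ j * h * (Λ.nodeWeyl L b θ j)⁻¹ ∈ Λ.torus L := by
  refine conj_mem_of_mem_closure ?_ hh
  rintro _ ⟨β, v, rfl⟩
  rw [nodeWeyl, weylElem_conj_corootElem Λ hV]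
  exact Λ.corootElem_mem_torus _ v

theorem weylElem_mem_torus_mul (j : Node b) (v : L.oˣ) :
    ∃ h ∈ Λ.torus L, Λ.weylElem (nodeRoot b θ j) (L.inclUnit v * L.eps ^ nodeLevel b j) =
      h * Λ.nodeWeyl L b θ j :=
  ⟨_, Λ.corootElem_mem_torus (nodeRoot b θ j) v, Λ.weylElem_eq_corootElem_mul _ _ _⟩

/-- The inverse is the Weyl element of parameter `-ε ^ l`, which differs from `n_j` by the torus
element of parameter `-1`. -/
theorem nodeWeyl_inv (j : Node b) : ∃ h ∈ Λ.torus L,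
    (Λ.nodeWeyl L b θ j)⁻¹ = h * Λ.nodeWeyl L b θ j := by
  obtain ⟨h, hh, e⟩ := Λ.weylElem_mem_torus_mul (θ := θ) j (-1 : L.oˣ)
  refine ⟨h, hh, ?_⟩
  rw [← e, nodeWeyl, ← weylElem_neg]
  congr 1
  apply Units.ext
  simp

/-- `s_j` permutes the positive affine roots other than `α_j`. -/
theorem nodeWeyl_conj_mem_nodeRadical (hV : Function.Injective (LieModule.toEnd ℂ 𝔤 V))
    (hL : L.IsLocal) (hθ : IsHighestRoot b θ) (j : Node b) {q : GL κ L.F}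
    (hq : q ∈ Λ.nodeRadical L b θ j) :
    Λ.nodeWeyl L b θ j * q * (Λ.nodeWeyl L b θ j)⁻¹ ∈ Λ.nodeRadical L b θ j := by
  refine conj_mem_of_mem_closure ?_ hq
  rintro _ (⟨β, v, rfl⟩ | ⟨β, f, hf, rfl⟩)
  · exact Λ.torus_le_par (subLevel b θ j)
      (Λ.nodeWeyl_conj_mem_torus hV j (Λ.corootElem_mem_torus β v))
  · obtain ⟨f', hf', e⟩ := Λ.nodeWeyl_conj_rootElem (θ := θ) hV j (β, subLevel b θ j β) hf
    rw [e]
    refine Λ.rootElem_mem_par (hL.fil_anti ?_ hf')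
    have h1 : AffPos b (β, subLevel b θ j β) :=
      affPos_iff_minLevel_le.2 (minLevel_le_subLevel hθ j β)
    have h2 : (β, subLevel b θ j β) ≠ nodeAff b θ j := by
      intro h
      have h3 : β = nodeRoot b θ j := congrArg Prod.fst h
      have h4 : subLevel b θ j β = nodeLevel b j := congrArg Prod.snd h
      rw [h3, subLevel_nodeRoot] at h4
      omega
    have h3 := affPos_iff_minLevel_le.1 (AffPos.affRefl hθ h1 h2)
    -- If the image has the finite part of `α_j`, its level must be strictly larger: otherwise it
    -- would be `α_j` itself, the image of the negative affine root `-α_j`.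
    by_cases h4 : (affRefl b θ j (β, subLevel b θ j β)).1 = nodeRoot b θ j
    · rw [h4, subLevel_nodeRoot]
      rw [h4, minLevel_nodeRoot hθ] at h3
      by_contra h5
      have h6 : affRefl b θ j (β, subLevel b θ j β) = nodeAff b θ j :=
        Prod.ext h4 (by simp only [nodeAff]; omega)
      have h7 := affRefl_affRefl (θ := θ) j (β, subLevel b θ j β)
      rw [h6, affRefl_nodeAff] at h7
      rw [← h7] at h1
      exact (affPos_nodeAff j).not_affNeg h1
    · rwa [subLevel_of_ne h4]

theorem nodeWeyl_inv_conj_mem_nodeRadical (hV : Function.Injective (LieModule.toEnd ℂ 𝔤 V))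
    (hL : L.IsLocal) (hθ : IsHighestRoot b θ) (j : Node b) {q : GL κ L.F}
    (hq : q ∈ Λ.nodeRadical L b θ j) :
    (Λ.nodeWeyl L b θ j)⁻¹ * q * Λ.nodeWeyl L b θ j ∈ Λ.nodeRadical L b θ j := by
  obtain ⟨h, hh, e⟩ := Λ.nodeWeyl_inv (L := L) (θ := θ) j
  have e' : (Λ.nodeWeyl L b θ j)⁻¹ * q * Λ.nodeWeyl L b θ j =
      h * (Λ.nodeWeyl L b θ j * q * (Λ.nodeWeyl L b θ j)⁻¹) * h⁻¹ := by
    calc (Λ.nodeWeyl L b θ j)⁻¹ * q * Λ.nodeWeyl L b θ j =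
        (Λ.nodeWeyl L b θ j)⁻¹ * q * ((Λ.nodeWeyl L b θ j)⁻¹)⁻¹ := by rw [inv_inv]
      _ = (h * Λ.nodeWeyl L b θ j) * q * (h * Λ.nodeWeyl L b θ j)⁻¹ := by rw [e]
      _ = _ := by group
  have hh' := Λ.torus_le_par (subLevel b θ j) hh
  rw [e']
  exact mul_mem (mul_mem hh' (Λ.nodeWeyl_conj_mem_nodeRadical hV hL hθ j hq)) (inv_mem hh')

end AdmissibleLattice

end AffineFlag

end

noncomputable section

namespace AffineFlag

namespace AdmissibleLattice

variable {𝔤 : Type*} [LieRing 𝔤] [LieAlgebra ℂ 𝔤] [FiniteDimensional ℂ 𝔤] [IsKilling ℂ 𝔤]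
variable {H : LieSubalgebra ℂ 𝔤} [H.IsCartanSubalgebra]
variable {V : Type*} [AddCommGroup V] [Module ℂ V] [LieRingModule 𝔤 V] [LieModule ℂ 𝔤 V]
variable {C : ChevalleyBasis H} {κ : Type*} [Fintype κ] [DecidableEq κ]
variable (Λ : AdmissibleLattice C V κ) {k : Type u} [Field k] (L : LoopRing k)
variable (b : (rootSystem H).Base) (θ : H.root)

/-! ### The Bruhat decomposition -/

/-- The lift of a word in the simple reflections. -/
def wordWeyl (u : List (Node b)) : GL κ L.F := (u.map (Λ.nodeWeyl L b θ)).prod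

/-- The union of the double cosets of the lifts of words. -/
def bruhatUnion : Set (GL κ L.F) :=
  {g | ∃ (u : List (Node b)), ∃ x ∈ Λ.iwahoriGen L b, ∃ y ∈ Λ.iwahoriGen L b,
    g = x * Λ.wordWeyl L b θ u * y}

variable {L b θ}

theorem wordWeyl_cons (i : Node b) (u : List (Node b)) :
    Λ.wordWeyl L b θ (i :: u) = Λ.nodeWeyl L b θ i * Λ.wordWeyl L b θ u := by
  simp [wordWeyl]

theorem wordWeyl_concat (u : List (Node b)) (j : Node b) :
    Λ.wordWeyl L b θ (u ++ [j]) = Λ.wordWeyl L b θ u * Λ.nodeWeyl L b θ j := by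
  simp [wordWeyl]

theorem nodeWeyl_inv_conj_rootElem (hV : Function.Injective (LieModule.toEnd ℂ 𝔤 V)) (j : Node b)
    (a : H.root × ℤ) {f : L.F} (hf : f ∈ L.fil a.2) :
    ∃ f' ∈ L.fil (affRefl b θ j a).2, (Λ.nodeWeyl L b θ j)⁻¹ * Λ.rootElem a.1 f *
      Λ.nodeWeyl L b θ j = Λ.rootElem (affRefl b θ j a).1 f' := by
  have h1 := Λ.weylElem_conj hV (nodeRoot b θ j) a.1 (-(L.eps ^ nodeLevel b j)) f
  rw [weylElem_neg, inv_inv] at h1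
  refine ⟨_, ?_, h1⟩
  have h2 : -(L.eps ^ nodeLevel b j) = L.inclUnit (-1) * L.eps ^ nodeLevel b j := by
    apply Units.ext; simp
  rw [weylCoeff, inclUnit_intUnit, h2, mul_zpow, ← map_zpow, ← mul_assoc, ← map_mul,
    Units.val_mul, mul_assoc, ← zpow_mul]
  refine LoopRing.incl_mul_mem_fil _ ?_
  have := LoopRing.mul_mem_fil (LoopRing.eps_zpow_mem_fil (L := L)
    (nodeLevel b j * -pair a.1 (nodeRoot b θ j))) hf
  convert this using 2
  simp only [affRefl]; ring

theorem wordWeyl_conj_rootElem (hV : Function.Injective (LieModule.toEnd ℂ 𝔤 V))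
    (u : List (Node b)) (a : H.root × ℤ) {f : L.F} (hf : f ∈ L.fil a.2) :
    ∃ f' ∈ L.fil (affWord b θ u a).2, Λ.wordWeyl L b θ u * Λ.rootElem a.1 f *
      (Λ.wordWeyl L b θ u)⁻¹ = Λ.rootElem (affWord b θ u a).1 f' := by
  induction u with
  | nil => exact ⟨f, hf, by simp [wordWeyl, affWord]⟩
  | cons i u ih =>
    obtain ⟨f', hf', e⟩ := ih
    obtain ⟨f'', hf'', e'⟩ := Λ.nodeWeyl_conj_rootElem (θ := θ) hV i _ hf'
    refine ⟨f'', hf'', ?_⟩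
    change _ = Λ.rootElem (affRefl b θ i (affWord b θ u a)).1 f''
    rw [← e', ← e, wordWeyl_cons]
    group

theorem wordWeyl_inv_conj_rootElem (hV : Function.Injective (LieModule.toEnd ℂ 𝔤 V))
    (u : List (Node b)) (a : H.root × ℤ) {f : L.F} (hf : f ∈ L.fil (affWord b θ u a).2) :
    ∃ f' ∈ L.fil a.2, (Λ.wordWeyl L b θ u)⁻¹ * Λ.rootElem (affWord b θ u a).1 f *
      Λ.wordWeyl L b θ u = Λ.rootElem a.1 f' := by
  induction u generalizing f with
  | nil => exact ⟨f, hf, by simp [wordWeyl, affWord]⟩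
  | cons i u ih =>
    obtain ⟨f', hf', e'⟩ := Λ.nodeWeyl_inv_conj_rootElem (θ := θ) hV i
      (affRefl b θ i (affWord b θ u a)) hf
    rw [affRefl_affRefl] at hf' e'
    obtain ⟨f'', hf'', e⟩ := ih hf'
    refine ⟨f'', hf'', ?_⟩
    change _ * Λ.rootElem (affRefl b θ i (affWord b θ u a)).1 f * _ = _
    rw [← e, ← e', wordWeyl_cons]
    group

theorem wordWeyl_conj_weylElem (hV : Function.Injective (LieModule.toEnd ℂ 𝔤 V))
    (u : List (Node b)) (a : H.root × ℤ) (v : L.oˣ) :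
    ∃ v', Λ.wordWeyl L b θ u * Λ.weylElem a.1 (L.inclUnit v * L.eps ^ a.2) *
      (Λ.wordWeyl L b θ u)⁻¹ =
        Λ.weylElem (affWord b θ u a).1 (L.inclUnit v' * L.eps ^ (affWord b θ u a).2) := by
  induction u with
  | nil => exact ⟨v, by simp [wordWeyl, affWord]⟩
  | cons i u ih =>
    obtain ⟨v', e⟩ := ih
    obtain ⟨v'', e'⟩ := Λ.nodeWeyl_conj_weylElem (θ := θ) hV i (affWord b θ u a) v'
    refine ⟨v'', ?_⟩
    change _ = Λ.weylElem (affRefl b θ i (affWord b θ u a)).1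
      (L.inclUnit v'' * L.eps ^ (affRefl b θ i (affWord b θ u a)).2)
    rw [← e', ← e, wordWeyl_cons]
    group

theorem wordWeyl_conj_mem_torus (hV : Function.Injective (LieModule.toEnd ℂ 𝔤 V))
    (u : List (Node b)) {h : GL κ L.F} (hh : h ∈ Λ.torus L) :
    Λ.wordWeyl L b θ u * h * (Λ.wordWeyl L b θ u)⁻¹ ∈ Λ.torus L := by
  induction u with
  | nil => simpa [wordWeyl] using hh
  | cons i u ih =>
    have := Λ.nodeWeyl_conj_mem_torus (θ := θ) hV i ih
    rw [wordWeyl_cons]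
    convert this using 1
    group

theorem nodeWeyl_mul_self (j : Node b) :
    Λ.nodeWeyl L b θ j * Λ.nodeWeyl L b θ j ∈ Λ.torus L := by
  obtain ⟨h, hh, e⟩ := Λ.nodeWeyl_inv (L := L) (θ := θ) j
  have : Λ.nodeWeyl L b θ j * Λ.nodeWeyl L b θ j = h⁻¹ :=
    eq_inv_of_mul_eq_one_right (by rw [← mul_assoc, ← e, inv_mul_cancel])
  rw [this]
  exact inv_mem hh

theorem rootElem_mem_iwahoriGen (hL : L.IsLocal) {a : H.root × ℤ} (ha : AffPos b a) {f : L.F}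
    (hf : f ∈ L.fil a.2) : Λ.rootElem a.1 f ∈ Λ.iwahoriGen L b :=
  Λ.rootElem_mem_par (hL.fil_anti (affPos_iff_minLevel_le.1 ha) hf)

theorem torus_le_iwahoriGen : Λ.torus L ≤ Λ.iwahoriGen L b := Λ.torus_le_par _

theorem mul_mem_bruhatUnion {g x : GL κ L.F} (hg : g ∈ Λ.bruhatUnion L b θ)
    (hx : x ∈ Λ.iwahoriGen L b) : g * x ∈ Λ.bruhatUnion L b θ := by
  obtain ⟨u, y, hy, z, hz, rfl⟩ := hg
  exact ⟨u, y, hy, z * x, mul_mem hz hx, by group⟩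

theorem mem_bruhatUnion_mul {g x : GL κ L.F} (hg : g ∈ Λ.bruhatUnion L b θ)
    (hx : x ∈ Λ.iwahoriGen L b) : x * g ∈ Λ.bruhatUnion L b θ := by
  obtain ⟨u, y, hy, z, hz, rfl⟩ := hg
  exact ⟨u, x * y, mul_mem hx hy, z, hz, by group⟩

theorem wordWeyl_mem_bruhatUnion (u : List (Node b)) :
    Λ.wordWeyl L b θ u ∈ Λ.bruhatUnion L b θ :=
  ⟨u, 1, one_mem _, 1, one_mem _, by group⟩

/-- A decomposition in the group of rank one. -/
theorem rootElem_eq_mul_weylElem (hV : Function.Injective (LieModule.toEnd ℂ 𝔤 V))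
    {F : Type*} [CommRing F] (α : H.root) (w : Fˣ) :
    Λ.rootElem α (w : F) = Λ.rootElem (negRoot α) ((w⁻¹ : Fˣ) : F) * Λ.weylElem α w *
      Λ.rootElem (negRoot α) ((w⁻¹ : Fˣ) : F) := by
  have h := Λ.weylElem_negRoot hV α (-w⁻¹)
  have e1 : -(-w⁻¹)⁻¹ = w := by
    apply Units.ext; simp
  rw [e1] at h
  rw [← h, weylElem, negRoot_negRoot]
  have e2 : -(((-w⁻¹ : Fˣ)⁻¹ : Fˣ) : F) = w := by rw [← Units.val_neg, e1]
  rw [e2, Units.val_neg, rootElem_neg]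
  group

/-- If `u α_j` is positive, `x_{α_j}(c)` moves to the left through `n_u` into the Iwahori subgroup.
If it is negative and `c ≠ 0`, `x_{α_j}(c)` is written as `x_{-α_j} w x_{-α_j}`: the left factor
moves through `n_u` to a positive root group, the right one becomes an element of `x_{α_j}` after
passing `n_j`, and `w n_j` lies in the torus. -/
theorem wordWeyl_mul_nodeElem_mul_mem (hV : Function.Injective (LieModule.toEnd ℂ 𝔤 V))
    (hL : L.IsLocal) (u : List (Node b)) (j : Node b) (c : k) :
    Λ.wordWeyl L b θ u * Λ.nodeElem L b θ j c * Λ.nodeWeyl L b θ j ∈ Λ.bruhatUnion L b θ := by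
  have hx : L.const c * ((L.eps ^ nodeLevel b j : L.Fˣ) : L.F) ∈ L.fil (nodeAff b θ j).2 :=
    hL.const_mul_mem_fil c (LoopRing.eps_zpow_mem_fil _)
  rcases affPos_or_affNeg b (affWord b θ u (nodeAff b θ j)) with ha | ha
  · obtain ⟨f', hf', e⟩ := Λ.wordWeyl_conj_rootElem hV u (nodeAff b θ j) hx
    rw [mul_inv_eq_iff_eq_mul] at e
    have e' : Λ.wordWeyl L b θ u * Λ.nodeElem L b θ j c * Λ.nodeWeyl L b θ j =
        Λ.rootElem (affWord b θ u (nodeAff b θ j)).1 f' * Λ.wordWeyl L b θ (u ++ [j]) := by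
      rw [wordWeyl_concat, ← mul_assoc, ← e]; rfl
    rw [e']
    exact Λ.mem_bruhatUnion_mul (Λ.wordWeyl_mem_bruhatUnion _) (Λ.rootElem_mem_iwahoriGen hL ha hf')
  by_cases hc : c = 0
  · rw [hc, nodeElem_zero, mul_one, ← wordWeyl_concat]
    exact Λ.wordWeyl_mem_bruhatUnion _
  obtain ⟨v, hv, -⟩ := hL.exists_inclUnit_eq_constUnit (Units.mk0 c hc)
  set w : L.Fˣ := L.inclUnit v * L.eps ^ nodeLevel b j
  have hw : (w : L.F) = L.const c * ((L.eps ^ nodeLevel b j : L.Fˣ) : L.F) := by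
    simp only [w, hv]; rfl
  have hw' : ((w⁻¹ : L.Fˣ) : L.F) ∈ L.fil (affNeg (nodeAff b θ j)).2 := by
    simp only [w, mul_inv, Units.val_mul, ← map_inv, ← zpow_neg]
    exact LoopRing.incl_mul_mem_fil _ (LoopRing.eps_zpow_mem_fil _)
  obtain ⟨h, hh, eh⟩ := Λ.weylElem_mem_torus_mul (θ := θ) j v
  obtain ⟨f₁, hf₁, e₁⟩ := Λ.wordWeyl_conj_rootElem hV u (affNeg (nodeAff b θ j)) hw'
  obtain ⟨f₂, hf₂, e₂⟩ := Λ.nodeWeyl_inv_conj_rootElem (θ := θ) hV j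
    (affNeg (nodeAff b θ j)) hw'
  rw [affRefl_affNeg, affRefl_nodeAff, affNeg_affNeg] at hf₂ e₂
  rw [affWord_affNeg] at e₁ hf₁
  have e₃ := Λ.rootElem_eq_mul_weylElem hV (nodeRoot b θ j) w
  have ht := Λ.wordWeyl_conj_mem_torus (θ := θ) hV u
    (mul_mem hh (Λ.nodeWeyl_mul_self (L := L) (θ := θ) j))
  have key : Λ.wordWeyl L b θ u * Λ.nodeElem L b θ j c * Λ.nodeWeyl L b θ j =
      (Λ.wordWeyl L b θ u * Λ.rootElem (affNeg (nodeAff b θ j)).1 ((w⁻¹ : L.Fˣ) : L.F) *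
        (Λ.wordWeyl L b θ u)⁻¹) *
      ((Λ.wordWeyl L b θ u * (h * (Λ.nodeWeyl L b θ j * Λ.nodeWeyl L b θ j)) *
        (Λ.wordWeyl L b θ u)⁻¹) * (Λ.wordWeyl L b θ u *
      ((Λ.nodeWeyl L b θ j)⁻¹ * Λ.rootElem (affNeg (nodeAff b θ j)).1 ((w⁻¹ : L.Fˣ) : L.F) *
        Λ.nodeWeyl L b θ j))) := by
    rw [nodeElem, ← hw, e₃, eh]
    simp only [affNeg, nodeAff]
    group
  rw [key, e₁, e₂]
  exact Λ.mem_bruhatUnion_mul (Λ.mem_bruhatUnion_mul (Λ.mul_mem_bruhatUnion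
    (Λ.wordWeyl_mem_bruhatUnion u) (Λ.rootElem_mem_iwahoriGen hL (affPos_nodeAff j) hf₂))
    (Λ.torus_le_iwahoriGen ht)) (Λ.rootElem_mem_iwahoriGen hL ha hf₁)

/-- The right-hand Iwahori factor is `x_{α_j}(c)` times an element of the radical, and the radical
is normalized by `n_j`. -/
theorem mul_nodeWeyl_mem_bruhatUnion (hV : Function.Injective (LieModule.toEnd ℂ 𝔤 V))
    (hL : L.IsLocal) (hθ : IsHighestRoot b θ) {g : GL κ L.F} (hg : g ∈ Λ.bruhatUnion L b θ)
    (j : Node b) : g * Λ.nodeWeyl L b θ j ∈ Λ.bruhatUnion L b θ := by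
  obtain ⟨u, x, hx, y, hy, rfl⟩ := hg
  obtain ⟨c, hc⟩ := Λ.exists_nodeElem_inv_mul_mem hV hL hθ j hy
  have h1 := Λ.nodeRadical_le hL hθ j (Λ.nodeWeyl_inv_conj_mem_nodeRadical hV hL hθ j hc)
  have h2 := Λ.mem_bruhatUnion_mul (Λ.mul_mem_bruhatUnion
    (Λ.wordWeyl_mul_nodeElem_mul_mem (θ := θ) hV hL u j c) h1) hx
  convert h2 using 1
  group

/-- The group generated by the Iwahori subgroup and the lifts of simple reflections. -/
def titsGroup (L : LoopRing k) (b : (rootSystem H).Base) (θ : H.root) : Subgroup (GL κ L.F) :=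
  Subgroup.closure ((Λ.iwahoriGen L b : Set (GL κ L.F)) ∪ Set.range (Λ.nodeWeyl L b θ))

theorem titsGroup_subset (hV : Function.Injective (LieModule.toEnd ℂ 𝔤 V))
    (hL : L.IsLocal) (hθ : IsHighestRoot b θ) {g : GL κ L.F} (hg : g ∈ Λ.titsGroup L b θ) :
    g ∈ Λ.bruhatUnion L b θ := by
  induction hg using Subgroup.closure_induction_right with
  | one => exact Λ.wordWeyl_mem_bruhatUnion []
  | mul_right x _ y hy hx =>
    rcases hy with hy | ⟨j, rfl⟩
    · exact Λ.mul_mem_bruhatUnion hx hy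
    · exact Λ.mul_nodeWeyl_mem_bruhatUnion hV hL hθ hx j
  | mul_inv_cancel x _ y hy hx =>
    rcases hy with hy | ⟨j, rfl⟩
    · exact Λ.mul_mem_bruhatUnion hx (inv_mem hy)
    · obtain ⟨h, hh, e⟩ := Λ.nodeWeyl_inv (L := L) (θ := θ) j
      rw [e, ← mul_assoc]
      exact Λ.mul_nodeWeyl_mem_bruhatUnion hV hL hθ
        (Λ.mul_mem_bruhatUnion hx (Λ.torus_le_iwahoriGen hh)) j

theorem nodeWeyl_mem_titsGroup (j : Node b) : Λ.nodeWeyl L b θ j ∈ Λ.titsGroup L b θ :=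
  Subgroup.subset_closure (Or.inr ⟨j, rfl⟩)

theorem iwahoriGen_le_titsGroup : Λ.iwahoriGen L b ≤ Λ.titsGroup L b θ :=
  fun _ hx => Subgroup.subset_closure (Or.inl hx)

/-- Every root arises from simple roots by simple reflections and negation; conjugation by a lift
changes `w_β(1)` into `w_{s_i β}(±1)`. -/
theorem weylElem_one_mem_titsGroup (hV : Function.Injective (LieModule.toEnd ℂ 𝔤 V))
    (α : H.root) : Λ.weylElem α 1 ∈ Λ.titsGroup L b θ := by
  refine RootPairing.Base.induction_reflect (b := b) α
    (p := fun α => Λ.weylElem α 1 ∈ Λ.titsGroup L b θ) ?_ ?_ ?_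
  · intro α hα
    rw [← negRoot_eq_reflectionPerm, weylElem_negRoot Λ hV, inv_one, weylElem_neg]
    exact inv_mem hα
  · intro i hi
    have := Λ.nodeWeyl_mem_titsGroup (L := L) (θ := θ) (some ⟨i, hi⟩ : Node b)
    rwa [nodeWeyl, nodeLevel, zpow_zero] at this
  · intro β i hβ hi
    have h0 := Λ.nodeWeyl_mem_titsGroup (L := L) (θ := θ) (some ⟨i, hi⟩ : Node b)
    rw [nodeWeyl, nodeLevel, zpow_zero] at h0
    have hi' : Λ.weylElem i 1 ∈ Λ.titsGroup L b θ := h0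
    have h1 := mul_mem (mul_mem hi' hβ) (inv_mem hi')
    rw [weylElem_conj_weylElem Λ hV, weylCoeff, one_zpow, mul_one, mul_one] at h1
    rcases Int.units_eq_one_or (Λ.weylSign i β) with h2 | h2
    · rwa [h2, map_one] at h1
    · rw [h2] at h1
      have h3 : Units.map (Int.castRingHom L.F : ℤ →* L.F) (-1) = -1 := Units.ext (by simp)
      rw [h3, weylElem_neg] at h1
      exact inv_mem_iff.1 h1

/-- The root groups of affine roots. -/
def HasRootGroup (S : Subgroup (GL κ L.F)) (a : H.root × ℤ) : Prop :=
  ∀ f ∈ L.fil a.2, Λ.rootElem a.1 f ∈ S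

theorem HasRootGroup.affRefl (hV : Function.Injective (LieModule.toEnd ℂ 𝔤 V)) {j : Node b}
    {a : H.root × ℤ} (h : Λ.HasRootGroup (Λ.titsGroup L b θ) a) :
    Λ.HasRootGroup (Λ.titsGroup L b θ) (affRefl b θ j a) := by
  intro f hf
  obtain ⟨f', hf', e⟩ := Λ.nodeWeyl_conj_rootElem (θ := θ) hV j _ hf
  rw [affRefl_affRefl] at hf' e
  have h1 := h f' hf'
  rw [← e] at h1
  have hj := Λ.nodeWeyl_mem_titsGroup (L := L) (θ := θ) j
  rwa [Subgroup.mul_mem_cancel_right _ (inv_mem hj), Subgroup.mul_mem_cancel_left _ hj] at h1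

theorem HasRootGroup.reflRoot (hV : Function.Injective (LieModule.toEnd ℂ 𝔤 V)) (α : H.root)
    {a : H.root × ℤ} (h : Λ.HasRootGroup (Λ.titsGroup L b θ) a) :
    Λ.HasRootGroup (Λ.titsGroup L b θ) (reflRoot α a.1, a.2) := by
  intro f hf
  have e := Λ.weylElem_conj hV α (AffineFlag.reflRoot α a.1) 1 f
  rw [reflRoot_reflRoot, weylCoeff, one_zpow, mul_one, inclUnit_intUnit] at e
  have h1 := h _ (LoopRing.incl_mul_mem_fil
    ((Units.map (Int.castRingHom L.o : ℤ →* L.o)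
      (Λ.weylSign α (AffineFlag.reflRoot α a.1)) : L.oˣ) : L.o) hf)
  have h2 : Λ.weylElem α 1 * Λ.rootElem (AffineFlag.reflRoot α a.1) f * (Λ.weylElem α 1)⁻¹ ∈
      Λ.titsGroup L b θ := by rw [e]; exact h1
  have hj := Λ.weylElem_one_mem_titsGroup (L := L) (b := b) (θ := θ) hV α
  rwa [Subgroup.mul_mem_cancel_right _ (inv_mem hj), Subgroup.mul_mem_cancel_left _ hj] at h2

/-- Composing `s_0` with `s_θ`, in either order, keeps the finite part `β` and shifts the level by
`±⟨β, θ^∨⟩`. -/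
theorem hasRootGroup_of_pair_ne_zero (hV : Function.Injective (LieModule.toEnd ℂ 𝔤 V))
    (hL : L.IsLocal) {β : H.root} (hβ : pair β θ ≠ 0) (m : ℤ) :
    Λ.HasRootGroup (Λ.titsGroup L b θ) (β, m) := by
  have h1 : ∀ m, Λ.HasRootGroup (Λ.titsGroup L b θ) (β, m) →
      Λ.HasRootGroup (Λ.titsGroup L b θ) (β, m + pair β θ) := by
    intro m h
    have := HasRootGroup.reflRoot Λ hV (negRoot θ) (HasRootGroup.affRefl Λ hV (j := none) h)
    simpa [affRefl, nodeRoot, nodeLevel] using this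
  have h2 : ∀ m, Λ.HasRootGroup (Λ.titsGroup L b θ) (β, m) →
      Λ.HasRootGroup (Λ.titsGroup L b θ) (β, m - pair β θ) := by
    intro m h
    have := HasRootGroup.affRefl Λ hV (j := none) (HasRootGroup.reflRoot Λ hV (negRoot θ) h)
    have e := pair_reflRoot_left (negRoot θ) β
    rw [pair_negRoot_right, pair_negRoot_right, neg_neg] at e
    rw [neg_eq_iff_eq_neg] at e
    simpa [affRefl, nodeRoot, nodeLevel, e, ← sub_eq_add_neg] using this
  -- Level `1` is positive for every finite part; from there the translation reaches arbitrarily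
  -- negative levels, and larger levels are contained in smaller ones.
  have h3 : ∀ n : ℕ, Λ.HasRootGroup (Λ.titsGroup L b θ) (β, 1 - n * |pair β θ|) := by
    intro n
    induction n with
    | zero =>
      intro f hf
      exact Λ.iwahoriGen_le_titsGroup (Λ.rootElem_mem_iwahoriGen hL (a := (β, 1)) (Or.inl le_rfl)
        (by simpa using hf))
    | succ n ih =>
      rcases abs_choice (pair β θ) with h | h <;> rw [h] at ih ⊢
      · convert h2 _ ih using 2
        push_cast; ring
      · convert h1 _ ih using 2
        push_cast; ring
  intro f hf
  refine h3 (1 - m).toNat f (hL.fil_anti ?_ hf)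
  have h4 : 1 ≤ |pair β θ| := Int.one_le_abs hβ
  have h5 : (1 - m) ≤ ((1 - m).toNat : ℤ) := Int.self_le_toNat _
  have h6 : ((1 - m).toNat : ℤ) * 1 ≤ (1 - m).toNat * |pair β θ| := by gcongr
  change 1 - _ ≤ m
  linarith

theorem chevalleyGroup_le {F : Type*} [CommRing F] {S : Subgroup (GL κ F)}
    (h : ∀ (α : H.root) (f : F), Λ.rootElem α f ∈ S) : Λ.chevalleyGroup F ≤ S := by
  rw [chevalleyGroup, Subgroup.closure_le]
  rintro _ ⟨α, f, rfl⟩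
  exact h α f

/-- The roots not orthogonal to `θ` have all their affine root groups in the group, and
irreducibility propagates this to all roots by reflections. -/
theorem chevalleyGroup_le_titsGroup [(rootSystem H).IsIrreducible]
    (hV : Function.Injective (LieModule.toEnd ℂ 𝔤 V)) (hL : L.IsLocal) :
    Λ.chevalleyGroup L.F ≤ Λ.titsGroup L b θ := by
  refine Λ.chevalleyGroup_le fun β f => ?_
  let A : Set H.root := {β | ∀ m, Λ.HasRootGroup (Λ.titsGroup L b θ) (β, m)}
  have hA : ∀ α β : H.root, β ∈ A → reflRoot α β ∈ A :=
    fun α β h m => HasRootGroup.reflRoot Λ hV α (a := (β, m)) (h m)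
  have hA' : ∀ β, pair β θ ≠ 0 → β ∈ A := fun β h m => Λ.hasRootGroup_of_pair_ne_zero hV hL h m
  have h1 : ∀ m, Λ.HasRootGroup (Λ.titsGroup L b θ) (β, m) :=
    forall_root_of_reflRoot A hA θ hA' β
  by_cases hf : f = 0
  · rw [hf, rootElem_zero]; exact one_mem _
  · obtain ⟨n, v, hv⟩ := hL.exists_zpow f hf
    refine h1 n f ?_
    rw [hv]
    exact LoopRing.eps_zpow_mul_incl_mem n v.1

/-! ### The exchange condition -/

/-- The exchange condition, up to the torus: the letter of `v` at which `α_j` turns negative can be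
deleted together with `j`. -/
theorem exists_shorter_word (hV : Function.Injective (LieModule.toEnd ℂ 𝔤 V))
    (hθ : IsHighestRoot b θ) (v : List (Node b)) (j : Node b)
    (h : ¬ AffPos b (affWord b θ v (nodeAff b θ j))) :
    ∃ v' : List (Node b), v'.length ≤ v.length ∧ ∃ t ∈ Λ.torus L,
      Λ.wordWeyl L b θ v * Λ.nodeWeyl L b θ j = t * Λ.wordWeyl L b θ v' := by
  induction v with
  | nil => exact absurd (affPos_nodeAff j) h
  | cons i v ih =>
    by_cases ha : AffPos b (affWord b θ v (nodeAff b θ j))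
    · have h1 : affWord b θ v (nodeAff b θ j) = nodeAff b θ i := by
        by_contra h1
        exact h (AffPos.affRefl hθ ha h1)
      obtain ⟨w, e⟩ := Λ.wordWeyl_conj_weylElem (θ := θ) hV v (nodeAff b θ j) (1 : L.oˣ)
      obtain ⟨t, ht, e'⟩ := Λ.weylElem_mem_torus_mul (θ := θ) i w
      have e2 : Λ.wordWeyl L b θ v * Λ.nodeWeyl L b θ j * (Λ.wordWeyl L b θ v)⁻¹ =
          t * Λ.nodeWeyl L b θ i := by
        rw [map_one, one_mul, h1] at e
        exact e.trans e'
      rw [mul_inv_eq_iff_eq_mul] at e2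
      refine ⟨v, by simp, Λ.nodeWeyl L b θ i * t * (Λ.nodeWeyl L b θ i)⁻¹ *
        (Λ.nodeWeyl L b θ i * Λ.nodeWeyl L b θ i),
        mul_mem (Λ.nodeWeyl_conj_mem_torus hV i ht) (Λ.nodeWeyl_mul_self i), ?_⟩
      rw [wordWeyl_cons, mul_assoc, e2]
      group
    · obtain ⟨v', hv', t, ht, e⟩ := ih ha
      refine ⟨i :: v', by simpa using hv', _, Λ.nodeWeyl_conj_mem_torus (θ := θ) hV i ht, ?_⟩
      rw [wordWeyl_cons, wordWeyl_cons, mul_assoc, e]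
      group

/-- Write `u = v j`. Conjugating the root group of `α_j` by `n_u ∈ J` puts that of `u α_j` in `J`,
so `u α_j` is positive and `v α_j` negative, and the exchange condition applies. It yields a word
which need not be a prefix, hence the induction over a bound `n` on the length. -/
theorem wordWeyl_mem_iwahoriGen (hV : Function.Injective (LieModule.toEnd ℂ 𝔤 V))
    (hL : L.IsLocal) (hθ : IsHighestRoot b θ) {J : Subgroup (GL κ L.F)}
    (hJ : Λ.iwahoriGen L b ≤ J) (hJ' : ∀ a, Λ.HasRootGroup J a → AffPos b a) (n : ℕ) :
    ∀ u : List (Node b), u.length ≤ n → Λ.wordWeyl L b θ u ∈ J →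
      Λ.wordWeyl L b θ u ∈ Λ.iwahoriGen L b := by
  induction n with
  | zero =>
    intro u hu _
    rw [List.length_eq_zero_iff.1 (Nat.le_zero.1 hu)]
    exact one_mem _
  | succ n ih =>
    intro u hu huJ
    rcases List.eq_nil_or_concat u with rfl | ⟨v, j, rfl⟩
    · exact one_mem _
    rw [List.concat_eq_append] at hu huJ ⊢
    have h1 : AffPos b (affWord b θ (v ++ [j]) (nodeAff b θ j)) := by
      apply hJ'
      intro f hf
      obtain ⟨f', hf', e⟩ := Λ.wordWeyl_inv_conj_rootElem (θ := θ) hV _ _ hf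
      have h2 : Λ.rootElem (nodeAff b θ j).1 f' ∈ J :=
        hJ (Λ.rootElem_mem_iwahoriGen hL (affPos_nodeAff j) hf')
      rw [← e] at h2
      rwa [Subgroup.mul_mem_cancel_right _ huJ, Subgroup.mul_mem_cancel_left _ (inv_mem huJ)] at h2
    have h2 : ¬ AffPos b (affWord b θ v (nodeAff b θ j)) := by
      have e : affWord b θ (v ++ [j]) (nodeAff b θ j) =
          affNeg (affWord b θ v (nodeAff b θ j)) := by
        rw [affWord_append, ← affWord_affNeg, ← affRefl_nodeAff]; rfl
      rw [e] at h1
      intro h3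
      exact h3.not_affNeg h1
    obtain ⟨v', hv', t, ht, e⟩ := Λ.exists_shorter_word (L := L) hV hθ v j h2
    rw [wordWeyl_concat, e] at huJ ⊢
    have ht' := Λ.torus_le_iwahoriGen (b := b) ht
    refine mul_mem ht' (ih v' ?_ ?_)
    · simp at hu; omega
    · exact (Subgroup.mul_mem_cancel_left _ (hJ ht')).1 huJ

theorem mem_iwahoriGen_of_mem [(rootSystem H).IsIrreducible]
    (hV : Function.Injective (LieModule.toEnd ℂ 𝔤 V))
    (hL : L.IsLocal) (hθ : IsHighestRoot b θ) {J : Subgroup (GL κ L.F)}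
    (hJ : Λ.iwahoriGen L b ≤ J) (hJ' : ∀ a, Λ.HasRootGroup J a → AffPos b a) {g : GL κ L.F}
    (hg : g ∈ Λ.chevalleyGroup L.F) (hgJ : g ∈ J) : g ∈ Λ.iwahoriGen L b := by
  obtain ⟨u, x, hx, y, hy, rfl⟩ := Λ.titsGroup_subset hV hL hθ
    (Λ.chevalleyGroup_le_titsGroup hV hL hg)
  rw [Subgroup.mul_mem_cancel_right _ (hJ hy), Subgroup.mul_mem_cancel_left _ (hJ hx)] at hgJ
  exact mul_mem (mul_mem hx (Λ.wordWeyl_mem_iwahoriGen hV hL hθ hJ hJ' _ u le_rfl hgJ)) hy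

end AdmissibleLattice

end AffineFlag

end

noncomputable section

namespace AffineFlag

namespace AdmissibleLattice

variable {𝔤 : Type*} [LieRing 𝔤] [LieAlgebra ℂ 𝔤] [FiniteDimensional ℂ 𝔤] [IsKilling ℂ 𝔤]
variable {H : LieSubalgebra ℂ 𝔤} [H.IsCartanSubalgebra]
variable {V : Type*} [AddCommGroup V] [Module ℂ V] [LieRingModule 𝔤 V] [LieModule ℂ 𝔤 V]
variable {C : ChevalleyBasis H} {κ : Type*} [Fintype κ] [DecidableEq κ]
variable (Λ : AdmissibleLattice C V κ) {k : Type u} [Field k] {L : LoopRing k}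
variable {b : (rootSystem H).Base} {θ : H.root}

/-! ### The Iwahori subgroup -/

theorem corootElem_negRoot (hV : Function.Injective (LieModule.toEnd ℂ 𝔤 V))
    {F : Type*} [CommRing F] (α : H.root) (d : Fˣ) :
    Λ.corootElem (negRoot α) d = Λ.corootElem α d⁻¹ := by
  have : -d⁻¹ = d⁻¹ * -1 := by rw [mul_neg, mul_one]
  rw [corootElem_eq, weylElem_negRoot Λ hV, weylElem_negRoot Λ hV, inv_one, this,
    weylElem_eq_corootElem_mul, mul_inv_cancel_right]

/-- Compare two ways of conjugating: `h_β(d)` by `w_α(1)`, and `w_α(1)` by `h_β(d)`. -/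
theorem corootElem_reflRoot (hV : Function.Injective (LieModule.toEnd ℂ 𝔤 V))
    {F : Type*} [CommRing F] (α β : H.root) (d : Fˣ) :
    Λ.corootElem (reflRoot α β) d = (Λ.corootElem α (d ^ pair α β))⁻¹ * Λ.corootElem β d := by
  have h1 := Λ.weylElem_conj_corootElem hV α β 1 d
  have h2 := Λ.corootElem_conj_weylElem hV β α d 1
  rw [mul_one, mul_inv_eq_iff_eq_mul] at h2
  rw [← h1, corootElem_eq Λ α, mul_inv_rev, inv_inv, mul_assoc, mul_assoc]
  congr 1
  rw [eq_inv_mul_iff_mul_eq, ← mul_assoc, ← h2, mul_inv_cancel_right]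

/-- `borel` is defined with simple coroots only; the other coroots are reached by reflections and
negation. -/
theorem corootElem_mem_borel (hV : Function.Injective (LieModule.toEnd ℂ 𝔤 V)) (β : H.root) :
    ∀ d : kˣ, Λ.corootElem β d ∈ Λ.borel b k := by
  refine RootPairing.Base.induction_reflect (b := b) β
    (p := fun β => ∀ d : kˣ, Λ.corootElem β d ∈ Λ.borel b k) ?_ ?_ ?_
  · intro α hα d
    rw [← negRoot_eq_reflectionPerm, corootElem_negRoot Λ hV]
    exact hα _
  · intro i hi d
    exact Subgroup.mem_sup_right (Subgroup.subset_closure ⟨i, hi, d, rfl⟩)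
  · intro β i hβ hi d
    change Λ.corootElem (reflRoot i β) d ∈ _
    rw [corootElem_reflRoot Λ hV]
    exact mul_mem (inv_mem (Subgroup.mem_sup_right (Subgroup.subset_closure ⟨i, hi, _, rfl⟩)))
      (hβ d)

theorem rootElem_mem_borel {β : H.root} (hβ : IsPositive b β) (c : k) :
    Λ.rootElem β c ∈ Λ.borel b k :=
  Subgroup.mem_sup_left (Subgroup.subset_closure ⟨β, c, hβ, rfl⟩)

theorem borel_le {S : Subgroup (GL κ k)}
    (h1 : ∀ (β : H.root) (c : k), IsPositive b β → Λ.rootElem β c ∈ S)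
    (h2 : ∀ (β : H.root) (d : kˣ), Λ.corootElem β d ∈ S) : Λ.borel b k ≤ S := by
  rw [borel, sup_le_iff, Subgroup.closure_le, Subgroup.closure_le]
  constructor
  · rintro _ ⟨β, c, hβ, rfl⟩
    exact h1 β c hβ
  · rintro _ ⟨i, -, d, rfl⟩
    exact h2 i d

/-- The invertible matrices over `o` whose value at `ε = 0` lies in the Borel subgroup. -/
def bigIwahori (L : LoopRing k) (b : (rootSystem H).Base) : Subgroup (GL κ L.F) :=
  ((Λ.borel b k).comap (Matrix.GeneralLinearGroup.map L.evalZero)).map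
    (Matrix.GeneralLinearGroup.map L.incl)

theorem map_mem_bigIwahori {g : GL κ L.o}
    (h : Matrix.GeneralLinearGroup.map L.evalZero g ∈ Λ.borel b k) :
    Matrix.GeneralLinearGroup.map L.incl g ∈ Λ.bigIwahori L b :=
  ⟨g, h, rfl⟩

/-- On generators: for a negative root the parameter lies in `ε o`, so `x_β(f)` becomes trivial at
`ε = 0`. -/
theorem iwahoriGen_le_bigIwahori (hV : Function.Injective (LieModule.toEnd ℂ 𝔤 V))
    (hL : L.IsLocal) : Λ.iwahoriGen L b ≤ Λ.bigIwahori L b := by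
  refine Λ.par_le (fun β v => ?_) fun β f hf => ?_
  · rw [← map_corootElem]
    refine Λ.map_mem_bigIwahori ?_
    rw [map_corootElem]
    exact Λ.corootElem_mem_borel hV β _
  · obtain ⟨a, ha⟩ : ∃ a, f = L.incl a := by
      have h0 : f ∈ L.fil 0 := hL.fil_anti (by unfold minLevel; split_ifs <;> omega) hf
      obtain ⟨a, ha⟩ := h0
      exact ⟨a, by rw [ha, zpow_zero, Units.val_one, one_mul]⟩
    subst ha
    rw [← map_rootElem]
    refine Λ.map_mem_bigIwahori ?_
    rw [map_rootElem]
    by_cases hβ : IsPositive b β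
    · exact Λ.rootElem_mem_borel hβ _
    · rw [minLevel, if_neg hβ] at hf
      rw [hL.evalZero_eq_zero hf, rootElem_zero]
      exact one_mem _

/-- A root element with a pole is not integral. -/
theorem nonneg_of_rootElem_mem_range (hV : Function.Injective (LieModule.toEnd ℂ 𝔤 V))
    (hL : L.IsLocal) {β : H.root} {m : ℤ}
    (h : Λ.rootElem β ((L.eps ^ m : L.Fˣ) : L.F) ∈
      (Matrix.GeneralLinearGroup.map L.incl : GL κ L.o →* GL κ L.F).range) : 0 ≤ m := by
  classical
  obtain ⟨g, hg⟩ := h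
  by_contra hm
  have hm' : m < 0 := not_le.1 hm
  set N := Fintype.card κ
  let T : Finset ℕ := (Finset.range N).filter fun r => Λ.divPowIn k β r ≠ 0
  have h1T : 1 ∈ T := by
    refine Finset.mem_filter.2 ⟨?_, Λ.divPowIn_one_ne_zero hV β k⟩
    rw [Finset.mem_range]
    by_contra h1
    apply Λ.divPowIn_one_ne_zero hV β k
    ext i j
    simp [divPowIn, Λ.divPow_eq_zero β (not_lt.1 h1)]
  -- `r` is the last divided power which is nonzero over `k`, and `r ≥ 1` by primitivity. If `m <
  -- 0`, the term of index `r` dominates, and multiplying an entry by `ε ^ (-m r)` isolates a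
  -- nonzero constant which would have to vanish at `ε = 0`.
  set r := T.max' ⟨1, h1T⟩
  have hr1 : 1 ≤ r := T.le_max' 1 h1T
  have hrT : r ∈ T := T.max'_mem _
  obtain ⟨hrN, hr0⟩ := Finset.mem_filter.1 hrT
  obtain ⟨i, j, hij⟩ : ∃ i j, Λ.divPowIn k β r i j ≠ 0 := by
    by_contra! h0
    exact hr0 (by ext i j; exact h0 i j)
  have hconst : ∀ s, Λ.divPowIn L.F β s i j = L.const (Λ.divPowIn k β s i j) := by
    intro s; simp [divPowIn]
  have hentry : L.incl ((g : Matrix κ κ L.o) i j) = ∑ s ∈ Finset.range N,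
      ((L.eps ^ (m * s) : L.Fˣ) : L.F) * L.const (Λ.divPowIn k β s i j) := by
    have h1 := congrArg (fun x : GL κ L.F => (x : Matrix κ κ L.F) i j) hg
    change L.incl ((g : Matrix κ κ L.o) i j) = Λ.rootMatrix β _ i j at h1
    rw [h1, rootMatrix, Matrix.sum_apply]
    refine Finset.sum_congr rfl fun s _ => ?_
    rw [Matrix.smul_apply, smul_eq_mul, hconst, zpow_mul, zpow_natCast, Units.val_pow_eq_pow_val]
  have h2 : ((L.eps ^ (-(m * r)) : L.Fˣ) : L.F) * L.incl ((g : Matrix κ κ L.o) i j) ∈ L.fil 1 := by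
    refine hL.fil_anti ?_ (LoopRing.eps_zpow_mul_incl_mem _ _)
    have : m * r ≤ -1 * 1 := by nlinarith
    omega
  rw [hentry, Finset.mul_sum, ← Finset.add_sum_erase _ _ hrN] at h2
  have h3 : ∑ s ∈ (Finset.range N).erase r, ((L.eps ^ (-(m * r)) : L.Fˣ) : L.F) *
      (((L.eps ^ (m * s) : L.Fˣ) : L.F) * L.const (Λ.divPowIn k β s i j)) ∈ L.fil 1 := by
    refine sum_mem fun s hs => ?_
    obtain ⟨hsr, hsN⟩ := Finset.mem_erase.1 hs
    rw [← mul_assoc, ← Units.val_mul, ← zpow_add, mul_comm]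
    by_cases hs0 : Λ.divPowIn k β s i j = 0
    · rw [hs0, map_zero, zero_mul]; exact zero_mem _
    · have hsT : s ∈ T := Finset.mem_filter.2 ⟨hsN, fun h => hs0 (by rw [h]; rfl)⟩
      have hlt : s < r := lt_of_le_of_ne (T.le_max' s hsT) hsr
      refine hL.const_mul_mem_fil _ (hL.fil_anti ?_ (LoopRing.eps_zpow_mem_fil _))
      have : (s : ℤ) + 1 ≤ r := by exact_mod_cast hlt
      nlinarith
  have h4 := (AddSubgroup.add_mem_cancel_right _ h3).1 h2
  rw [← mul_assoc, ← Units.val_mul, ← zpow_add, neg_add_cancel, zpow_zero, Units.val_one,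
    one_mul] at h4
  obtain ⟨a, ha, ha'⟩ := hL.exists_const (Λ.divPowIn k β r i j)
  rw [← ha] at h4
  exact hij (by rw [← ha', hL.evalZero_eq_zero h4])

/-- `z` is the product of the `h_α(e)` for `α ∈ s`. -/
theorem exists_cocharacter (hV : Function.Injective (LieModule.toEnd ℂ 𝔤 V))
    {F : Type*} [CommRing F] (e : Fˣ) (s : Finset H.root) :
    ∃ z : GL κ F, (∀ γ f, z * Λ.rootElem γ f * z⁻¹ =
      Λ.rootElem γ (((e ^ ∑ α ∈ s, pair γ α : Fˣ) : F) * f)) ∧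
      ∀ γ d, z * Λ.corootElem γ d * z⁻¹ = Λ.corootElem γ d := by
  classical
  induction s using Finset.induction_on with
  | empty => exact ⟨1, by simp, by simp⟩
  | insert α s hα ih =>
    obtain ⟨z, h1, h2⟩ := ih
    refine ⟨Λ.corootElem α e * z, fun γ f => ?_, fun γ d => ?_⟩
    · rw [Finset.sum_insert hα, zpow_add, Units.val_mul, mul_assoc ((e ^ pair γ α : Fˣ) : F),
        ← Λ.corootElem_conj hV, ← h1]
      group
    · rw [show Λ.corootElem α e * z * Λ.corootElem γ d * (Λ.corootElem α e * z)⁻¹ =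
        Λ.corootElem α e * (z * Λ.corootElem γ d * z⁻¹) * (Λ.corootElem α e)⁻¹ by group, h2,
        corootElem_conj_corootElem Λ hV]

/-- Conjugation by the sum of the positive coroots, evaluated at `ε`, multiplies the parameter of
`x_γ` by a power of `ε` with positive exponent exactly when `γ` is positive. The Borel subgroup is
thus carried to integral matrices, while a negative root would produce a pole. -/
theorem IsPositive.of_rootElem_mem_borel (hV : Function.Injective (LieModule.toEnd ℂ 𝔤 V))
    (hL : L.IsLocal) {β : H.root} (hβ : Λ.rootElem β (1 : k) ∈ Λ.borel b k) : IsPositive b β := by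
  classical
  by_contra hneg
  rw [← isPositive_negRoot_iff] at hneg
  obtain ⟨z, hz1, hz2⟩ := Λ.exists_cocharacter hV L.eps ({α : H.root | b.IsPos α} : Finset H.root)
  have hpair : ∀ γ : H.root, (rootSystem H).root γ (twoRho b) =
      ((∑ α : H.root with b.IsPos α, pair γ α : ℤ) : ℂ) := by
    intro γ
    rw [twoRho, map_sum, Int.cast_sum]
    refine Finset.sum_congr (by congr) fun α _ => root_coroot_eq_pair γ α
  have hpos : ∀ γ : H.root, IsPositive b γ →
      1 ≤ ∑ α : H.root with b.IsPos α, pair γ α := by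
    intro γ hγ
    obtain ⟨n, hn, e⟩ := hγ.exists_root_twoRho
    rw [hpair] at e
    have : (∑ α : H.root with b.IsPos α, pair γ α) = n := by exact_mod_cast e
    omega
  let S : Subgroup (GL κ k) :=
    (((Matrix.GeneralLinearGroup.map L.incl : GL κ L.o →* GL κ L.F).range).comap
      (MulAut.conj z).toMonoidHom).comap (Matrix.GeneralLinearGroup.map L.const)
  have hS : ∀ g : GL κ k, g ∈ S ↔ z * Matrix.GeneralLinearGroup.map L.const g * z⁻¹ ∈
      (Matrix.GeneralLinearGroup.map L.incl : GL κ L.o →* GL κ L.F).range := fun g => Iff.rfl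
  have hle : Λ.borel b k ≤ S := by
    refine Λ.borel_le (fun γ c hγ => ?_) fun γ d => ?_
    · rw [hS, map_rootElem, hz1]
      have : ((L.eps ^ ∑ α : H.root with b.IsPos α, pair γ α : L.Fˣ) : L.F) * L.const c ∈
          L.fil 0 := by
        rw [mul_comm]
        refine hL.const_mul_mem_fil c (hL.fil_anti ?_ (LoopRing.eps_zpow_mem_fil _))
        have := hpos γ hγ
        omega
      obtain ⟨a, ha⟩ := this
      rw [ha, zpow_zero, Units.val_one, one_mul, ← map_rootElem]
      exact ⟨_, rfl⟩
    · rw [hS, map_corootElem, hz2]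
      obtain ⟨v, hv, -⟩ := hL.exists_inclUnit_eq_constUnit d
      refine ⟨Λ.corootElem γ v, ?_⟩
      rw [map_corootElem]
      congr 1
  have h1 := (hS _).1 (hle hβ)
  rw [map_rootElem, hz1, map_one, mul_one] at h1
  have h2 := Λ.nonneg_of_rootElem_mem_range hV hL h1
  have h3 := hpos _ hneg
  simp only [pair_negRoot_left, Finset.sum_neg_distrib] at h3
  omega

/-- It suffices to look at `x_β(ε ^ m)`: a pole is impossible, and for `m = 0` its value at `ε = 0`
is `x_β(1)`. -/
theorem affPos_of_hasRootGroup (hV : Function.Injective (LieModule.toEnd ℂ 𝔤 V))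
    (hL : L.IsLocal) (a : H.root × ℤ) (h : Λ.HasRootGroup (Λ.bigIwahori L b) a) :
    AffPos b a := by
  have h1 := h _ (LoopRing.eps_zpow_mem_fil a.2)
  obtain ⟨g, hg, e⟩ := h1
  have h2 := Λ.nonneg_of_rootElem_mem_range hV hL ⟨g, e⟩
  rcases h2.lt_or_eq with h3 | h3
  · exact Or.inl (by omega)
  · refine Or.inr ⟨h3.symm, IsPositive.of_rootElem_mem_borel Λ hV hL ?_⟩
    rw [← h3, zpow_zero, Units.val_one, ← map_one L.incl, ← map_rootElem] at e
    rw [GL_map_injective hL.incl_injective e] at hg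
    have hg' : Matrix.GeneralLinearGroup.map L.evalZero (Λ.rootElem a.1 1) ∈ Λ.borel b k := hg
    rwa [map_rootElem, map_one] at hg'

/-- The Iwahori subgroup of a loop group over a discretely valued field is generated by the
integral points of the torus and the root groups of positive affine roots. -/
theorem mem_iwahoriGen_of_mem_bigIwahori [(rootSystem H).IsIrreducible]
    (hV : Function.Injective (LieModule.toEnd ℂ 𝔤 V))
    (hL : L.IsLocal) (hθ : IsHighestRoot b θ) {g : GL κ L.F}
    (hg : g ∈ Λ.chevalleyGroup L.F) (hg' : g ∈ Λ.bigIwahori L b) : g ∈ Λ.iwahoriGen L b :=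
  Λ.mem_iwahoriGen_of_mem hV hL hθ (Λ.iwahoriGen_le_bigIwahori hV hL)
    (Λ.affPos_of_hasRootGroup hV hL) hg hg'

end AdmissibleLattice

end AffineFlag

end

noncomputable section

namespace AffineFlag

/-! ### Laurent series and Laurent polynomials -/

section Rings

variable (k : Type u) [Field k]

/-- The variable of the ring of Laurent series. -/
def laurentEps : (LaurentSeries k)ˣ := Units.mk0 (HahnSeries.single 1 1) (by simp)

theorem laurentEps_val : ((laurentEps k : (LaurentSeries k)ˣ) : LaurentSeries k) =
    HahnSeries.ofPowerSeries ℤ k PowerSeries.X := HahnSeries.ofPowerSeries_X.symm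

theorem exists_laurentEps_zpow (f : LaurentSeries k) (hf : f ≠ 0) :
    ∃ (n : ℤ) (v : (PowerSeries k)ˣ),
      f = ((laurentEps k ^ n : (LaurentSeries k)ˣ) : LaurentSeries k) *
        HahnSeries.ofPowerSeries ℤ k v := by
  have h1 : IsUnit f.powerSeriesPart := by
    refine PowerSeries.isUnit_iff_constantCoeff.2 (isUnit_iff_ne_zero.2 ?_)
    rw [← PowerSeries.coeff_zero_eq_constantCoeff_apply, LaurentSeries.powerSeriesPart_coeff,
      Nat.cast_zero, add_zero]
    exact HahnSeries.coeff_order_eq_zero.not.2 hf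
  obtain ⟨v, hv⟩ := h1
  refine ⟨f.order, v, ?_⟩
  rw [hv, Units.val_zpow_eq_zpow_val]
  have h2 := f.single_order_mul_powerSeriesPart
  rw [RatFunc.single_zpow] at h2
  exact h2.symm

theorem LoopRing.series_isLocal : (LoopRing.series k).IsLocal where
  incl_injective := HahnSeries.ofPowerSeries_injective
  exists_const c := ⟨PowerSeries.C c, HahnSeries.ofPowerSeries_C c,
    PowerSeries.constantCoeff_C c⟩
  exists_eps := ⟨(PowerSeries.X : PowerSeries k), HahnSeries.ofPowerSeries_X,
    PowerSeries.constantCoeff_X⟩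
  exists_eq_eps_mul a ha := by
    obtain ⟨a', rfl⟩ := PowerSeries.X_dvd_iff.2 (show PowerSeries.constantCoeff a = 0 from ha)
    refine ⟨a', (map_mul (HahnSeries.ofPowerSeries ℤ k) _ _).trans ?_⟩
    rw [HahnSeries.ofPowerSeries_X]
    rfl
  isUnit a ha := PowerSeries.isUnit_iff_constantCoeff.2 (isUnit_iff_ne_zero.2 ha)
  exists_zpow := exists_laurentEps_zpow k

/-- The embeddings of loop rings which detect integrality. -/
structure LoopRing.Embedding {k : Type u} [Field k] (L L' : LoopRing k) where
  onF : L.F →+* L'.F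
  onO : L.o →+* L'.o
  incl_onO : ∀ a, L'.incl (onO a) = onF (L.incl a)
  evalZero_onO : ∀ a, L'.evalZero (onO a) = L.evalZero a
  onF_const : ∀ c, onF (L.const c) = L'.const c
  onF_eps : onF L.eps = L'.eps
  exists_incl : ∀ f a, onF f = L'.incl a → ∃ a', f = L.incl a'
  incl_injective : Function.Injective L.incl

/-- The identity of the ring of Laurent series. -/
def LoopRing.seriesEmbedding : (LoopRing.series k).Embedding (LoopRing.series k) where
  onF := RingHom.id _
  onO := RingHom.id _
  incl_onO _ := rfl
  evalZero_onO _ := rfl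
  onF_const _ := rfl
  onF_eps := rfl
  exists_incl _ a h := ⟨a, h⟩
  incl_injective := HahnSeries.ofPowerSeries_injective

/-- Laurent polynomials are Laurent series. -/
def laurentPolynomialToSeries : LaurentPolynomial k →+* LaurentSeries k :=
  LaurentPolynomial.eval₂ HahnSeries.C (laurentEps k)

theorem laurentPolynomialToSeries_toLaurent (p : Polynomial k) :
    laurentPolynomialToSeries k (Polynomial.toLaurent p) =
      HahnSeries.ofPowerSeries ℤ k (p : PowerSeries k) := by
  have : (laurentPolynomialToSeries k).comp
      (Polynomial.toLaurent : Polynomial k →+* LaurentPolynomial k) =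
      (HahnSeries.ofPowerSeries ℤ k).comp Polynomial.coeToPowerSeries.ringHom := by
    refine Polynomial.ringHom_ext (fun c => ?_) ?_
    · rw [RingHom.comp_apply, laurentPolynomialToSeries, LaurentPolynomial.eval₂_toLaurent,
        Polynomial.eval₂_C, RingHom.comp_apply, Polynomial.coeToPowerSeries.ringHom_apply,
        Polynomial.coe_C, HahnSeries.ofPowerSeries_C]
    · rw [RingHom.comp_apply, laurentPolynomialToSeries, LaurentPolynomial.eval₂_toLaurent,
        Polynomial.eval₂_X, RingHom.comp_apply, Polynomial.coeToPowerSeries.ringHom_apply,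
        Polynomial.coe_X, laurentEps_val]
  exact RingHom.congr_fun this p

/-- A power `ε ^ n` clears the denominator of `f`. The resulting polynomial is divisible by `ε ^ n`
as a power series, hence as a polynomial. -/
theorem exists_toLaurent_eq (f : LaurentPolynomial k) (s : PowerSeries k)
    (h : laurentPolynomialToSeries k f = HahnSeries.ofPowerSeries ℤ k s) :
    ∃ p : Polynomial k, f = Polynomial.toLaurent p := by
  obtain ⟨n, p, hp⟩ := LaurentPolynomial.exists_T_pow f
  have h1 : (p : PowerSeries k) = PowerSeries.X ^ n * s := by
    apply HahnSeries.ofPowerSeries_injective (Γ := ℤ)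
    rw [← laurentPolynomialToSeries_toLaurent, hp, map_mul, h, map_mul, mul_comm]
    congr 1
    rw [laurentPolynomialToSeries, LaurentPolynomial.eval₂_T_n, map_pow,
      laurentEps_val]
  have h2 : Polynomial.X ^ n ∣ p := by
    rw [Polynomial.X_pow_dvd_iff]
    intro d hd
    rw [← Polynomial.coeff_coe, h1, PowerSeries.coeff_X_pow_mul', if_neg (by omega)]
  obtain ⟨q, rfl⟩ := h2
  refine ⟨q, ?_⟩
  rw [map_mul, Polynomial.toLaurent_X_pow, mul_comm] at hp
  have h3 := congrArg (· * LaurentPolynomial.T (-(n : ℤ))) hp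
  simp only [mul_assoc, ← LaurentPolynomial.T_add, add_neg_cancel, LaurentPolynomial.T_zero,
    mul_one] at h3
  exact h3.symm

theorem constantCoeff_coe (p : Polynomial k) :
    PowerSeries.constantCoeff (p : PowerSeries k) = Polynomial.constantCoeff p := by
  rw [← PowerSeries.coeff_zero_eq_constantCoeff_apply, Polynomial.coeff_coe,
    Polynomial.constantCoeff_apply]

theorem laurentPolynomialToSeries_T : laurentPolynomialToSeries k (LaurentPolynomial.T 1) =
    ((laurentEps k : (LaurentSeries k)ˣ) : LaurentSeries k) := by
  rw [laurentPolynomialToSeries, LaurentPolynomial.eval₂_T, zpow_one]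

/-- The inclusion of the ring of Laurent polynomials in the ring of Laurent series. -/
def LoopRing.polynomialEmbedding :
    (LoopRing.polynomial k).Embedding (LoopRing.series k) where
  onF := laurentPolynomialToSeries k
  onO := Polynomial.coeToPowerSeries.ringHom
  incl_onO p := (laurentPolynomialToSeries_toLaurent k p).symm
  evalZero_onO p := constantCoeff_coe k p
  onF_const c := LaurentPolynomial.eval₂_C _ _ c
  onF_eps := laurentPolynomialToSeries_T k
  exists_incl f a h := exists_toLaurent_eq k f a h
  incl_injective := Polynomial.toLaurent_injective

end Rings

/-! ### Cosets and Hecke operators -/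

section Hecke

variable {G : Type*} [Group G] {I : Subgroup G}

theorem relPosition_mk (g h : G) :
    relPosition I (g : G ⧸ I) (h : G ⧸ I) = DoubleCoset.mk I I (g⁻¹ * h) := rfl

theorem heckeAct_cosetBasis (g n h : G) [Decidable (∃ x ∈ I, ∃ y ∈ I, g⁻¹ * h = x * n * y)] :
    heckeAct I (cosetBasis I g) (doubleCosetSum I n) (h : G ⧸ I) =
      if ∃ x ∈ I, ∃ y ∈ I, g⁻¹ * h = x * n * y then 1 else 0 := by
  rw [heckeAct, cosetBasis, Finsupp.sum_single_index (by simp), one_mul, relPosition_mk,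
    doubleCosetSum]
  split_ifs with hx
  · rw [Set.indicator_of_mem, Pi.one_apply]
    exact ((DoubleCoset.eq I I _ _).2 hx).symm
  · rw [Set.indicator_of_notMem]
    intro h1
    exact hx ((DoubleCoset.eq I I _ _).1 (Eq.symm h1))

/-- The Hecke operator of a double coset `I n I` which is the disjoint union of the cosets
`y c I`. -/
theorem hasSum_heckeAct {k : Type*} {y : k → G} {n : G}
    (h1 : ∀ g ∈ I, ∃ c, (y c)⁻¹ * (g * n) ∈ I) (h2 : ∀ c, y c * n⁻¹ ∈ I)
    (h3 : ∀ c c', (y c)⁻¹ * y c' ∈ I → c = c') (g : G) :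
    HasSum (fun c : k => (⇑(cosetBasis I (g * y c)) : G ⧸ I → ℂ))
      (heckeAct I (cosetBasis I g) (doubleCosetSum I n)) := by
  classical
  -- The sum is taken coefficientwise: a coset inside the translated double coset receives the
  -- coefficient `1` from exactly one index, any other coset from none.
  rw [Pi.hasSum]
  intro x
  obtain ⟨h, rfl⟩ := QuotientGroup.mk_surjective x
  rw [heckeAct_cosetBasis]
  have key : ∀ c, cosetBasis I (g * y c) (h : G ⧸ I) = if (y c)⁻¹ * (g⁻¹ * h) ∈ I then 1 else 0 := by
    intro c
    rw [cosetBasis, Finsupp.single_apply]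
    congr 1
    rw [QuotientGroup.eq, mul_inv_rev, mul_assoc]
  simp only [key]
  by_cases hx : ∃ x ∈ I, ∃ y ∈ I, g⁻¹ * h = x * n * y
  · rw [if_pos hx]
    obtain ⟨x, hx, z, hz, e⟩ := hx
    obtain ⟨c, hc⟩ := h1 x hx
    have hc' : (y c)⁻¹ * (g⁻¹ * h) ∈ I := by
      rw [e, ← mul_assoc]
      exact mul_mem hc hz
    convert hasSum_ite_eq c (1 : ℂ) using 2 with c'
    by_cases hcc : c' = c
    · rw [hcc, if_pos hc', if_pos rfl]
    · rw [if_neg hcc, if_neg]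
      intro h4
      apply hcc
      apply h3
      have := mul_mem h4 (inv_mem hc')
      convert this using 1
      group
  · rw [if_neg hx]
    convert hasSum_zero using 2 with c
    rw [if_neg]
    intro h4
    refine hx ⟨y c * n⁻¹, h2 c, _, h4, ?_⟩
    group

end Hecke

/-! ### Passage to the loop group and the rank one computation -/

namespace AdmissibleLattice

variable {𝔤 : Type*} [LieRing 𝔤] [LieAlgebra ℂ 𝔤] [FiniteDimensional ℂ 𝔤] [IsKilling ℂ 𝔤]
variable {H : LieSubalgebra ℂ 𝔤} [H.IsCartanSubalgebra]
variable {V : Type*} [AddCommGroup V] [Module ℂ V] [LieRingModule 𝔤 V] [LieModule ℂ 𝔤 V]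
variable {C : ChevalleyBasis H} {κ : Type*} [Fintype κ] [DecidableEq κ]
variable (Λ : AdmissibleLattice C V κ) {k : Type u} [Field k] {L L' : LoopRing k}
variable {b : (rootSystem H).Base} {θ : H.root}

/-- Integrality is tested on the entries of `g` and of `g⁻¹`, and the embedding detects integral
entries and preserves their values at `ε = 0`. -/
theorem map_mem_bigIwahori_iff (ι : L.Embedding L') (hL' : L'.IsLocal) {g : GL κ L.F} :
    Matrix.GeneralLinearGroup.map ι.onF g ∈ Λ.bigIwahori L' b ↔ g ∈ Λ.bigIwahori L b := by
  have hev : ∀ g₀ : GL κ L.o, Matrix.GeneralLinearGroup.map L'.evalZero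
      (Matrix.GeneralLinearGroup.map ι.onO g₀) = Matrix.GeneralLinearGroup.map L.evalZero g₀ :=
    fun g₀ => Units.ext (by ext i j; exact ι.evalZero_onO _)
  have hincl : ∀ g₀ : GL κ L.o, Matrix.GeneralLinearGroup.map L'.incl
      (Matrix.GeneralLinearGroup.map ι.onO g₀) =
        Matrix.GeneralLinearGroup.map ι.onF (Matrix.GeneralLinearGroup.map L.incl g₀) :=
    fun g₀ => Units.ext (by ext i j; exact ι.incl_onO _)
  constructor
  · rintro ⟨h, hh, e⟩
    have h1 : ∀ i j, ∃ a, (g : Matrix κ κ L.F) i j = L.incl a := fun i j =>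
      ι.exists_incl _ _ (congrArg (fun x : GL κ L'.F => (x : Matrix κ κ L'.F) i j) e).symm
    have e' : Matrix.GeneralLinearGroup.map L'.incl h⁻¹ =
        Matrix.GeneralLinearGroup.map ι.onF g⁻¹ := by rw [map_inv, map_inv, e]
    have h2 : ∀ i j, ∃ a, ((g⁻¹ : GL κ L.F) : Matrix κ κ L.F) i j = L.incl a := fun i j =>
      ι.exists_incl _ _ (congrArg (fun x : GL κ L'.F => (x : Matrix κ κ L'.F) i j) e').symm
    choose A hA using h1
    choose B hB using h2
    have hA' : (Matrix.of A).map L.incl = (g : Matrix κ κ L.F) := by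
      ext i j; exact (hA i j).symm
    have hB' : (Matrix.of B).map L.incl = ((g⁻¹ : GL κ L.F) : Matrix κ κ L.F) := by
      ext i j; exact (hB i j).symm
    have hinj := Matrix.map_injective (m := κ) (n := κ) ι.incl_injective
    let g₀ : GL κ L.o :=
      { val := Matrix.of A
        inv := Matrix.of B
        val_inv := hinj (by
          beta_reduce
          rw [Matrix.map_mul, hA', hB', Units.mul_inv, Matrix.map_one _ (map_zero _) (map_one _)])
        inv_val := hinj (by
          beta_reduce
          rw [Matrix.map_mul, hA', hB', Units.inv_mul, Matrix.map_one _ (map_zero _) (map_one _)]) }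
    have hg₀ : Matrix.GeneralLinearGroup.map L.incl g₀ = g := Units.ext hA'
    rw [← hg₀, ← hincl] at e
    have e2 := GL_map_injective hL'.incl_injective e
    refine ⟨g₀, ?_, hg₀⟩
    have hh' : Matrix.GeneralLinearGroup.map L'.evalZero h ∈ Λ.borel b k := hh
    rw [e2, hev] at hh'
    exact hh'
  · rintro ⟨g₀, hg₀, rfl⟩
    refine ⟨Matrix.GeneralLinearGroup.map ι.onO g₀, ?_, hincl g₀⟩
    have : Matrix.GeneralLinearGroup.map L'.evalZero (Matrix.GeneralLinearGroup.map ι.onO g₀) ∈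
        Λ.borel b k := by rw [hev]; exact hg₀
    exact this

theorem map_mem_chevalleyGroup {F F' : Type*} [CommRing F] [CommRing F'] (φ : F →+* F')
    {g : GL κ F} (hg : g ∈ Λ.chevalleyGroup F) :
    Matrix.GeneralLinearGroup.map φ g ∈ Λ.chevalleyGroup F' := by
  have : Λ.chevalleyGroup F ≤ (Λ.chevalleyGroup F').comap (Matrix.GeneralLinearGroup.map φ) := by
    refine Λ.chevalleyGroup_le fun α f => ?_
    rw [Subgroup.mem_comap, map_rootElem]
    exact Subgroup.subset_closure ⟨α, _, rfl⟩
  exact this hg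

/-- The Iwahori subgroup in terms of its embedding in the loop group of a discretely valued
field. -/
theorem mem_iwahori_iff [(rootSystem H).IsIrreducible]
    (hV : Function.Injective (LieModule.toEnd ℂ 𝔤 V)) (ι : L.Embedding L')
    (hL' : L'.IsLocal) (hθ : IsHighestRoot b θ) (g : LoopGroup Λ L) :
    g ∈ iwahori Λ L b ↔ Matrix.GeneralLinearGroup.map ι.onF (g : GL κ L.F) ∈
      Λ.iwahoriGen L' b := by
  have h1 : g ∈ iwahori Λ L b ↔ (g : GL κ L.F) ∈ Λ.bigIwahori L b := Iff.rfl
  rw [h1, ← Λ.map_mem_bigIwahori_iff ι hL']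
  exact ⟨Λ.mem_iwahoriGen_of_mem_bigIwahori hV hL' hθ (Λ.map_mem_chevalleyGroup _ g.2),
    fun h => Λ.iwahoriGen_le_bigIwahori hV hL' h⟩

theorem map_xPos (ι : L.Embedding L') (j : Node b) (c : k) :
    Matrix.GeneralLinearGroup.map ι.onF (xPos Λ L b θ j c : GL κ L.F) =
      Λ.nodeElem L' b θ j c := by
  cases j with
  | none =>
    change Matrix.GeneralLinearGroup.map ι.onF (Λ.rootElem (negRoot θ) _) = _
    rw [map_rootElem, map_mul, ι.onF_const, ι.onF_eps, nodeElem, nodeLevel, zpow_one]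
    rfl
  | some i =>
    change Matrix.GeneralLinearGroup.map ι.onF (Λ.rootElem i.1 _) = _
    rw [map_rootElem, ι.onF_const, nodeElem, nodeLevel, zpow_zero, Units.val_one, mul_one]
    rfl

theorem map_xNeg (ι : L.Embedding L') (j : Node b) (c : k) :
    Matrix.GeneralLinearGroup.map ι.onF (xNeg Λ L b θ j c : GL κ L.F) =
      Λ.rootElem (negRoot (nodeRoot b θ j))
        (L'.const c * ((L'.eps ^ (-nodeLevel b j) : L'.Fˣ) : L'.F)) := by
  cases j with
  | none =>
    have h : ι.onF ((L.eps⁻¹ : L.Fˣ) : L.F) = ((L'.eps⁻¹ : L'.Fˣ) : L'.F) := by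
      have : Units.map (ι.onF : L.F →* L'.F) L.eps = L'.eps := Units.ext ι.onF_eps
      rw [← this, ← map_inv]
      rfl
    change Matrix.GeneralLinearGroup.map ι.onF (Λ.rootElem θ _) = _
    rw [map_rootElem, map_mul, ι.onF_const, h, nodeLevel, zpow_neg_one, nodeRoot, negRoot_negRoot]
  | some i =>
    change Matrix.GeneralLinearGroup.map ι.onF (Λ.rootElem (negRoot i.1) _) = _
    rw [map_rootElem, ι.onF_const, nodeLevel, neg_zero, zpow_zero, Units.val_one, mul_one]
    rfl

theorem nodeElem_add (j : Node b) (c d : k) :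
    Λ.nodeElem L b θ j (c + d) = Λ.nodeElem L b θ j c * Λ.nodeElem L b θ j d := by
  rw [nodeElem, map_add, add_mul, rootElem_add, nodeElem, nodeElem]

/-- In `SL₂`: `!![c, 1; -1, 0] = !![1, -c; 0, 1] * !![0, 1; -1, 0]`. -/
theorem map_yElem (ι : L.Embedding L') (j : Node b) (c : k) :
    Matrix.GeneralLinearGroup.map ι.onF (yElem Λ L b θ j c : GL κ L.F) =
      Λ.nodeElem L' b θ j (-c) * Λ.nodeWeyl L' b θ j := by
  rw [yElem, Subgroup.coe_mul, Subgroup.coe_mul, map_mul, map_mul, map_xPos, map_xPos, map_xNeg,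
    sub_eq_neg_add, nodeElem_add, mul_assoc, mul_assoc]
  congr 1
  rw [nodeWeyl, weylElem, ← mul_assoc, nodeElem, map_one, one_mul, map_neg, map_one, neg_one_mul,
    zpow_neg]

/-! ### The cosets in the double coset of a simple reflection -/

/-- Otherwise conjugation by `n_j` would put the root group of `-α_j` into the Iwahori subgroup. -/
theorem nodeWeyl_notMem_iwahoriGen (hV : Function.Injective (LieModule.toEnd ℂ 𝔤 V))
    (hL : L.IsLocal) (j : Node b) : Λ.nodeWeyl L b θ j ∉ Λ.iwahoriGen L b := by
  intro h
  refine (affPos_nodeAff (θ := θ) j).not_affNeg (Λ.affPos_of_hasRootGroup hV hL _ fun f hf => ?_)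
  refine Λ.iwahoriGen_le_bigIwahori hV hL ?_
  obtain ⟨f', hf', e⟩ := Λ.nodeWeyl_inv_conj_rootElem (θ := θ) hV j _ hf
  rw [affRefl_affNeg, affRefl_nodeAff, affNeg_affNeg] at hf' e
  have h1 := Λ.rootElem_mem_iwahoriGen hL (affPos_nodeAff j) hf'
  rw [← e] at h1
  rwa [Subgroup.mul_mem_cancel_right _ h, Subgroup.mul_mem_cancel_left _ (inv_mem h)] at h1

/-- The rank one identity behind the quadratic relation. -/
theorem exists_nodeWeyl_inv_conj_nodeElem (hV : Function.Injective (LieModule.toEnd ℂ 𝔤 V))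
    (hL : L.IsLocal) (j : Node b) {c : k} (hc : c ≠ 0) :
    ∃ y ∈ Λ.iwahoriGen L b, Λ.nodeWeyl L b θ j * Λ.nodeElem L b θ j c * Λ.nodeWeyl L b θ j =
      Λ.nodeElem L b θ j (-c⁻¹) * Λ.nodeWeyl L b θ j * y := by
  obtain ⟨v, hv, -⟩ := hL.exists_inclUnit_eq_constUnit (Units.mk0 c hc)
  set w : L.Fˣ := L.inclUnit v * L.eps ^ nodeLevel b j
  have hw : (w : L.F) = L.const c * ((L.eps ^ nodeLevel b j : L.Fˣ) : L.F) := by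
    simp only [w, hv]; rfl
  have hw' : ((w⁻¹ : L.Fˣ) : L.F) ∈ L.fil (affNeg (nodeAff b θ j)).2 := by
    simp only [w, mul_inv, Units.val_mul, ← map_inv, ← zpow_neg]
    exact LoopRing.incl_mul_mem_fil _ (LoopRing.eps_zpow_mem_fil _)
  obtain ⟨h, hh, eh⟩ := Λ.weylElem_mem_torus_mul (θ := θ) j v
  obtain ⟨f₂, hf₂, e₂⟩ := Λ.nodeWeyl_inv_conj_rootElem (θ := θ) hV j
    (affNeg (nodeAff b θ j)) hw'
  rw [affRefl_affNeg, affRefl_nodeAff, affNeg_affNeg] at hf₂ e₂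
  have e₃ := Λ.rootElem_eq_mul_weylElem hV (nodeRoot b θ j) w
  -- In `SL₂`, conjugation by `!![0, 1; -1, 0]` maps `!![1, 0; a, 1]` to `!![1, -a; 0, 1]`; the two
  -- powers of `ε` in the conjugation combine with the one in `w⁻¹` to leave level `nodeLevel b j`.
  have e₄ : Λ.nodeWeyl L b θ j * Λ.rootElem (negRoot (nodeRoot b θ j)) ((w⁻¹ : L.Fˣ) : L.F) *
      (Λ.nodeWeyl L b θ j)⁻¹ = Λ.nodeElem L b θ j (-c⁻¹) := by
    have h1 := Λ.rootElem_neg_conj hV (negRoot (nodeRoot b θ j)) (-(L.eps ^ nodeLevel b j)⁻¹)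
      ((w⁻¹ : L.Fˣ) : L.F)
    have h2 : -(-(L.eps ^ nodeLevel b j)⁻¹)⁻¹ = L.eps ^ nodeLevel b j := by
      apply Units.ext; simp
    rw [weylElem_negRoot Λ hV, h2, negRoot_negRoot] at h1
    rw [nodeWeyl, h1, nodeElem]
    congr 1
    have h3 : ((w⁻¹ : L.Fˣ) : L.F) =
        L.const c⁻¹ * (((L.eps ^ nodeLevel b j)⁻¹ : L.Fˣ) : L.F) := by
      simp only [w, mul_inv, Units.val_mul]
      rw [hv, ← map_inv]
      rfl
    rw [h3, map_neg]
    have h4 : ((L.eps ^ nodeLevel b j : L.Fˣ) : L.F) *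
        (((L.eps ^ nodeLevel b j)⁻¹ : L.Fˣ) : L.F) = 1 := Units.mul_inv _
    have h5 : (((-(L.eps ^ nodeLevel b j)⁻¹)⁻¹ : L.Fˣ) : L.F) =
        -((L.eps ^ nodeLevel b j : L.Fˣ) : L.F) := by
      rw [← neg_eq_iff_eq_neg, ← Units.val_neg, h2]
    rw [h5]
    linear_combination (-L.const c⁻¹ * ((L.eps ^ nodeLevel b j : L.Fˣ) : L.F)) * h4
  have hn := Λ.nodeWeyl_mul_self (L := L) (θ := θ) j
  refine ⟨h * (Λ.nodeWeyl L b θ j * Λ.nodeWeyl L b θ j) * Λ.rootElem (nodeAff b θ j).1 f₂,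
    mul_mem (Λ.torus_le_iwahoriGen (mul_mem hh hn))
      (Λ.rootElem_mem_iwahoriGen hL (affPos_nodeAff j) hf₂), ?_⟩
  rw [← e₂, ← e₄]
  conv_lhs => rw [nodeElem, ← hw, e₃, eh]
  simp only [affNeg, nodeAff]
  group

variable [(rootSystem H).IsIrreducible]

/-- Write `g` as `x_{α_j}(c) q` with `q` in the radical: then `g n = y_j(-c) (n⁻¹ q n)`. -/
theorem exists_yElem_inv_mul_mem (hV : Function.Injective (LieModule.toEnd ℂ 𝔤 V))
    (ι : L.Embedding L') (hL' : L'.IsLocal) (hθ : IsHighestRoot b θ) (j : Node b)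
    {g : LoopGroup Λ L} (hg : g ∈ iwahori Λ L b) :
    ∃ c, (yElem Λ L b θ j c)⁻¹ * (g * yElem Λ L b θ j 0) ∈ iwahori Λ L b := by
  rw [Λ.mem_iwahori_iff hV ι hL' hθ] at hg
  obtain ⟨c, hc⟩ := Λ.exists_nodeElem_inv_mul_mem hV hL' hθ j hg
  refine ⟨-c, ?_⟩
  rw [Λ.mem_iwahori_iff hV ι hL' hθ]
  simp only [Subgroup.coe_mul, Subgroup.coe_inv, map_mul, map_inv, map_yElem, neg_neg, neg_zero,
    nodeElem_zero, one_mul]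
  have := Λ.nodeRadical_le hL' hθ j (Λ.nodeWeyl_inv_conj_mem_nodeRadical hV hL' hθ j hc)
  convert this using 1
  group

theorem yElem_mul_inv_mem (hV : Function.Injective (LieModule.toEnd ℂ 𝔤 V))
    (ι : L.Embedding L') (hL' : L'.IsLocal) (hθ : IsHighestRoot b θ) (j : Node b) (c : k) :
    yElem Λ L b θ j c * (yElem Λ L b θ j 0)⁻¹ ∈ iwahori Λ L b := by
  rw [Λ.mem_iwahori_iff hV ι hL' hθ]
  simp only [Subgroup.coe_mul, Subgroup.coe_inv, map_mul, map_inv, map_yElem, neg_zero,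
    nodeElem_zero, one_mul]
  rw [mul_inv_cancel_right]
  exact Λ.nodeElem_mem_iwahoriGen hL' hθ j _

theorem yElem_mul_yElem_zero_mem (hV : Function.Injective (LieModule.toEnd ℂ 𝔤 V))
    (ι : L.Embedding L') (hL' : L'.IsLocal) (hθ : IsHighestRoot b θ) (j : Node b) (c : k) :
    yElem Λ L b θ j c * yElem Λ L b θ j 0 ∈ iwahori Λ L b := by
  rw [Λ.mem_iwahori_iff hV ι hL' hθ]
  simp only [Subgroup.coe_mul, map_mul, map_yElem, neg_zero, nodeElem_zero, one_mul]
  rw [mul_assoc]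
  exact mul_mem (Λ.nodeElem_mem_iwahoriGen hL' hθ j _)
    (Λ.torus_le_iwahoriGen (Λ.nodeWeyl_mul_self j))

/-- For `c ≠ d` the element is `n⁻¹ x_{α_j}(c - d) n`, which by the rank one identity lies in `I n
I`; membership in `I` would force `n ∈ I`. -/
theorem eq_of_yElem_inv_mul_mem (hV : Function.Injective (LieModule.toEnd ℂ 𝔤 V))
    (ι : L.Embedding L') (hL' : L'.IsLocal) (hθ : IsHighestRoot b θ) (j : Node b) (c d : k)
    (h : (yElem Λ L b θ j c)⁻¹ * yElem Λ L b θ j d ∈ iwahori Λ L b) : c = d := by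
  by_contra hcd
  rw [Λ.mem_iwahori_iff hV ι hL' hθ] at h
  simp only [Subgroup.coe_mul, Subgroup.coe_inv, map_mul, map_inv, map_yElem] at h
  have h1 : (Λ.nodeElem L' b θ j (-c) * Λ.nodeWeyl L' b θ j)⁻¹ *
      (Λ.nodeElem L' b θ j (-d) * Λ.nodeWeyl L' b θ j) =
      (Λ.nodeWeyl L' b θ j)⁻¹ * Λ.nodeElem L' b θ j (c - d) * Λ.nodeWeyl L' b θ j := by
    rw [mul_inv_rev, ← nodeElem_neg, neg_neg, sub_eq_add_neg, nodeElem_add]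
    group
  obtain ⟨t, ht, e⟩ := Λ.nodeWeyl_inv (L := L') (θ := θ) j
  obtain ⟨y, hy, e'⟩ := Λ.exists_nodeWeyl_inv_conj_nodeElem (θ := θ) hV hL' j (sub_ne_zero.2 hcd)
  rw [h1, e, mul_assoc, mul_assoc, ← mul_assoc _ (Λ.nodeElem L' b θ j (c - d)), e',
    Subgroup.mul_mem_cancel_left _ (Λ.torus_le_iwahoriGen ht),
    Subgroup.mul_mem_cancel_right _ hy,
    Subgroup.mul_mem_cancel_left _ (Λ.nodeElem_mem_iwahoriGen hL' hθ j _)] at h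
  exact Λ.nodeWeyl_notMem_iwahoriGen hV hL' j h

theorem yElem_inv_mul_yElem_mul_yElem_mem (hV : Function.Injective (LieModule.toEnd ℂ 𝔤 V))
    (ι : L.Embedding L') (hL' : L'.IsLocal) (hθ : IsHighestRoot b θ) (j : Node b) (c : k)
    {t : k} (ht : t ≠ 0) :
    (yElem Λ L b θ j (c - t⁻¹))⁻¹ * (yElem Λ L b θ j c * yElem Λ L b θ j t) ∈
      iwahori Λ L b := by
  rw [Λ.mem_iwahori_iff hV ι hL' hθ]
  simp only [Subgroup.coe_mul, Subgroup.coe_inv, map_mul, map_inv, map_yElem]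
  obtain ⟨y, hy, e⟩ := Λ.exists_nodeWeyl_inv_conj_nodeElem (θ := θ) hV hL' j (neg_ne_zero.2 ht)
  have e1 : Λ.nodeElem L' b θ j (-c) * Λ.nodeWeyl L' b θ j *
      (Λ.nodeElem L' b θ j (-t) * Λ.nodeWeyl L' b θ j) =
      Λ.nodeElem L' b θ j (-(c - t⁻¹)) * Λ.nodeWeyl L' b θ j * y := by
    have h1 : -(c - t⁻¹) = -c + -(-t)⁻¹ := by rw [inv_neg, neg_neg]; ring
    rw [h1, nodeElem_add, mul_assoc, ← mul_assoc (Λ.nodeWeyl L' b θ j), e]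
    group
  rw [e1, inv_mul_cancel_left]
  exact hy

theorem hasSum_yElem (hV : Function.Injective (LieModule.toEnd ℂ 𝔤 V))
    (ι : L.Embedding L') (hL' : L'.IsLocal) (hθ : IsHighestRoot b θ) (j : Node b)
    (g : LoopGroup Λ L) :
    HasSum (fun t : k => (⇑(cosetBasis (iwahori Λ L b) (g * yElem Λ L b θ j t)) :
      LoopGroup Λ L ⧸ iwahori Λ L b → ℂ))
      (heckeAct (iwahori Λ L b) (cosetBasis (iwahori Λ L b) g)
        (doubleCosetSum (iwahori Λ L b) (yElem Λ L b θ j 0))) :=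
  hasSum_heckeAct (fun _ hg => Λ.exists_yElem_inv_mul_mem hV ι hL' hθ j hg)
    (Λ.yElem_mul_inv_mem hV ι hL' hθ j) (Λ.eq_of_yElem_inv_mul_mem hV ι hL' hθ j) g

theorem cosetBasis_eq {G : Type*} [Group G] {I : Subgroup G} {g h : G} (H : g⁻¹ * h ∈ I) :
    cosetBasis I g = cosetBasis I h := by
  rw [cosetBasis, cosetBasis, QuotientGroup.eq.2 H]

theorem exists_hasSum_yElem (hV : Function.Injective (LieModule.toEnd ℂ 𝔤 V))
    (ι : L.Embedding L') (hL' : L'.IsLocal) (hθ : IsHighestRoot b θ) (j : Node b)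
    (g : LoopGroup Λ L) (c : k) :
    ∃ S : LoopGroup Λ L ⧸ iwahori Λ L b → ℂ,
      HasSum (fun t : kˣ => (⇑(cosetBasis (iwahori Λ L b)
        (g * yElem Λ L b θ j (c - ((t⁻¹ : kˣ) : k)))) :
          LoopGroup Λ L ⧸ iwahori Λ L b → ℂ)) S ∧
      heckeAct (iwahori Λ L b) (cosetBasis (iwahori Λ L b) (g * yElem Λ L b θ j c))
        (doubleCosetSum (iwahori Λ L b) (yElem Λ L b θ j 0)) =
          ⇑(cosetBasis (iwahori Λ L b) g) + S := by
  classical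
  have h1 := Λ.hasSum_yElem hV ι hL' hθ j (g * yElem Λ L b θ j c)
  -- The term `t = 0` is taken out of the sum. It is the coset of `g`, and the remaining terms are
  -- reindexed by the units of `k`.
  have h2 := hasSum_ite_sub_hasSum h1 0
  have h3 : cosetBasis (iwahori Λ L b) (g * yElem Λ L b θ j c * yElem Λ L b θ j 0) =
      cosetBasis (iwahori Λ L b) g := by
    refine (cosetBasis_eq ?_).symm
    rw [mul_assoc, inv_mul_cancel_left]
    exact Λ.yElem_mul_yElem_zero_mem hV ι hL' hθ j c
  refine ⟨_, ?_, (add_sub_cancel _ _).symm⟩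
  rw [h3] at h2
  rw [← Function.Injective.hasSum_iff (f := _) (g := (Units.val : kˣ → k)) Units.val_injective] at h2
  · refine (congrArg (fun f => HasSum f _) (funext fun t => ?_)).mpr h2
    rw [Function.comp_apply, if_neg t.ne_zero]
    refine congrArg _ (cosetBasis_eq ?_)
    have h4 := Λ.yElem_inv_mul_yElem_mul_yElem_mem hV ι hL' hθ j c t.ne_zero
    rw [Units.val_inv_eq_inv_val]
    convert h4 using 1
    group
  · intro t ht
    by_cases h0 : t = 0
    · rw [if_pos h0]
    · exact absurd ⟨Units.mk0 t h0, rfl⟩ ht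

end AdmissibleLattice

end AffineFlag

end

theorem mainTheorem3
    {𝔤 : Type*} [LieRing 𝔤] [LieAlgebra ℂ 𝔤] [FiniteDimensional ℂ 𝔤] [LieAlgebra.IsSimple ℂ 𝔤]
    (H : LieSubalgebra ℂ 𝔤) [H.IsCartanSubalgebra]
    (b : (LieAlgebra.IsKilling.rootSystem H).Base)
    (θ : H.root) (hθ : AffineFlag.IsHighestRoot b θ)
    (C : AffineFlag.ChevalleyBasis H)
    {V : Type*} [AddCommGroup V] [Module ℂ V] [LieRingModule 𝔤 V] [LieModule ℂ 𝔤 V]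
    (hV : Function.Injective (LieModule.toEnd ℂ 𝔤 V))
    {κ : Type*} [Fintype κ] [DecidableEq κ] (Λ : AffineFlag.AdmissibleLattice C V κ)
    {k : Type*} [Field k] (L : AffineFlag.LoopRing k)
    (hL : L = AffineFlag.LoopRing.series k ∨ L = AffineFlag.LoopRing.polynomial k)
    (w : AffineFlag.affineWeyl b θ) (p : List (AffineFlag.Node b × k))
    (hp : AffineFlag.IsReducedWord b θ (p.map Prod.fst) w) (j : AffineFlag.Node b) :
    let I := AffineFlag.iwahori Λ L b
    let coset : List (AffineFlag.Node b × k) → (AffineFlag.LoopGroup Λ L ⧸ I) →₀ ℂ :=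
      fun q => AffineFlag.cosetBasis I (AffineFlag.yWord Λ L b θ q)
    let T := AffineFlag.doubleCosetSum I (AffineFlag.nWord Λ L b θ [j])
    (AffineFlag.BruhatLT b θ (w * AffineFlag.simpleRefl b θ j) w →
      ∀ (p' : List (AffineFlag.Node b × k)) (c : k), p = p' ++ [(j, c)] →
        ∃ S : AffineFlag.LoopGroup Λ L ⧸ I → ℂ,
          HasSum (fun t : kˣ => (⇑(coset (p' ++ [(j, c - ((t⁻¹ : kˣ) : k))])) :
            AffineFlag.LoopGroup Λ L ⧸ I → ℂ)) S ∧
          AffineFlag.heckeAct I (coset p) T = ⇑(coset p') + S) ∧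
    (AffineFlag.BruhatLT b θ w (w * AffineFlag.simpleRefl b θ j) →
      HasSum (fun t : k => (⇑(coset (p ++ [(j, t)])) : AffineFlag.LoopGroup Λ L ⧸ I → ℂ))
        (AffineFlag.heckeAct I (coset p) T)) := by
  intro I coset T
  -- The Bruhat decomposition is used only over Laurent series, where nonzero elements are powers of
  -- `ε` times units of `o`; either loop ring embeds there.
  have hι : Nonempty (L.Embedding (AffineFlag.LoopRing.series k)) := by
    rcases hL with rfl | rfl
    · exact ⟨AffineFlag.LoopRing.seriesEmbedding k⟩
    · exact ⟨AffineFlag.LoopRing.polynomialEmbedding k⟩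
  obtain ⟨ι⟩ := hι
  have hL' := AffineFlag.LoopRing.series_isLocal k
  have hT : AffineFlag.nWord Λ L b θ [j] = AffineFlag.yElem Λ L b θ j 0 := by
    simp [AffineFlag.nWord]
  have hword : ∀ (q : List (AffineFlag.Node b × k)) (c : k),
      AffineFlag.yWord Λ L b θ (q ++ [(j, c)]) =
        AffineFlag.yWord Λ L b θ q * AffineFlag.yElem Λ L b θ j c := by
    intro q c
    simp [AffineFlag.yWord]
  simp only [coset, T, hT, hword]
  refine ⟨fun _ p' c hp' => ?_, fun _ => Λ.hasSum_yElem hV ι hL' hθ j _⟩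
  subst hp'
  rw [hword]
  exact Λ.exists_hasSum_yElem hV ι hL' hθ j _ c
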